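/- Let $\Omega\subset\mathbb R^3$ be a bounded domain with $C^\infty$ boundary and let $\Gamma\subset\partial\Omega$ be non-empty and relatively open. Let $d\in C^2(\overline\Omega)$ satisfy $d>0$ in $\Omega$, $|\nabla d|>0$ on $\overline\Omega$ and $d=0$ on $\partial\Omega\setminus\Gamma$. Let $T>0$, $t_0\in(0,T)$, $\delta=\min\{t_0,T-t_0\}$, and let $l\in C^\infty[0,T]$ satisfy $l>0$ on $(0,T)$, $l(t)=t$ for $0\le t\le\delta/2$, $l(t)=T-t$ for $T-\delta/2\le t\le T$, and $l(t_0)>l(t)$ for all $t\in(0,T)\setminus\{t_0\}$. For $\lambda>0$ set $$\varphi(x,t)=\frac{e^{\lambda d(x)}}{l(t)},\qquad \alpha(x,t)=\frac{e^{\lambda d(x)}-e^{2\lambda\|d\|_{C(\overline\Omega)}}}{l(t)} .$$ Let $A\in W^{1,\infty}(\Omega)$ be a $3\times3$ real matrix field and $b\in W^{2,\infty}(\Omega)$ a real vector field with values in $\mathbb R^3$, both identified with their continuous representatives on $\overline\Omega$, and define $$Pf=\mathrm{div}(fA)=A\nabla f+f\,\mathrm{div}A,\qquad Qg=\mathrm{rot}(gb)=\nabla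 g\times b+g\,\mathrm{rot}\,b,$$ where $[\mathrm{div}A]_k=\sum_{j=1}^3\partial_jA_{kj}$. Assume that $$\det A(x)\ne0\quad\text{and}\quad|\nabla d(x)\times b(x)|\neq0\qquad\text{for all }x\in\overline\Omega .$$ Then there exist constants $\lambda_0\ge1$, $s_0\ge1$ and $C>0$ (depending only on $\Omega,\Gamma,d,T,t_0,l,A,b$; in particular $C$ does not depend on $s,\lambda,f,g$) such that for all $\lambda\ge\lambda_0$, all $s\ge s_0$ and all real-valued $f\in H^1(\Omega)$, $g\in H^2(\Omega)$, $$\int_\Omega\big(|\nabla f|^2+s^2\lambda^2\varphi^2(x,t_0)|f|^2\big)e^{2s\alpha(x,t_0)}\,dx\le C\int_\Omega|Pf|^2e^{2s\alpha(x,t_0)}\,dx+C\int_\Gamma s\lambda\varphi(x,t_0)|f|^2e^{2s\alpha(x,t_0)}\,d\sigma$$ and $$\int_\Omega\big(|\nabla g|^2+s^2\lambda^2\varphi^2(x,t_0)|g|^2\big)e^{2s\alpha(x,t_0)}\,dx\le C\int_\Omega\Big(\frac{1}{s^2\lambda^2\varphi^2(x,t_0)}|\nabla(Qg)|^2+|Qg|^2\Big)e^{2s\alpha(x,t_0)}\,dx+C\int_{\partial\Omega}\Big(\frac{1}{s\lambda\varphi(x,t_0)}|\nabla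 g|^2+s\lambda\varphi(x,t_0)|g|^2\Big)e^{2s\alpha(x,t_0)}\,d\sigma .$$ Derivatives of $f$, $g$, $A$, $b$, $Qg$ are weak derivatives, $d\sigma$ is surface measure on $\partial\Omega$, and on $\partial\Omega$ the functions $f$, $g$, $\nabla g$ are understood as traces. -/

import Mathlib

open MeasureTheory Set Filter Topology
open scoped ContDiff

noncomputable section

namespace Carleman

/-- Euclidean three-space. -/
abbrev E3 : Type := EuclideanSpace ℝ (Fin 3)

/-- The classical partial derivative `∂ⱼ u`. -/
def pderiv (j : Fin 3) (u : E3 → ℝ) (x : E3) : ℝ :=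
  fderiv ℝ u x (EuclideanSpace.single j 1)

/-- The gradient on the closed set `closure Ω` of a function that is `C¹` up to the boundary. -/
def gradClosure (Ω : Set E3) (d : E3 → ℝ) (x : E3) : Fin 3 → ℝ :=
  fun j => fderivWithin ℝ d (closure Ω) x (EuclideanSpace.single j 1)

/-- `Ω` has `C^∞` boundary: near each boundary point, after choosing one of the coordinate axes
and an orientation of it, `Ω` is the region strictly above the graph of a smooth function of the
two other coordinates. -/
def HasSmoothBoundary (Ω : Set E3) : Prop :=
  ∀ p ∈ frontier Ω, ∃ r > (0 : ℝ), ∃ (i : Fin 3) (ε : ℝ) (γ : (Fin 2 → ℝ) → ℝ),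
    (ε = 1 ∨ ε = -1) ∧ ContDiff ℝ ∞ γ ∧
      ∀ x ∈ Metric.ball p r, x ∈ Ω ↔ γ (fun k => x (i.succAbove k)) < ε * x i

/-- A bounded domain (non-empty connected open set) with smooth boundary. -/
structure IsSmoothBoundedDomain (Ω : Set E3) : Prop where
  isOpen : IsOpen Ω
  isConnected : IsConnected Ω
  isBounded : Bornology.IsBounded Ω
  smoothBoundary : HasSmoothBoundary Ω

/-- `f'` is the weak derivative `∂ⱼ f` in the open set `Ω`. -/
structure HasWeakDeriv (Ω : Set E3) (j : Fin 3) (f f' : E3 → ℝ) : Prop where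
  locInt : LocallyIntegrableOn f Ω
  locInt' : LocallyIntegrableOn f' Ω
  integral_eq : ∀ ψ : E3 → ℝ, ContDiff ℝ ∞ ψ → HasCompactSupport ψ → tsupport ψ ⊆ Ω →
    ∫ x in Ω, f x * pderiv j ψ x = -∫ x in Ω, f' x * ψ x

open Classical in
/-- The weak derivative `∂ⱼ f` in `Ω` (unique up to null sets; `0` if there is none). -/
def weakDeriv (Ω : Set E3) (j : Fin 3) (f : E3 → ℝ) : E3 → ℝ :=
  if h : ∃ f', HasWeakDeriv Ω j f f' then h.choose else 0

theorem hasWeakDeriv_weakDeriv {Ω : Set E3} {j : Fin 3} {f : E3 → ℝ}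
    (h : ∃ f', HasWeakDeriv Ω j f f') : HasWeakDeriv Ω j f (weakDeriv Ω j f) := by
  rw [weakDeriv, dif_pos h]
  exact h.choose_spec

/-- Membership in the Sobolev space `W^{k,p}(Ω)`: all weak derivatives of order at most `k` exist
and belong to `L^p(Ω)`. -/
def MemW (Ω : Set E3) (p : ENNReal) : ℕ → (E3 → ℝ) → Prop
  | 0, f => MemLp f p (volume.restrict Ω)
  | k + 1, f => MemLp f p (volume.restrict Ω) ∧
      ∀ j, (∃ f', HasWeakDeriv Ω j f f') ∧ MemW Ω p k (weakDeriv Ω j f)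

/-- Surface measure on `∂Ω`: the two-dimensional Hausdorff measure, normalised so that it agrees
with area on planes, restricted to `∂Ω`. -/
def surfaceMeasure (Ω : Set E3) : Measure E3 :=
  (Measure.euclideanHausdorffMeasure 2 : Measure E3).restrict (frontier Ω)

/-- `τ` is the trace on `∂Ω` of `f ∈ H¹(Ω)`: for some functions `uₙ`, smooth on the whole space,
`uₙ → f` in `H¹(Ω)` and the restrictions of `uₙ` to `∂Ω` converge to `τ` in `L²(∂Ω)`. -/
structure IsTrace (Ω : Set E3) (f τ : E3 → ℝ) : Prop where
  memLp : MemLp τ 2 (surfaceMeasure Ω)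
  exists_approx : ∃ u : ℕ → E3 → ℝ, (∀ n, ContDiff ℝ ∞ (u n)) ∧
    Tendsto (fun n => eLpNorm (fun x => u n x - f x) 2 (volume.restrict Ω)) atTop (𝓝 0) ∧
    (∀ j, Tendsto (fun n => eLpNorm (fun x => pderiv j (u n) x - weakDeriv Ω j f x) 2
      (volume.restrict Ω)) atTop (𝓝 0)) ∧
    Tendsto (fun n => eLpNorm (fun x => u n x - τ x) 2 (surfaceMeasure Ω)) atTop (𝓝 0)

/-- The squared Euclidean length of a vector in `ℝ³`. -/
def sqNorm (v : Fin 3 → ℝ) : ℝ := ∑ i, v i ^ 2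

/-- The weak gradient `∇f`. -/
def weakGrad (Ω : Set E3) (f : E3 → ℝ) (x : E3) : Fin 3 → ℝ :=
  fun j => weakDeriv Ω j f x

/-- The row-wise divergence `[div A]ₖ = ∑ⱼ ∂ⱼ Aₖⱼ` of a matrix field. -/
def divMat (Ω : Set E3) (A : E3 → Matrix (Fin 3) (Fin 3) ℝ) (x : E3) : Fin 3 → ℝ :=
  fun k => ∑ j, weakDeriv Ω j (fun y => A y k j) x

/-- The rotation (curl) of a vector field. -/
def rot (Ω : Set E3) (b : E3 → Fin 3 → ℝ) (x : E3) : Fin 3 → ℝ :=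
  ![weakDeriv Ω 1 (fun y => b y 2) x - weakDeriv Ω 2 (fun y => b y 1) x,
    weakDeriv Ω 2 (fun y => b y 0) x - weakDeriv Ω 0 (fun y => b y 2) x,
    weakDeriv Ω 0 (fun y => b y 1) x - weakDeriv Ω 1 (fun y => b y 0) x]

/-- `P f = div (f A) = A ∇f + f div A`. -/
def opP (Ω : Set E3) (A : E3 → Matrix (Fin 3) (Fin 3) ℝ) (f : E3 → ℝ) (x : E3) : Fin 3 → ℝ :=
  (A x).mulVec (weakGrad Ω f x) + f x • divMat Ω A x

/-- `Q g = rot (g b) = ∇g × b + g rot b`. -/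
def opQ (Ω : Set E3) (b : E3 → Fin 3 → ℝ) (g : E3 → ℝ) (x : E3) : Fin 3 → ℝ :=
  crossProduct (weakGrad Ω g x) (b x) + g x • rot Ω b x

/-- `|∇v|²` for a vector field `v`, the sum of the squares of all `∂ₖ vᵢ`. -/
def sqNormGrad (Ω : Set E3) (v : E3 → Fin 3 → ℝ) (x : E3) : ℝ :=
  ∑ i, sqNorm (weakGrad Ω (fun y => v y i) x)

/-- The conditions on the function `d`: it is `C²` up to the boundary, positive in `Ω`, without
critical points on `closure Ω`, and zero on `∂Ω \ Γ`. -/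
structure IsWeightFunction (Ω Γ : Set E3) (d : E3 → ℝ) : Prop where
  contDiffOn : ContDiffOn ℝ 2 d (closure Ω)
  pos : ∀ x ∈ Ω, 0 < d x
  grad_ne_zero : ∀ x ∈ closure Ω, gradClosure Ω d x ≠ 0
  eq_zero : ∀ x ∈ frontier Ω \ Γ, d x = 0

/-- The conditions on the function of time `l`, where `δ = min t₀ (T - t₀)`. -/
structure IsTimeWeight (T t₀ : ℝ) (l : ℝ → ℝ) : Prop where
  contDiffOn : ContDiffOn ℝ ∞ l (Icc 0 T)
  pos : ∀ t ∈ Ioo 0 T, 0 < l t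
  eq_left : ∀ t ∈ Icc 0 (min t₀ (T - t₀) / 2), l t = t
  eq_right : ∀ t ∈ Icc (T - min t₀ (T - t₀) / 2) T, l t = T - t
  lt_max : ∀ t ∈ Ioo 0 T \ {t₀}, l t < l t₀

/-- `φ(x,t) = e^{λ d(x)} / l(t)`. -/
def phi (d : E3 → ℝ) (l : ℝ → ℝ) (lam : ℝ) (x : E3) (t : ℝ) : ℝ :=
  Real.exp (lam * d x) / l t

/-- `α(x,t) = (e^{λ d(x)} - e^{2 λ ‖d‖}) / l(t)`, where `‖d‖` is the maximum of `|d|` on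
`closure Ω`. -/
def alpha (Ω : Set E3) (d : E3 → ℝ) (l : ℝ → ℝ) (lam : ℝ) (x : E3) (t : ℝ) : ℝ :=
  (Real.exp (lam * d x) - Real.exp (2 * lam * sSup ((fun y => |d y|) '' closure Ω))) / l t

/-- The weight `e^{2 s α(x,t)}`. -/
def weight (Ω : Set E3) (d : E3 → ℝ) (l : ℝ → ℝ) (lam s : ℝ) (x : E3) (t : ℝ) : ℝ :=
  Real.exp (2 * s * alpha Ω d l lam x t)

end Carleman

end

open Carleman

noncomputable section

namespace Carleman

variable {Ω : Set E3}

/-! Both estimates are instances of one first-order estimate along a vector field `X` with `X·∇d ≥ κ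
> 0` on `closure Ω`. Put `q = sλφ` and `W = e^{kλd} e^{2sα}` at time `t₀`. Since `∇α = λφ∇d`, the
divergence of `q W u² X` equals `qW` times `((1+k)λ + 2q)(X·∇d)u² + 2u(X·∇u) + (div X)u²`. For large
`s` the term `2q²W(X·∇d)u²` dominates, and Young's inequality on the cross term gives a bound of `∫
q²Wu²` by `∫ W(X·∇u)²` and the boundary flux. Because `d ≥ 0`, `q ≥ sλ/l(t₀)`, so the threshold for
`s` does not depend on `λ` (`carleman_pointwise`, `exists_carleman_smooth`). The traces come with
smooth approximations, along which the estimate passes to Sobolev functions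
(`exists_carleman_estimate`).

For `P` take `X = ∇d`. Outside `Γ` the function `d` vanishes while it is positive in `Ω`, so `∇d`
points inwards, the flux has the favourable sign, and only `Γ` contributes. Invertibility of `A`
bounds `|∇f|` by `|Pf|` and `|f|`.

For `Q` only `∇g × b` is controlled. Since `(b×c)·∇v = c·(∇v×b)`, a field `X = b×c` with `c` close
to `∇d×b` is transversal to the level sets of `d`, and `X·∇g` is bounded by `Qg` and `g`. The
component of `∇g` along `b` is not read off from `Qg`; instead the same estimate is applied to each
`∂ₖg` with `k = -2`, where the weights become `1`, `1/q²` and `1/q`. This is the origin of the terms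
`|∇(Qg)|²/q²` and `|∇g|²/q` on the right. No sign of the flux is known, so all of `∂Ω` appears.

In both cases the lower-order errors are at most `l(t₀)²/s²` times the left-hand side, up to
constants, and are absorbed (`le_two_mul_of_le_mul_add`). The flux only has to be bounded, not
computed: `IsSmoothBoundedDomain.exists_flux_bound` works in graph charts with cut-offs in the
height above the graph, and compares coordinate area with surface measure. -/

/-! ### Weak derivatives: C¹ test functions, uniqueness, symmetry and product rules -/

theorem setIntegral_eq_of_eq_zero_of_notMem {g : E3 → ℝ} {K : Set E3} (hK : MeasurableSet K)
    (hKΩ : K ⊆ Ω) (hg : ∀ x ∉ K, g x = 0) : ∫ x in Ω, g x = ∫ x in K, g x := by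
  rw [← integral_indicator hK, ← setIntegral_eq_integral_of_forall_compl_eq_zero (s := Ω) (μ := volume)
    (f := K.indicator g)]
  · refine integral_congr_ae (Eventually.of_forall fun x => ?_)
    by_cases hx : x ∈ K
    · simp [hx]
    · simp [hx, hg x hx]
  · intro x hx
    exact indicator_of_notMem (fun h => hx (hKΩ h)) g

theorem integrableOn_mul_of_support_subset {f : E3 → ℝ} (hf : LocallyIntegrableOn f Ω)
    {K : Set E3} (hK : IsCompact K) (hKΩ : K ⊆ Ω) {g : E3 → ℝ} (hg : Continuous g)
    (hs : ∀ x ∉ K, g x = 0) : Integrable (fun x => f x * g x) := by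
  have h1 : IntegrableOn (fun x => f x * g x) K :=
    (hf.integrableOn_compact_subset hKΩ hK).mul_continuousOn hg.continuousOn hK
  rw [← integrableOn_univ]
  exact h1.of_forall_sdiff_eq_zero MeasurableSet.univ fun x hx => by simp [hs x hx.2]

/-- Dominated convergence against a locally integrable function, for bounded continuous functions
with supports in a fixed compact subset. -/
theorem tendsto_setIntegral_mul_of_support_subset {f : E3 → ℝ} (hf : LocallyIntegrableOn f Ω)
    {K : Set E3} (hK : IsCompact K) (hKΩ : K ⊆ Ω) {h : ℕ → E3 → ℝ} {h₀ : E3 → ℝ} {M : ℝ}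
    (hc : ∀ n, Continuous (h n)) (hM : ∀ n x, |h n x| ≤ M) (hs : ∀ n, ∀ x ∉ K, h n x = 0)
    (hlim : ∀ x, Tendsto (fun n => h n x) atTop (𝓝 (h₀ x))) :
    Tendsto (fun n => ∫ x in Ω, f x * h n x) atTop (𝓝 (∫ x in Ω, f x * h₀ x)) := by
  have hfK : IntegrableOn f K := hf.integrableOn_compact_subset hKΩ hK
  have key : ∀ g : E3 → ℝ, (∀ x ∉ K, g x = 0) →
      ∫ x in Ω, f x * g x = ∫ x in K, f x * g x := fun g hg => by
    exact setIntegral_eq_of_eq_zero_of_notMem hK.measurableSet hKΩ fun x hx => by simp [hg x hx]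
  have h0 : ∀ x ∉ K, h₀ x = 0 := fun x hx =>
    tendsto_nhds_unique (hlim x) (by simp [hs _ x hx])
  rw [key _ h0]
  simp_rw [fun n => key _ (hs n)]
  refine tendsto_integral_of_dominated_convergence (fun x => ‖f x‖ * M) ?_ ?_ ?_ ?_
  · exact fun n => hfK.aestronglyMeasurable.mul (hc n).aestronglyMeasurable
  · exact hfK.norm.mul_const M
  · intro n
    refine Eventually.of_forall fun x => ?_
    rw [norm_mul]
    gcongr
    exact hM n x
  · exact Eventually.of_forall fun x => (hlim x).const_mul _

theorem abs_pderiv_le (j : Fin 3) (u : E3 → ℝ) (x : E3) : |pderiv j u x| ≤ ‖fderiv ℝ u x‖ := by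
  have := (fderiv ℝ u x).le_opNorm (EuclideanSpace.single j 1)
  simpa [pderiv] using this

theorem continuous_pderiv {u : E3 → ℝ} (hu : ContDiff ℝ 1 u) (j : Fin 3) :
    Continuous (pderiv j u) :=
  (hu.continuous_fderiv one_ne_zero).clm_apply continuous_const

theorem hasCompactSupport_pderiv {u : E3 → ℝ} (hu : HasCompactSupport u) (j : Fin 3) :
    HasCompactSupport (pderiv j u) :=
  (hu.fderiv ℝ).comp_left (g := fun L : E3 →L[ℝ] ℝ => L (EuclideanSpace.single j 1)) rfl

theorem pderiv_eq_zero_of_notMem {u : E3 → ℝ} {j : Fin 3} {x : E3} (hx : x ∉ tsupport u) :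
    pderiv j u x = 0 := by
  simp [pderiv, fderiv_of_notMem_tsupport ℝ hx]

/-- The defining identity of the weak derivative extends to `C¹` test functions. -/
theorem HasWeakDeriv.integral_eq_of_contDiff_one {j : Fin 3} {f f' : E3 → ℝ}
    (h : HasWeakDeriv Ω j f f') (hΩ : IsOpen Ω) {ψ : E3 → ℝ} (hψ : ContDiff ℝ 1 ψ)
    (hcs : HasCompactSupport ψ) (hsub : tsupport ψ ⊆ Ω) :
    ∫ x in Ω, f x * pderiv j ψ x = -∫ x in Ω, f' x * ψ x := by
  obtain ⟨δ, hδ, hδΩ⟩ := hcs.isCompact.exists_cthickening_subset_open hΩ hsub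
  set K := Metric.cthickening δ (tsupport ψ) with hKdef
  have hK : IsCompact K := hcs.isCompact.cthickening
  -- Mollifiers of radius at most `δ`: all mollified test functions then live in the one compact set
  -- `K ⊆ Ω`, as dominated convergence requires.
  let φ : ℕ → ContDiffBump (0 : E3) := fun n =>
    ⟨δ / (n + 1) / 2, δ / (n + 1), by positivity, half_lt_self (by positivity)⟩
  have hφle : ∀ n, (φ n).rOut ≤ δ := fun n => by
    change δ / (n + 1) ≤ δ
    exact div_le_self hδ.le (by linarith [n.cast_nonneg (α := ℝ)])
  have hφlim : Tendsto (fun n => (φ n).rOut) atTop (𝓝 0) := by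
    have := (tendsto_one_div_add_atTop_nhds_zero_nat (𝕜 := ℝ)).const_mul δ
    simpa [φ, div_eq_mul_inv] using this
  let L := ContinuousLinearMap.lsmul ℝ ℝ (E := ℝ)
  let c : (E3 → ℝ) → ℕ → E3 → ℝ := fun g n => convolution ((φ n).normed volume) g L volume
  have hφcd : ∀ n, ContDiff ℝ ∞ ((φ n).normed volume) := fun n => (φ n).contDiff_normed
  have hφcs : ∀ n, HasCompactSupport ((φ n).normed volume) := fun n => (φ n).hasCompactSupport_normed
  have hφli : ∀ n, LocallyIntegrable ((φ n).normed volume) volume := fun n =>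
    (hφcd n).continuous.locallyIntegrable
  have hsm : ∀ n, ContDiff ℝ ∞ (c ψ n) := fun n =>
    (hφcs n).contDiff_convolution_left _ (hφcd n) hψ.continuous.locallyIntegrable
  have hcont : ∀ g : E3 → ℝ, Continuous g → ∀ n, Continuous (c g n) := fun g hg n =>
    ((hφcs n).contDiff_convolution_left (n := ⊤) L (hφcd n) hg.locallyIntegrable).continuous
  have hsupp : ∀ g : E3 → ℝ, (∀ x ∉ tsupport ψ, g x = 0) → ∀ n, ∀ x ∉ K, c g n x = 0 := by
    intro g hg n x hx
    refine ((φ n).normed_convolution_eq_right (x₀ := x) (g := g) (μ := volume) ?_).trans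
      (hg x fun h => hx (Metric.self_subset_cthickening _ h))
    intro y hy
    rw [hg x fun h => hx (Metric.self_subset_cthickening _ h)]
    refine hg y fun hy' => hx ?_
    refine Metric.mem_cthickening_of_dist_le x y δ _ hy' ?_
    rw [dist_comm]
    exact (Metric.mem_ball.1 hy).le.trans (hφle n)
  have hlim : ∀ g : E3 → ℝ, Continuous g → ∀ x, Tendsto (fun n => c g n x) atTop (𝓝 (g x)) :=
    fun g hg x => ContDiffBump.convolution_tendsto_right_of_continuous hφlim hg x
  have hbd : ∀ g : E3 → ℝ, Continuous g → ∀ M, (∀ x, |g x| ≤ M) → ∀ n x, |c g n x| ≤ M := by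
    intro g hg M hM n x
    have := dist_convolution_le (f := (φ n).normed volume) (g := g) (μ := volume) (x₀ := x)
      (z₀ := (0 : ℝ)) ((abs_nonneg _).trans (hM x))
      (φ n).support_normed_eq.subset (φ n).nonneg_normed (φ n).integral_normed
      hg.aestronglyMeasurable (fun y _ => by simpa using hM y)
    simpa using this
  -- The derivative is moved onto `ψ`, so the derivatives of the approximants are mollifications of
  -- the continuous function `∂ⱼψ` and stay bounded.
  have hder : ∀ n x, pderiv j (c ψ n) x = c (pderiv j ψ) n x := by
    intro n x
    have h1 := hcs.hasFDerivAt_convolution_right L (hφli n) hψ x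
    rw [pderiv, h1.fderiv]
    exact convolution_precompR_apply L (hφli n) (hcs.fderiv ℝ)
      (hψ.continuous_fderiv one_ne_zero) x _
  obtain ⟨M, hM⟩ := hcs.exists_bound_of_continuous hψ.continuous
  obtain ⟨M', hM'⟩ := (hasCompactSupport_pderiv hcs j).exists_bound_of_continuous
    (continuous_pderiv hψ j)
  have hz : ∀ x ∉ tsupport ψ, ψ x = 0 := fun x hx => image_eq_zero_of_notMem_tsupport hx
  have t1 := tendsto_setIntegral_mul_of_support_subset h.locInt hK hδΩ (h₀ := pderiv j ψ)
    (hcont _ (continuous_pderiv hψ j)) (hbd _ (continuous_pderiv hψ j) M' hM')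
    (hsupp _ fun x hx => pderiv_eq_zero_of_notMem hx) (hlim _ (continuous_pderiv hψ j))
  have t2 := tendsto_setIntegral_mul_of_support_subset h.locInt' hK hδΩ (h₀ := ψ)
    (hcont _ hψ.continuous) (hbd _ hψ.continuous M hM)
    (hsupp _ hz) (hlim _ hψ.continuous)
  refine tendsto_nhds_unique t1 (t2.neg.congr fun n => ?_)
  have hsub' : tsupport (c ψ n) ⊆ K := by
    refine closure_minimal (fun x hx => ?_) hK.isClosed
    by_contra hxK
    exact hx (hsupp ψ hz n x hxK)
  have := h.integral_eq (c ψ n) (hsm n) (HasCompactSupport.of_support_subset_isCompact hK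
    (subset_closure.trans hsub')) (hsub'.trans hδΩ)
  rw [← this]
  simp_rw [hder]

theorem hasWeakDeriv_ae_eq (hΩ : IsOpen Ω) {j : Fin 3} {f f₁ f₂ : E3 → ℝ}
    (h₁ : HasWeakDeriv Ω j f f₁) (h₂ : HasWeakDeriv Ω j f f₂) :
    f₁ =ᵐ[volume.restrict Ω] f₂ := by
  have : ∀ᵐ x, x ∈ Ω → (f₁ - f₂) x = 0 := by
    refine hΩ.ae_eq_zero_of_integral_contDiff_smul_eq_zero (h₁.locInt'.sub h₂.locInt') ?_
    intro g hg hgc hgs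
    have hz : ∀ x ∉ tsupport g, g x = 0 := fun x hx => image_eq_zero_of_notMem_tsupport hx
    have e₁ := integrableOn_mul_of_support_subset h₁.locInt' hgc.isCompact hgs hg.continuous hz
    have e₂ := integrableOn_mul_of_support_subset h₂.locInt' hgc.isCompact hgs hg.continuous hz
    rw [← setIntegral_eq_integral_of_forall_compl_eq_zero (s := Ω) fun x hx => by
      simp [hz x fun h => hx (hgs h)]]
    have e₃ : ∫ x in Ω, g x • (f₁ - f₂) x = ∫ x in Ω, (f₁ x * g x - f₂ x * g x) :=
      integral_congr_ae (Eventually.of_forall fun x => by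
        simp only [Pi.sub_apply, smul_eq_mul]; ring)
    rw [e₃, integral_sub e₁.integrableOn e₂.integrableOn]
    linarith [h₁.integral_eq g hg hgc hgs, h₂.integral_eq g hg hgc hgs]
  filter_upwards [(ae_restrict_iff' hΩ.measurableSet).2 this] with x hx
  simpa [sub_eq_zero] using hx

theorem weakDeriv_ae_eq (hΩ : IsOpen Ω) {j : Fin 3} {f f' : E3 → ℝ}
    (h : HasWeakDeriv Ω j f f') : weakDeriv Ω j f =ᵐ[volume.restrict Ω] f' :=
  hasWeakDeriv_ae_eq hΩ (hasWeakDeriv_weakDeriv ⟨f', h⟩) h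

theorem pderiv_comm {u : E3 → ℝ} (hu : ContDiff ℝ 2 u) (i j : Fin 3) (x : E3) :
    pderiv i (pderiv j u) x = pderiv j (pderiv i u) x := by
  have hd : DifferentiableAt ℝ (fderiv ℝ u) x :=
    (hu.fderiv_right (m := 1) le_rfl).differentiable one_ne_zero x
  have e : ∀ i j : Fin 3, pderiv i (pderiv j u) x =
      fderiv ℝ (fderiv ℝ u) x (EuclideanSpace.single i 1) (EuclideanSpace.single j 1) := by
    intro i j
    have := (hd.hasFDerivAt.clm_apply (hasFDerivAt_const (EuclideanSpace.single j (1 : ℝ)) x)).fderiv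
    change fderiv ℝ (fun y => fderiv ℝ u y (EuclideanSpace.single j 1)) x _ = _
    rw [this]
    simp
  rw [e, e]
  exact hu.contDiffAt.isSymmSndFDerivAt (by simp) _ _

theorem contDiff_pderiv {u : E3 → ℝ} (hu : ContDiff ℝ ∞ u) (j : Fin 3) :
    ContDiff ℝ ∞ (pderiv j u) :=
  (hu.fderiv_right (m := ∞) (by simp)).clm_apply contDiff_const

theorem tsupport_pderiv_subset (u : E3 → ℝ) (j : Fin 3) : tsupport (pderiv j u) ⊆ tsupport u := by
  refine closure_minimal (fun x hx => ?_) (isClosed_tsupport u)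
  by_contra h
  exact hx (pderiv_eq_zero_of_notMem h)

/-- Second weak derivatives commute. -/
theorem HasWeakDeriv.comm {i k : Fin 3} {g gi gk gik : E3 → ℝ} (hi : HasWeakDeriv Ω i g gi)
    (hk : HasWeakDeriv Ω k g gk) (hik : HasWeakDeriv Ω k gi gik) : HasWeakDeriv Ω i gk gik where
  locInt := hk.locInt'
  locInt' := hik.locInt'
  integral_eq ψ hψ hc hs := by
    have h1 := hk.integral_eq (pderiv i ψ) (contDiff_pderiv hψ i) (hasCompactSupport_pderiv hc i)
      ((tsupport_pderiv_subset ψ i).trans hs)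
    have h2 := hi.integral_eq (pderiv k ψ) (contDiff_pderiv hψ k) (hasCompactSupport_pderiv hc k)
      ((tsupport_pderiv_subset ψ k).trans hs)
    have h3 := hik.integral_eq ψ hψ hc hs
    have hψ2 : ContDiff ℝ 2 ψ := by exact_mod_cast contDiff_infty.1 hψ 2
    simp only [pderiv_comm hψ2 k i] at h1
    linarith

theorem HasWeakDeriv.sub {j : Fin 3} {f f' g g' : E3 → ℝ} (hf : HasWeakDeriv Ω j f f')
    (hg : HasWeakDeriv Ω j g g') :
    HasWeakDeriv Ω j (fun x => f x - g x) (fun x => f' x - g' x) where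
  locInt := hf.locInt.sub hg.locInt
  locInt' := hf.locInt'.sub hg.locInt'
  integral_eq ψ hψ hc hs := by
    have hz : ∀ x ∉ tsupport ψ, ψ x = 0 := fun x hx => image_eq_zero_of_notMem_tsupport hx
    have hz' : ∀ x ∉ tsupport ψ, pderiv j ψ x = 0 := fun x hx => pderiv_eq_zero_of_notMem hx
    have c' := (contDiff_pderiv hψ j).continuous
    simp_rw [sub_mul]
    rw [integral_sub, integral_sub, hf.integral_eq ψ hψ hc hs, hg.integral_eq ψ hψ hc hs]
    · ring
    · exact (integrableOn_mul_of_support_subset hf.locInt' hc.isCompact hs hψ.continuous hz).integrableOn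
    · exact (integrableOn_mul_of_support_subset hg.locInt' hc.isCompact hs hψ.continuous hz).integrableOn
    · exact (integrableOn_mul_of_support_subset hf.locInt hc.isCompact hs c' hz').integrableOn
    · exact (integrableOn_mul_of_support_subset hg.locInt hc.isCompact hs c' hz').integrableOn

theorem HasWeakDeriv.add {j : Fin 3} {f f' g g' : E3 → ℝ} (hf : HasWeakDeriv Ω j f f')
    (hg : HasWeakDeriv Ω j g g') :
    HasWeakDeriv Ω j (fun x => f x + g x) (fun x => f' x + g' x) where
  locInt := hf.locInt.add hg.locInt
  locInt' := hf.locInt'.add hg.locInt'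
  integral_eq ψ hψ hc hs := by
    have hz : ∀ x ∉ tsupport ψ, ψ x = 0 := fun x hx => image_eq_zero_of_notMem_tsupport hx
    have hz' : ∀ x ∉ tsupport ψ, pderiv j ψ x = 0 := fun x hx => pderiv_eq_zero_of_notMem hx
    have c' := (contDiff_pderiv hψ j).continuous
    simp_rw [add_mul]
    rw [integral_add, integral_add, hf.integral_eq ψ hψ hc hs, hg.integral_eq ψ hψ hc hs]
    · ring
    · exact (integrableOn_mul_of_support_subset hf.locInt' hc.isCompact hs hψ.continuous hz).integrableOn
    · exact (integrableOn_mul_of_support_subset hg.locInt' hc.isCompact hs hψ.continuous hz).integrableOn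
    · exact (integrableOn_mul_of_support_subset hf.locInt hc.isCompact hs c' hz').integrableOn
    · exact (integrableOn_mul_of_support_subset hg.locInt hc.isCompact hs c' hz').integrableOn

theorem pderiv_mul {u v : E3 → ℝ} {x : E3} (hu : DifferentiableAt ℝ u x)
    (hv : DifferentiableAt ℝ v x) (j : Fin 3) :
    pderiv j (fun y => u y * v y) x = pderiv j u x * v x + u x * pderiv j v x := by
  simp [pderiv, fderiv_fun_mul hu hv]
  ring

/-- Product rule for the weak derivative, with a factor that is `C¹` in `Ω`. -/
theorem HasWeakDeriv.mul_contDiff (hΩ : IsOpen Ω) {j : Fin 3} {f f' c : E3 → ℝ}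
    (hf : HasWeakDeriv Ω j f f') (hc : ContDiff ℝ 1 c) :
    HasWeakDeriv Ω j (fun x => f x * c x) (fun x => f' x * c x + f x * pderiv j c x) where
  locInt := hf.locInt.mul_continuousOn hc.continuous.continuousOn hΩ.isLocallyClosed
  locInt' := (hf.locInt'.mul_continuousOn hc.continuous.continuousOn
    hΩ.isLocallyClosed).add (hf.locInt.mul_continuousOn
      (continuous_pderiv hc j).continuousOn hΩ.isLocallyClosed)
  integral_eq ψ hψ hs hsub := by
    have hψ1 : ContDiff ℝ 1 ψ := hψ.of_le (by exact_mod_cast le_top)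
    have hz : ∀ x ∉ tsupport ψ, ψ x = 0 := fun x hx => image_eq_zero_of_notMem_tsupport hx
    have hz' : ∀ x ∉ tsupport ψ, pderiv j ψ x = 0 := fun x hx => pderiv_eq_zero_of_notMem hx
    have hts : tsupport (fun x => c x * ψ x) ⊆ tsupport ψ :=
      closure_mono fun x hx => right_ne_zero_of_mul hx
    -- The test function `c ψ` is only `C¹`, which is why the defining identity was extended beyond
    -- smooth test functions.
    have h := hf.integral_eq_of_contDiff_one hΩ (hc.mul hψ1) (hs.mul_left (f := c))
      (hts.trans hsub)
    have e : ∀ x, f x * pderiv j (fun x => c x * ψ x) x =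
        f x * (c x * pderiv j ψ x) + f x * (pderiv j c x * ψ x) := fun x => by
      rw [pderiv_mul (hc.differentiable one_ne_zero x) (hψ1.differentiable one_ne_zero x)]; ring
    have e' : ∀ x, (f' x * c x + f x * pderiv j c x) * ψ x =
        f' x * (c x * ψ x) + f x * (pderiv j c x * ψ x) := fun x => by ring
    have i1 := integrableOn_mul_of_support_subset hf.locInt hs.isCompact hsub
      (hc.continuous.mul (continuous_pderiv hψ1 j)) fun x hx => by simp [hz' x hx]
    have i2 := integrableOn_mul_of_support_subset hf.locInt hs.isCompact hsub
      ((continuous_pderiv hc j).mul hψ.continuous) fun x hx => by simp [hz x hx]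
    have i3 := integrableOn_mul_of_support_subset hf.locInt' hs.isCompact hsub
      (hc.continuous.mul hψ.continuous) fun x hx => by simp [hz x hx]
    simp_rw [e']
    simp_rw [e] at h
    simp only [Pi.mul_apply] at i1 i2 i3
    rw [integral_add i1.integrableOn i2.integrableOn] at h
    rw [integral_add i3.integrableOn i2.integrableOn]
    simp_rw [mul_assoc]
    linarith

theorem tendsto_integral_mul_of_tendsto_eLpNorm {μ : Measure E3} {u : ℕ → E3 → ℝ} {h k : E3 → ℝ}
    (hu : ∀ n, AEStronglyMeasurable (u n) μ) (hh : MemLp h 2 μ) (hk : MemLp k 2 μ)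
    (ht : Tendsto (fun n => eLpNorm (fun x => u n x - h x) 2 μ) atTop (𝓝 0)) :
    Tendsto (fun n => ∫ x, u n x * k x ∂μ) atTop (𝓝 (∫ x, h x * k x ∂μ)) ∧
      ∀ᶠ n in atTop, Integrable (fun x => u n x * k x) μ := by
  have hhk : Integrable (fun x => h x * k x) μ := hh.integrable_mul hk
  have hev : ∀ᶠ n in atTop, Integrable (fun x => u n x * k x) μ := by
    -- The threshold `1` only makes the norm finite; for early `n` the difference need not lie in
    -- `L²`.
    filter_upwards [ht.eventually_lt_const (show (0 : ENNReal) < 1 by simp)] with n hn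
    have : MemLp (fun x => u n x - h x) 2 μ :=
      ⟨(hu n).sub hh.aestronglyMeasurable, hn.trans (by simp)⟩
    have := (this.add hh).integrable_mul hk
    refine this.congr (Eventually.of_forall fun x => ?_)
    simp
  refine ⟨?_, hev⟩
  refine tendsto_integral_of_L1 _ hhk.aestronglyMeasurable hev ?_
  have hb : ∀ n, ∫⁻ x, ‖u n x * k x - h x * k x‖ₑ ∂μ ≤
      eLpNorm (fun x => u n x - h x) 2 μ * eLpNorm k 2 μ := fun n => by
    have := eLpNorm_smul_le_mul_eLpNorm (p := 2) (q := 2) (r := 1) (μ := μ) hk.aestronglyMeasurable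
      ((hu n).sub hh.aestronglyMeasurable)
    rw [eLpNorm_one_eq_lintegral_enorm] at this
    refine le_trans (le_of_eq ?_) this
    refine lintegral_congr fun x => ?_
    simp [sub_mul]
  refine tendsto_of_tendsto_of_tendsto_of_le_of_le tendsto_const_nhds ?_ (fun _ => zero_le) hb
  simpa using ENNReal.Tendsto.mul_const ht (Or.inr hk.eLpNorm_ne_top)

/-- Product rule for the weak derivative of the product of a function in the closure of the smooth
functions in the Sobolev norm and a function in `W^{1,∞}`. -/
theorem HasWeakDeriv.mul_of_tendsto {j : Fin 3} {h h' β β' : E3 → ℝ}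
    (hh : MemLp h 2 (volume.restrict Ω)) (hh' : MemLp h' 2 (volume.restrict Ω))
    (hβ : MemLp β ⊤ (volume.restrict Ω)) (hβ' : MemLp β' ⊤ (volume.restrict Ω))
    (hw : HasWeakDeriv Ω j β β') {u : ℕ → E3 → ℝ} (hu : ∀ n, ContDiff ℝ ∞ (u n))
    (t1 : Tendsto (fun n => eLpNorm (fun x => u n x - h x) 2 (volume.restrict Ω)) atTop (𝓝 0))
    (t2 : Tendsto (fun n => eLpNorm (fun x => pderiv j (u n) x - h' x) 2 (volume.restrict Ω))
      atTop (𝓝 0)) :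
    HasWeakDeriv Ω j (fun x => h x * β x) (fun x => h' x * β x + h x * β' x) := by
  have m1 : MemLp (fun x => h x * β x) 2 (volume.restrict Ω) := hβ.mul' hh
  have m2 : MemLp (fun x => h' x * β x + h x * β' x) 2 (volume.restrict Ω) :=
    (hβ.mul' hh').add (hβ'.mul' hh)
  refine ⟨?_, ?_, fun ψ hψ hc hs => ?_⟩
  · exact locallyIntegrableOn_of_locallyIntegrable_restrict (m1.locallyIntegrable (by norm_num))
  · exact locallyIntegrableOn_of_locallyIntegrable_restrict (m2.locallyIntegrable (by norm_num))
  have mψ : MemLp ψ 2 (volume.restrict Ω) := (hψ.continuous.memLp_of_hasCompactSupport hc).restrict _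
  have mψ' : MemLp (pderiv j ψ) 2 (volume.restrict Ω) :=
    ((contDiff_pderiv hψ j).continuous.memLp_of_hasCompactSupport
      (hasCompactSupport_pderiv hc j)).restrict _
  have c1 := tendsto_integral_mul_of_tendsto_eLpNorm (fun n => (hu n).continuous.aestronglyMeasurable)
    hh (hβ.mul' mψ' : MemLp (fun x => pderiv j ψ x * β x) 2 _) t1
  have c2 := tendsto_integral_mul_of_tendsto_eLpNorm (fun n => (hu n).continuous.aestronglyMeasurable)
    hh (hβ'.mul' mψ : MemLp (fun x => ψ x * β' x) 2 _) t1
  have c3 := tendsto_integral_mul_of_tendsto_eLpNorm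
    (fun n => (contDiff_pderiv (hu n) j).continuous.aestronglyMeasurable)
    hh' (hβ.mul' mψ : MemLp (fun x => ψ x * β x) 2 _) t2
  -- The weak derivative of `β` is tested against `uₙψ`. Every term is then a pairing of an
  -- `L²`-convergent sequence with a fixed `L²` function.
  have key : ∀ᶠ n in atTop, ∫ x in Ω, u n x * (pderiv j ψ x * β x) =
      -(∫ x in Ω, pderiv j (u n) x * (ψ x * β x)) - ∫ x in Ω, u n x * (ψ x * β' x) := by
    filter_upwards [c1.2, c2.2, c3.2] with n i1 i2 i3
    have hts : tsupport (fun x => u n x * ψ x) ⊆ tsupport ψ :=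
      closure_mono fun x hx => right_ne_zero_of_mul hx
    have := hw.integral_eq (fun x => u n x * ψ x) ((hu n).mul hψ) (hc.mul_left (f := u n))
      (hts.trans hs)
    have e : ∀ x, β x * pderiv j (fun x => u n x * ψ x) x =
        pderiv j (u n) x * (ψ x * β x) + u n x * (pderiv j ψ x * β x) := fun x => by
      rw [pderiv_mul ((hu n).differentiable (by simp) x) (hψ.differentiable (by simp) x)]; ring
    have e' : ∀ x, β' x * (u n x * ψ x) = u n x * (ψ x * β' x) := fun x => by ring
    simp_rw [e, e'] at this
    rw [integral_add i3 i1] at this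
    linarith
  have lim := (c3.1.neg.sub c2.1).congr' (key.mono fun n hn => hn.symm)
  have := tendsto_nhds_unique c1.1 lim
  have e : ∀ x, h x * β x * pderiv j ψ x = h x * (pderiv j ψ x * β x) := fun x => by ring
  have e' : ∀ x, (h' x * β x + h x * β' x) * ψ x = h' x * (ψ x * β x) + h x * (ψ x * β' x) :=
    fun x => by ring
  simp_rw [e, e']
  rw [this, integral_add]
  · ring
  · exact hh'.integrable_mul (hβ.mul' mψ : MemLp (fun x => ψ x * β x) 2 _)
  · exact hh.integrable_mul (hβ'.mul' mψ : MemLp (fun x => ψ x * β' x) 2 _)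

/-! ### Graph charts of the boundary -/

/-- The height of `x` above the graph of `γ`, in the direction of the `i`-th axis oriented
by `ε`. -/
def graphHeight (i : Fin 3) (ε : ℝ) (γ : (Fin 2 → ℝ) → ℝ) (x : E3) : ℝ :=
  ε * x i - γ (fun k => x (i.succAbove k))

/-- The point at height `t` above the point of the graph of `γ` over `y`. -/
def graphPoint (i : Fin 3) (ε : ℝ) (γ : (Fin 2 → ℝ) → ℝ) (y : Fin 2 → ℝ) (t : ℝ) : E3 :=
  WithLp.toLp 2 (i.insertNth (ε * (t + γ y)) y : Fin 3 → ℝ)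

/-- In the open set `B`, the set `Ω` is the region above the graph of `γ`. -/
structure IsGraphChart (Ω B : Set E3) (i : Fin 3) (ε : ℝ) (γ : (Fin 2 → ℝ) → ℝ) : Prop where
  isOpen : IsOpen B
  sign : ε = 1 ∨ ε = -1
  contDiff : ContDiff ℝ ∞ γ
  mem_iff : ∀ x ∈ B, x ∈ Ω ↔ 0 < graphHeight i ε γ x

theorem HasSmoothBoundary.exists_isGraphChart (h : HasSmoothBoundary Ω) {p : E3}
    (hp : p ∈ frontier Ω) : ∃ B, p ∈ B ∧ ∃ i ε γ, IsGraphChart Ω B i ε γ := by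
  obtain ⟨r, hr, i, ε, γ, hε, hγ, hx⟩ := h p hp
  refine ⟨Metric.ball p r, Metric.mem_ball_self hr, i, ε, γ, Metric.isOpen_ball, hε, hγ, ?_⟩
  intro x hxB
  rw [hx x hxB, graphHeight, sub_pos]

theorem contDiff_graphHeight {i : Fin 3} {ε : ℝ} {γ : (Fin 2 → ℝ) → ℝ} (hγ : ContDiff ℝ ∞ γ) :
    ContDiff ℝ ∞ (graphHeight i ε γ) := by
  have h : ∀ k : Fin 3, ContDiff ℝ ∞ fun x : E3 => x k := fun k =>
    (EuclideanSpace.proj (𝕜 := ℝ) k).contDiff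
  exact (contDiff_const.mul (h i)).sub (hγ.comp (contDiff_pi.2 fun k => h _))

theorem continuous_graphPoint {i : Fin 3} {ε : ℝ} {γ : (Fin 2 → ℝ) → ℝ} (hγ : Continuous γ) :
    Continuous fun p : (Fin 2 → ℝ) × ℝ => graphPoint i ε γ p.1 p.2 := by
  refine (PiLp.continuous_toLp 2 _).comp ?_
  exact Continuous.finInsertNth i (continuous_const.mul (continuous_snd.add (hγ.comp continuous_fst)))
    continuous_fst

@[simp]
theorem graphPoint_apply_same (i : Fin 3) (ε : ℝ) (γ : (Fin 2 → ℝ) → ℝ) (y : Fin 2 → ℝ) (t : ℝ) :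
    graphPoint i ε γ y t i = ε * (t + γ y) := by
  simp [graphPoint]

@[simp]
theorem graphPoint_apply_succAbove (i : Fin 3) (ε : ℝ) (γ : (Fin 2 → ℝ) → ℝ) (y : Fin 2 → ℝ)
    (t : ℝ) (k : Fin 2) : graphPoint i ε γ y t (i.succAbove k) = y k := by
  simp [graphPoint]

theorem graphHeight_graphPoint {i : Fin 3} {ε : ℝ} (hε : ε = 1 ∨ ε = -1) (γ : (Fin 2 → ℝ) → ℝ)
    (y : Fin 2 → ℝ) (t : ℝ) : graphHeight i ε γ (graphPoint i ε γ y t) = t := by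
  have : ε * ε = 1 := by rcases hε with rfl | rfl <;> norm_num
  simp only [graphHeight, graphPoint_apply_same, graphPoint_apply_succAbove]
  linear_combination (t + γ y) * this

theorem graphPoint_graphHeight {i : Fin 3} {ε : ℝ} (hε : ε = 1 ∨ ε = -1) (γ : (Fin 2 → ℝ) → ℝ)
    (x : E3) : graphPoint i ε γ (fun k => x (i.succAbove k)) (graphHeight i ε γ x) = x := by
  have : ε * ε = 1 := by rcases hε with rfl | rfl <;> norm_num
  ext k
  obtain rfl | ⟨k, rfl⟩ := i.eq_self_or_eq_succAbove k
  · simp only [graphHeight, graphPoint_apply_same]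
    linear_combination (x k) * this
  · simp

namespace IsGraphChart

variable {B : Set E3} {i : Fin 3} {ε : ℝ} {γ : (Fin 2 → ℝ) → ℝ}

theorem nonneg_of_mem_closure (h : IsGraphChart Ω B i ε γ) {x : E3} (hB : x ∈ B)
    (hx : x ∈ closure Ω) : 0 ≤ graphHeight i ε γ x := by
  by_contra! hneg
  have hcont := (contDiff_graphHeight (i := i) (ε := ε) h.contDiff).continuous
  have : {y | graphHeight i ε γ y < 0} ∩ B ∈ 𝓝 x :=
    inter_mem ((isOpen_lt hcont continuous_const).mem_nhds hneg) (h.isOpen.mem_nhds hB)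
  obtain ⟨y, ⟨hy1, hy2⟩, hy⟩ := mem_closure_iff_nhds.1 hx _ this
  exact lt_asymm hy1 ((h.mem_iff y hy2).1 hy)

theorem mem_closure_of_nonneg (h : IsGraphChart Ω B i ε γ) {x : E3} (hB : x ∈ B)
    (hx : 0 ≤ graphHeight i ε γ x) : x ∈ closure Ω := by
  set y : Fin 2 → ℝ := fun k => x (i.succAbove k)
  set t₀ := graphHeight i ε γ x
  have hxe : graphPoint i ε γ y t₀ = x := graphPoint_graphHeight h.sign γ x
  have hc : Continuous fun t => graphPoint i ε γ y t :=
    (continuous_graphPoint h.contDiff.continuous).comp (by fun_prop : Continuous fun t => (y, t))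
  have ht : Tendsto (fun t => graphPoint i ε γ y t) (𝓝[>] t₀) (𝓝 x) := by
    rw [← hxe]
    exact hc.continuousAt.tendsto.mono_left nhdsWithin_le_nhds
  refine mem_closure_of_tendsto ht ?_
  filter_upwards [ht (h.isOpen.mem_nhds hB), self_mem_nhdsWithin] with t h1 h2
  rw [h.mem_iff _ h1, graphHeight_graphPoint h.sign]
  exact hx.trans_lt h2

theorem mem_frontier_of_eq_zero (h : IsGraphChart Ω B i ε γ) {x : E3} (hB : x ∈ B)
    (hx : graphHeight i ε γ x = 0) : x ∈ frontier Ω := by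
  refine ⟨h.mem_closure_of_nonneg hB hx.ge, fun hi => ?_⟩
  exact ((h.mem_iff x hB).1 (interior_subset hi)).ne' hx

theorem eq_zero_of_mem_frontier (h : IsGraphChart Ω B i ε γ) (hΩ : IsOpen Ω) {x : E3} (hB : x ∈ B)
    (hx : x ∈ frontier Ω) : graphHeight i ε γ x = 0 := by
  rw [hΩ.frontier_eq] at hx
  exact le_antisymm (not_lt.1 fun h' => hx.2 ((h.mem_iff x hB).2 h'))
    (h.nonneg_of_mem_closure hB hx.1)

end IsGraphChart

/-! ### Surface measure and thin layers along the boundary -/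

/-- This projection undoes the graph parametrisation and cannot increase Hausdorff measure, so
coordinate area is bounded by surface measure without an area formula. -/
theorem lipschitzWith_succAbove (i : Fin 3) :
    LipschitzWith 1 (fun (x : E3) (k : Fin 2) => x (i.succAbove k)) := by
  refine LipschitzWith.of_dist_le_mul fun x y => ?_
  rw [NNReal.coe_one, one_mul, dist_pi_le_iff dist_nonneg]
  intro k
  rw [dist_eq_norm, dist_eq_norm]
  exact PiLp.norm_apply_le (x - y) (i.succAbove k)

/-- Area in a coordinate plane of the projection of a part of the boundary is at most a constant
times its surface measure. -/
theorem exists_lintegral_graphPoint_le : ∃ c : NNReal, ∀ (Ω B : Set E3) (i : Fin 3) (ε : ℝ)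
    (γ : (Fin 2 → ℝ) → ℝ), IsGraphChart Ω B i ε γ → ∀ F : E3 → ENNReal, Measurable F →
      (∀ x ∉ B, F x = 0) →
      ∫⁻ y, F (graphPoint i ε γ y 0) ≤ c * ∫⁻ x, F x ∂surfaceMeasure Ω := by
  -- `a` is the normalising factor of the Euclidean Hausdorff measure. The coordinate plane carries
  -- the sup norm, whose unnormalised Hausdorff measure is Lebesgue measure, so the loss is `a⁻¹`.
  set a : NNReal := Measure.addHaarScalarFactor (volume : Measure (EuclideanSpace ℝ (Fin 2)))
    (Measure.hausdorffMeasure (2 : ℕ))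
  have ha : a ≠ 0 := Measure.addHaarScalarFactor_volume_hausdorffMeasure_ne_zero 2
  refine ⟨a⁻¹, fun Ω B i ε γ h F hF hFB => ?_⟩
  have hc : Continuous fun y => graphPoint i ε γ y 0 :=
    (continuous_graphPoint h.contDiff.continuous).comp
      (by fun_prop : Continuous fun y => (y, (0 : ℝ)))
  have hle : (Measure.map (fun y => graphPoint i ε γ y 0) volume).restrict B ≤
      (a⁻¹ : NNReal) • surfaceMeasure Ω := by
    refine Measure.le_iff.2 fun S hS => ?_
    rw [Measure.restrict_apply hS,
      Measure.map_apply hc.measurable (hS.inter h.isOpen.measurableSet)]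
    set T := S ∩ frontier Ω
    have h1 : (fun y => graphPoint i ε γ y 0) ⁻¹' (S ∩ B) ⊆
        (fun (x : E3) (k : Fin 2) => x (i.succAbove k)) '' T := by
      intro y hy
      refine ⟨graphPoint i ε γ y 0, ⟨hy.1, h.mem_frontier_of_eq_zero hy.2 ?_⟩, ?_⟩
      · exact graphHeight_graphPoint h.sign γ y 0
      · ext k; simp
    have h2 := ((lipschitzWith_succAbove i).lipschitzOnWith (s := T)).hausdorffMeasure_image_le
      (d := (2 : ℕ)) (by positivity)
    have h3 : (volume : Measure (Fin 2 → ℝ)) = Measure.hausdorffMeasure ((2 : ℕ) : ℝ) := by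
      rw [← hausdorffMeasure_pi_real]; simp
    refine (measure_mono h1).trans ?_
    rw [h3]
    refine h2.trans ?_
    rw [Measure.smul_apply, surfaceMeasure, Measure.restrict_apply hS,
      Measure.euclideanHausdorffMeasure_def, Measure.smul_apply, smul_smul]
    change _ ≤ (a⁻¹ * a) • _
    rw [inv_mul_cancel₀ ha]
    simp [T]
  have h4 : ∫⁻ y, F (graphPoint i ε γ y 0) =
      ∫⁻ x in B, F x ∂(Measure.map (fun y => graphPoint i ε γ y 0) volume) := by
    rw [← lintegral_map hF hc.measurable, ← lintegral_indicator h.isOpen.measurableSet]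
    refine lintegral_congr fun x => ?_
    by_cases hx : x ∈ B
    · simp [hx]
    · simp [hx, hFB x hx]
  rw [h4]
  refine (lintegral_mono' hle le_rfl).trans ?_
  rw [lintegral_smul_measure]
  rfl

/-- Integration in graph coordinates, with the height scaled by `h`. -/
theorem integral_eq_integral_graphPoint {i : Fin 3} {ε : ℝ} {γ : (Fin 2 → ℝ) → ℝ}
    (hε : ε = 1 ∨ ε = -1) {F : E3 → ℝ} (hF : Integrable F) {h : ℝ} (hh : 0 < h) :
    ∫ x, F x = ∫ y : Fin 2 → ℝ, ∫ t : ℝ, h * F (graphPoint i ε γ y (h * t)) := by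
  have e1 := (PiLp.volume_preserving_toLp (Fin 3)).integral_comp
    (MeasurableEquiv.toLp 2 (Fin 3 → ℝ)).measurableEmbedding F
  have mp := (volume_preserving_piFinSuccAbove (fun _ : Fin 3 => ℝ) i).symm
  have e2 := mp.integral_comp (MeasurableEquiv.measurableEmbedding _)
    (fun z => F (WithLp.toLp 2 z))
  have i1 : Integrable (fun z : Fin 3 → ℝ => F (WithLp.toLp 2 z)) :=
    ((PiLp.volume_preserving_toLp (Fin 3)).integrable_comp_emb
      (MeasurableEquiv.toLp 2 (Fin 3 → ℝ)).measurableEmbedding).2 hF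
  have i2 := (mp.integrable_comp_emb (MeasurableEquiv.measurableEmbedding _)).2 i1
  rw [← e1, ← e2]
  rw [Measure.volume_eq_prod, integral_prod_symm (fun z : ℝ × (Fin 2 → ℝ) =>
    F (WithLp.toLp 2 ((MeasurableEquiv.piFinSuccAbove (fun _ => ℝ) i).symm z))) i2]
  refine integral_congr_ae (Eventually.of_forall fun y => ?_)
  set g : ℝ → ℝ := fun s => F (WithLp.toLp 2 (i.insertNth s y : Fin 3 → ℝ))
  change ∫ s, g s = ∫ t, h * g (ε * (h * t + γ y))
  rw [integral_const_mul, Measure.integral_comp_mul_left (fun t => g (ε * (t + γ y))) h,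
    integral_add_right_eq_self (fun t => g (ε * t)) (γ y)]
  have : ∫ t, g (ε * t) = ∫ t, g t := by
    rcases hε with rfl | rfl
    · simp
    · simpa using integral_neg_eq_self g volume
  rw [this, abs_of_pos (inv_pos.2 hh), smul_eq_mul, ← mul_assoc, mul_inv_cancel₀ hh.ne', one_mul]

/-- Integrals over thin layers along the boundary converge to integrals over the graph. -/
theorem IsGraphChart.tendsto_integral_layer {B : Set E3} {i : Fin 3} {ε : ℝ}
    {γ : (Fin 2 → ℝ) → ℝ} (hch : IsGraphChart Ω B i ε γ) (hΩ : IsOpen Ω) (hb : Bornology.IsBounded Ω)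
    {Φ : E3 → ℝ} (hΦ : ContinuousOn Φ (closure Ω)) {K : Set E3} (hK : IsCompact K) (hKB : K ⊆ B)
    (hΦK : ∀ x ∉ K, Φ x = 0) {k : ℝ → ℝ} (hk : Continuous k)
    (hk0 : ∀ t, t ∉ Icc (1 : ℝ) 2 → k t = 0) {h : ℕ → ℝ} (hpos : ∀ n, 0 < h n)
    (hlim : Tendsto h atTop (𝓝 0)) :
    Tendsto (fun n => ∫ x in Ω, Φ x * ((h n)⁻¹ * k (graphHeight i ε γ x / h n))) atTop
      (𝓝 ((∫ y, Φ (graphPoint i ε γ y 0)) * ∫ t, k t)) := by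
  have hθc : Continuous (graphHeight i ε γ) := (contDiff_graphHeight hch.contDiff).continuous
  have hgp := continuous_graphPoint (i := i) (ε := ε) hch.contDiff.continuous
  obtain ⟨M, hM⟩ := hb.isCompact_closure.exists_bound_of_continuousOn hΦ
  have hkcs : HasCompactSupport k := HasCompactSupport.of_support_subset_isCompact
    (isCompact_Icc (a := (1 : ℝ)) (b := 2)) fun t ht => by
      by_contra h'; exact ht (hk0 t h')
  obtain ⟨Mk, hMk⟩ := hkcs.exists_bound_of_continuous hk
  -- `Φ` is controlled only on `closure Ω`; its extension by zero is bounded and measurable on the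
  -- whole space. The layer profile vanishes at non-positive heights, so integrating over the whole
  -- space instead of `Ω` changes nothing.
  set Ψ : E3 → ℝ := (closure Ω).indicator Φ with hΨ
  have hΨm : Measurable Ψ := by
    classical
    have := hΦ.measurable_piecewise (continuousOn_const (c := (0 : ℝ))) isClosed_closure.measurableSet
    convert! this using 1
  have hΨb : ∀ x, |Ψ x| ≤ |M| := fun x => by
    by_cases hx : x ∈ closure Ω
    · simpa [hΨ, hx] using (hM x hx).trans (le_abs_self M)
    · simp [hΨ, hx]
  have hΨK : ∀ x ∉ K, Ψ x = 0 := fun x hx => by simp [hΨ, indicator, hΦK x hx]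
  have e1 : ∀ n, ∫ x in Ω, Φ x * ((h n)⁻¹ * k (graphHeight i ε γ x / h n)) =
      ∫ x, Ψ x * ((h n)⁻¹ * k (graphHeight i ε γ x / h n)) := fun n => by
    rw [← setIntegral_eq_integral_of_forall_compl_eq_zero (s := Ω)
      (f := fun x => Ψ x * ((h n)⁻¹ * k (graphHeight i ε γ x / h n)))]
    · refine setIntegral_congr_fun hΩ.measurableSet fun x hx => ?_
      simp only [hΨ, indicator_of_mem (subset_closure hx)]
    · intro x hx
      by_cases hxK : x ∈ K
      · have h1 : ¬ 0 < graphHeight i ε γ x := fun h' => hx ((hch.mem_iff x (hKB hxK)).2 h')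
        rw [hk0 _ fun h' => h1 ?_]
        · simp
        · have := h'.1
          rw [le_div_iff₀ (hpos n)] at this
          linarith [hpos n]
      · simp [hΨK x hxK]
  -- Measuring the height in units of `h n` cancels the factor `(h n)⁻¹` and freezes the profile
  -- `k`.
  have e2 : ∀ n, ∫ x, Ψ x * ((h n)⁻¹ * k (graphHeight i ε γ x / h n)) =
      ∫ y : Fin 2 → ℝ, ∫ t : ℝ, Ψ (graphPoint i ε γ y (h n * t)) * k t := fun n => by
    rw [integral_eq_integral_graphPoint (i := i) (γ := γ) hch.sign ?_ (hpos n)]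
    · refine integral_congr_ae (Eventually.of_forall fun y => ?_)
      refine integral_congr_ae (Eventually.of_forall fun t => ?_)
      simp only [graphHeight_graphPoint hch.sign]
      rw [mul_div_cancel_left₀ _ (hpos n).ne']
      have := mul_inv_cancel₀ (hpos n).ne'
      linear_combination (Ψ (graphPoint i ε γ y (h n * t)) * k t) * this
    · refine Integrable.mono' (g := K.indicator fun _ => |M| * ((h n)⁻¹ * Mk)) ?_ ?_ ?_
      · exact (integrable_indicator_iff hK.measurableSet).2 (integrableOn_const hK.measure_lt_top.ne)
      · exact (hΨm.mul (measurable_const.mul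
          (hk.comp (hθc.div_const _)).measurable)).aestronglyMeasurable
      · refine Eventually.of_forall fun x => ?_
        by_cases hx : x ∈ K
        · rw [indicator_of_mem hx, norm_mul, norm_mul, Real.norm_of_nonneg (inv_pos.2 (hpos n)).le]
          have := (inv_pos.2 (hpos n)).le
          gcongr
          · exact hΨb x
          · exact hMk _
        · simp [hΨK x hx, hx]
  have e3 : (∫ y, Φ (graphPoint i ε γ y 0)) * ∫ t, k t =
      ∫ y : Fin 2 → ℝ, ∫ t : ℝ, Ψ (graphPoint i ε γ y 0) * k t := by
    simp_rw [integral_const_mul, integral_mul_const]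
    congr 1
    refine integral_congr_ae (Eventually.of_forall fun y => ?_)
    by_cases hy : graphPoint i ε γ y 0 ∈ K
    · have := hch.mem_closure_of_nonneg (hKB hy) (graphHeight_graphPoint hch.sign γ y 0).ge
      simp [hΨ, this]
    · simp [hΦK _ hy, hΨK _ hy]
  simp_rw [e1, e2]
  rw [e3]
  set π : E3 → Fin 2 → ℝ := fun x k => x (i.succAbove k)
  have hπ : Continuous π := (lipschitzWith_succAbove i).continuous
  have hπK : IsCompact (π '' K) := hK.image hπ
  -- `Ψ` may jump across the boundary, but for `t > 0` the graph is approached from inside `closure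
  -- Ω`, where `Φ` is continuous. Off the chart, closedness of `K` makes `Ψ` vanish eventually.
  have hpt : ∀ y t, 0 < t → Tendsto (fun n => Ψ (graphPoint i ε γ y (h n * t))) atTop
      (𝓝 (Ψ (graphPoint i ε γ y 0))) := by
    intro y t ht
    have hl : Tendsto (fun n => graphPoint i ε γ y (h n * t)) atTop (𝓝 (graphPoint i ε γ y 0)) := by
      have hc : Continuous fun t => graphPoint i ε γ y t :=
        hgp.comp (by fun_prop : Continuous fun t => (y, t))
      refine (hc.tendsto 0).comp ?_
      simpa using hlim.mul_const t
    by_cases hB : graphPoint i ε γ y 0 ∈ B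
    · have hcl : graphPoint i ε γ y 0 ∈ closure Ω :=
        hch.mem_closure_of_nonneg hB (graphHeight_graphPoint hch.sign γ y 0).ge
      have hev : ∀ᶠ n in atTop, graphPoint i ε γ y (h n * t) ∈ closure Ω := by
        filter_upwards [hl (hch.isOpen.mem_nhds hB)] with n hn
        refine hch.mem_closure_of_nonneg hn ?_
        rw [graphHeight_graphPoint hch.sign]
        exact (mul_pos (hpos n) ht).le
      have := (hΦ _ hcl).tendsto.comp (tendsto_nhdsWithin_iff.2 ⟨hl, hev⟩)
      rw [hΨ, indicator_of_mem hcl]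
      refine this.congr' ?_
      filter_upwards [hev] with n hn
      rw [indicator_of_mem hn]; rfl
    · have h1 : graphPoint i ε γ y 0 ∉ K := fun h' => hB (hKB h')
      rw [hΨK _ h1]
      refine tendsto_const_nhds.congr' ?_
      filter_upwards [hl (hK.isClosed.isOpen_compl.mem_nhds h1)] with n hn
      exact (hΨK _ hn).symm
  have hk_int : Integrable k := hk.integrable_of_hasCompactSupport hkcs
  have hbound : ∀ n y t, ‖Ψ (graphPoint i ε γ y (h n * t)) * k t‖ ≤ |M| * ‖k t‖ := fun n y t => by
    rw [norm_mul]
    gcongr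
    exact hΨb _
  have hmeas : ∀ n, Measurable fun p : (Fin 2 → ℝ) × ℝ =>
      Ψ (graphPoint i ε γ p.1 (h n * p.2)) * k p.2 := fun n =>
    (hΨm.comp (hgp.comp (by fun_prop : Continuous fun p : (Fin 2 → ℝ) × ℝ =>
      (p.1, h n * p.2))).measurable).mul (hk.comp continuous_snd).measurable
  refine tendsto_integral_of_dominated_convergence
    ((π '' K).indicator fun _ => |M| * ∫ t, ‖k t‖) ?_ ?_ ?_ ?_
  · exact fun n => ((hmeas n).stronglyMeasurable.integral_prod_right').aestronglyMeasurable
  · exact (integrable_indicator_iff hπK.measurableSet).2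
      (integrableOn_const hπK.measure_lt_top.ne)
  · intro n
    refine Eventually.of_forall fun y => ?_
    by_cases hy : y ∈ π '' K
    · rw [indicator_of_mem hy, ← integral_const_mul]
      refine (norm_integral_le_integral_norm _).trans ?_
      refine integral_mono_of_nonneg (Eventually.of_forall fun _ => norm_nonneg _)
        (hk_int.norm.const_mul _) (Eventually.of_forall fun t => hbound n y t)
    · rw [indicator_of_notMem hy]
      have : ∀ t, Ψ (graphPoint i ε γ y (h n * t)) = 0 := fun t => by
        refine hΨK _ fun h' => hy ⟨_, h', ?_⟩
        ext k; simp [π]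
      simp [this]
  · refine Eventually.of_forall fun y => ?_
    refine tendsto_integral_of_dominated_convergence (fun t => |M| * ‖k t‖) ?_ ?_ ?_ ?_
    · exact fun n => ((hmeas n).comp measurable_prodMk_left).aestronglyMeasurable
    · exact hk_int.norm.const_mul _
    · exact fun n => Eventually.of_forall fun t => hbound n y t
    · refine Eventually.of_forall fun t => ?_
      by_cases ht : t ∈ Icc (1 : ℝ) 2
      · exact (hpt y t (by linarith [ht.1])).mul_const _
      · simp [hk0 t ht]

/-! ### The divergence theorem as a bound of the flux -/

/-- Integrability is not needed, because the Bochner integral of a non-integrable function is `0`.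
-/
theorem ofReal_integral_le_lintegral {α : Type*} [MeasurableSpace α] {μ : Measure α} (f : α → ℝ) :
    ENNReal.ofReal (∫ x, f x ∂μ) ≤ ∫⁻ x, ENNReal.ofReal (f x) ∂μ := by
  by_cases hf : Integrable f μ
  · rw [integral_eq_lintegral_pos_part_sub_lintegral_neg_part hf]
    refine (ENNReal.ofReal_le_ofReal (sub_le_self _ ENNReal.toReal_nonneg)).trans ?_
    exact ENNReal.ofReal_toReal_le
  · simp [integral_undef hf]

theorem ofReal_sum_le {ι : Type*} (s : Finset ι) (f : ι → ℝ) :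
    ENNReal.ofReal (∑ i ∈ s, f i) ≤ ∑ i ∈ s, ENNReal.ofReal (f i) := by
  classical
  induction s using Finset.induction_on with
  | empty => simp
  | insert a s ha ih =>
    rw [Finset.sum_insert ha, Finset.sum_insert ha]
    exact ENNReal.ofReal_add_le.trans (by gcongr)

/-- A function that is continuous on `closure Ω` and `C¹` in `Ω`, with bounded derivatives. -/
structure IsBddC1 (Ω : Set E3) (ψ : E3 → ℝ) : Prop where
  continuousOn : ContinuousOn ψ (closure Ω)
  contDiffOn : ContDiffOn ℝ 1 ψ Ω
  bdd : ∃ M, ∀ x ∈ Ω, ∀ j, |pderiv j ψ x| ≤ M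

namespace IsBddC1

variable {ψ χ : E3 → ℝ}

theorem differentiableAt (hΩ : IsOpen Ω) (h : IsBddC1 Ω ψ) {x : E3} (hx : x ∈ Ω) :
    DifferentiableAt ℝ ψ x :=
  (h.contDiffOn.contDiffAt (hΩ.mem_nhds hx)).differentiableAt one_ne_zero

theorem exists_bound (hb : Bornology.IsBounded Ω) (h : IsBddC1 Ω ψ) :
    ∃ M, ∀ x ∈ closure Ω, |ψ x| ≤ M :=
  hb.isCompact_closure.exists_bound_of_continuousOn h.continuousOn

theorem continuousOn_pderiv (hΩ : IsOpen Ω) (h : IsBddC1 Ω ψ) (j : Fin 3) :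
    ContinuousOn (pderiv j ψ) Ω :=
  (h.contDiffOn.continuousOn_fderiv_of_isOpen hΩ le_rfl).clm_apply continuousOn_const

theorem mul (hΩ : IsOpen Ω) (hb : Bornology.IsBounded Ω) (h : IsBddC1 Ω ψ) (h' : IsBddC1 Ω χ) :
    IsBddC1 Ω fun x => ψ x * χ x := by
  refine ⟨h.continuousOn.mul h'.continuousOn, h.contDiffOn.mul h'.contDiffOn, ?_⟩
  obtain ⟨M₁, h₁⟩ := h.exists_bound hb
  obtain ⟨M₂, h₂⟩ := h'.exists_bound hb
  obtain ⟨M₃, h₃⟩ := h.bdd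
  obtain ⟨M₄, h₄⟩ := h'.bdd
  refine ⟨M₃ * M₂ + M₁ * M₄, fun x hx j => ?_⟩
  rw [pderiv_mul (h.differentiableAt hΩ hx) (h'.differentiableAt hΩ hx)]
  refine (abs_add_le _ _).trans ?_
  rw [abs_mul, abs_mul]
  have a₁ := h₁ x (subset_closure hx)
  have a₂ := h₂ x (subset_closure hx)
  have := (abs_nonneg _).trans a₁
  have := (abs_nonneg _).trans (h₃ x hx j)
  gcongr
  · exact h₃ x hx j
  · exact h₄ x hx j

end IsBddC1

theorem ContDiff.isBddC1 (hb : Bornology.IsBounded Ω) {u : E3 → ℝ} (hu : ContDiff ℝ 1 u) :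
    IsBddC1 Ω u := by
  refine ⟨hu.continuous.continuousOn, hu.contDiffOn, ?_⟩
  obtain ⟨M, hM⟩ := hb.isCompact_closure.exists_bound_of_continuousOn
    (hu.continuous_fderiv one_ne_zero).continuousOn
  exact ⟨M, fun x hx j => (abs_pderiv_le j u x).trans (hM x (subset_closure hx))⟩

theorem integrableOn_of_continuousOn_of_bound (hΩ : IsOpen Ω) (hb : Bornology.IsBounded Ω)
    {F : E3 → ℝ} (hF : ContinuousOn F Ω) {M : ℝ} (hM : ∀ x ∈ Ω, |F x| ≤ M) : IntegrableOn F Ω :=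
  IntegrableOn.of_bound hb.measure_lt_top (hF.aestronglyMeasurable hΩ.measurableSet) M
    ((ae_restrict_iff' hΩ.measurableSet).2 (Eventually.of_forall hM))

theorem contDiff_of_contDiffAt_tsupport {F : E3 → ℝ} {n : ℕ∞ω}
    (h : ∀ x ∈ tsupport F, ContDiffAt ℝ n F x) : ContDiff ℝ n F := by
  refine contDiff_iff_contDiffAt.2 fun x => ?_
  by_cases hx : x ∈ tsupport F
  · exact h x hx
  · exact contDiffAt_const.congr_of_eventuallyEq (notMem_tsupport_iff_eventuallyEq.1 hx)

/-- A smooth function that vanishes for `t ≤ 1` and is `1` for `t ≥ 2`. -/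
def stepFun (t : ℝ) : ℝ := Real.smoothTransition (t - 1)

theorem contDiff_stepFun : ContDiff ℝ ∞ stepFun :=
  Real.smoothTransition.contDiff.comp (contDiff_id.sub contDiff_const)

theorem stepFun_of_le {t : ℝ} (h : t ≤ 1) : stepFun t = 0 :=
  Real.smoothTransition.zero_of_nonpos (by linarith)

theorem stepFun_of_ge {t : ℝ} (h : 2 ≤ t) : stepFun t = 1 :=
  Real.smoothTransition.one_of_one_le (by linarith)

theorem abs_stepFun_le (t : ℝ) : |stepFun t| ≤ 1 := by
  rw [stepFun, abs_of_nonneg (Real.smoothTransition.nonneg _)]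
  exact Real.smoothTransition.le_one _

theorem deriv_stepFun_of_notMem {t : ℝ} (h : t ∉ Icc (1 : ℝ) 2) : deriv stepFun t = 0 := by
  rw [mem_Icc, not_and_or, not_le, not_le] at h
  rcases h with h | h
  · have : stepFun =ᶠ[𝓝 t] fun _ => 0 := by
      filter_upwards [Iio_mem_nhds h] with s hs using stepFun_of_le (le_of_lt hs)
    simp [this.deriv_eq]
  · have : stepFun =ᶠ[𝓝 t] fun _ => 1 := by
      filter_upwards [Ioi_mem_nhds h] with s hs using stepFun_of_ge (le_of_lt hs)
    simp [this.deriv_eq]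

/-- The unit mass makes the layers created by the cut-off converge to the boundary integral with
factor exactly `1`. -/
theorem integral_deriv_stepFun : ∫ t, deriv stepFun t = 1 := by
  have hc : Continuous (deriv stepFun) := contDiff_stepFun.continuous_deriv (by simp)
  have hi : Integrable (deriv stepFun) := hc.integrable_of_hasCompactSupport
    (HasCompactSupport.of_support_subset_isCompact (isCompact_Icc (a := (1 : ℝ)) (b := 2))
      fun t ht => by by_contra h'; exact ht (deriv_stepFun_of_notMem h'))
  have := integral_of_hasDerivAt_of_tendsto (f := stepFun) (f' := deriv stepFun) (m := 0) (n := 1)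
    (fun t => (contDiff_stepFun.differentiable (by simp) t).hasDerivAt) hi
    (tendsto_const_nhds.congr' ?_) (tendsto_const_nhds.congr' ?_)
  · simpa using this
  · filter_upwards [eventually_le_atBot 1] with t ht using (stepFun_of_le ht).symm
  · filter_upwards [eventually_ge_atTop 2] with t ht using (stepFun_of_ge ht).symm

/-- The divergence of a field with compact support in `Ω` has integral zero. -/
theorem integral_div_eq_zero (hΩ : IsOpen Ω) {j : Fin 3} {X X' ψ : E3 → ℝ}
    (hX : HasWeakDeriv Ω j X X') (hψ : ContDiffOn ℝ 1 ψ Ω) {K : Set E3} (hK : IsCompact K)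
    (hKΩ : K ⊆ Ω) (hψK : ∀ x ∉ K, ψ x = 0) :
    ∫ x in Ω, (X x * pderiv j ψ x + X' x * ψ x) = 0 := by
  have hts : tsupport ψ ⊆ K := closure_minimal (fun x hx => by
    by_contra h; exact hx (hψK x h)) hK.isClosed
  have hcd : ContDiff ℝ 1 ψ := contDiff_of_contDiffAt_tsupport fun x hx =>
    hψ.contDiffAt (hΩ.mem_nhds (hKΩ (hts hx)))
  have hcs : HasCompactSupport ψ := HasCompactSupport.of_support_subset_isCompact hK
    (subset_closure.trans hts)
  rw [integral_add, hX.integral_eq_of_contDiff_one hΩ hcd hcs (hts.trans hKΩ), neg_add_cancel]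
  · exact (integrableOn_mul_of_support_subset hX.locInt hK hKΩ (continuous_pderiv hcd j)
      fun x hx => pderiv_eq_zero_of_notMem fun h => hx (hts h)).integrableOn
  · exact (integrableOn_mul_of_support_subset hX.locInt' hK hKΩ hcd.continuous hψK).integrableOn

/-- One component of the divergence theorem, for functions supported in a boundary chart. -/
theorem IsGraphChart.integral_div_eq {B : Set E3} {i : Fin 3} {ε : ℝ} {γ : (Fin 2 → ℝ) → ℝ}
    (hch : IsGraphChart Ω B i ε γ) (hΩ : IsOpen Ω) (hb : Bornology.IsBounded Ω) {j : Fin 3}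
    {X X' ψ : E3 → ℝ} (hXc : ContinuousOn X (closure Ω)) (hX : HasWeakDeriv Ω j X X')
    (hX' : IntegrableOn X' Ω) (hψ : IsBddC1 Ω ψ) {K : Set E3} (hK : IsCompact K) (hKB : K ⊆ B)
    (hψK : ∀ x ∉ K, ψ x = 0) :
    ∫ x in Ω, (X x * pderiv j ψ x + X' x * ψ x) =
      -∫ y, ψ (graphPoint i ε γ y 0) * X (graphPoint i ε γ y 0) *
        pderiv j (graphHeight i ε γ) (graphPoint i ε γ y 0) := by
  set θ := graphHeight i ε γ with hθ
  have hθs : ContDiff ℝ ∞ θ := contDiff_graphHeight hch.contDiff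
  have hθ1 : ContDiff ℝ 1 θ := hθs.of_le (by exact_mod_cast le_top)
  have hts : tsupport ψ ⊆ K := closure_minimal (fun x hx => by
    by_contra h; exact hx (hψK x h)) hK.isClosed
  set h : ℕ → ℝ := fun n => 1 / ((n : ℝ) + 1) with hh
  have hpos : ∀ n, 0 < h n := fun n => by positivity
  have hlim : Tendsto h atTop (𝓝 0) := tendsto_one_div_add_atTop_nhds_zero_nat
  -- The cut-off vanishes at heights up to `h n`, so `ρₙψ` has compact support in `Ω` although `ψ`
  -- may reach the boundary.
  set ρ : ℕ → E3 → ℝ := fun n x => stepFun (θ x / h n) with hρ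
  have hρs : ∀ n, ContDiff ℝ 1 (ρ n) := fun n =>
    (contDiff_stepFun.of_le (by exact_mod_cast le_top)).comp (hθ1.div_const _)
  have hρd : ∀ n x, pderiv j (ρ n) x = (h n)⁻¹ * deriv stepFun (θ x / h n) * pderiv j θ x := by
    intro n x
    have h1 : HasDerivAt stepFun (deriv stepFun (θ x / h n)) (θ x / h n) :=
      (contDiff_stepFun.differentiable (by simp) _).hasDerivAt
    have h2 : HasFDerivAt (fun x => θ x / h n) ((h n)⁻¹ • fderiv ℝ θ x) x := by
      simp_rw [div_eq_inv_mul]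
      exact (hθ1.differentiable one_ne_zero x).hasFDerivAt.const_mul _
    have h3 := h1.comp_hasFDerivAt x h2
    change fderiv ℝ (stepFun ∘ fun x => θ x / h n) x _ = _
    rw [h3.fderiv]
    simp only [pderiv, _root_.smul_apply, smul_eq_mul]
    ring
  have hρb : ∀ n x, |ρ n x| ≤ 1 := fun n x => abs_stepFun_le _
  obtain ⟨Mψ, hMψ⟩ := hψ.exists_bound hb
  obtain ⟨Mψ', hMψ'⟩ := hψ.bdd
  obtain ⟨MX, hMX⟩ := hb.isCompact_closure.exists_bound_of_continuousOn hXc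
  have hψΩ : ContinuousOn ψ Ω := hψ.continuousOn.mono subset_closure
  have hXΩ : ContinuousOn X Ω := hXc.mono subset_closure
  have i1 : IntegrableOn (fun x => X x * pderiv j ψ x) Ω := by
    refine integrableOn_of_continuousOn_of_bound hΩ hb (hXΩ.mul (hψ.continuousOn_pderiv hΩ j))
      (M := MX * Mψ') fun x hx => ?_
    rw [abs_mul]
    have := hMX x (subset_closure hx)
    have := (norm_nonneg _).trans this
    gcongr
    · exact hMX x (subset_closure hx)
    · exact hMψ' x hx j
  have i2 : IntegrableOn (fun x => X' x * ψ x) Ω := by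
    refine Integrable.mul_bdd (c := Mψ) hX' (hψΩ.aestronglyMeasurable hΩ.measurableSet) ?_
    exact (ae_restrict_iff' hΩ.measurableSet).2
      (Eventually.of_forall fun x hx => hMψ x (subset_closure hx))
  have i12 : IntegrableOn (fun x => X x * pderiv j ψ x + X' x * ψ x) Ω := i1.add i2
  have hbρ : ∀ {F : E3 → ℝ} (n : ℕ), IntegrableOn F Ω → IntegrableOn (fun x => F x * ρ n x) Ω :=
    fun n hF => hF.mul_bdd (c := 1) (hρs n).continuous.aestronglyMeasurable
      (Eventually.of_forall (hρb n))
  set Φ : E3 → ℝ := fun x => ψ x * X x * pderiv j θ x with hΦ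
  have hΦc : ContinuousOn Φ (closure Ω) :=
    (hψ.continuousOn.mul hXc).mul (continuous_pderiv hθ1 j).continuousOn
  obtain ⟨MΦ, hMΦ⟩ := hb.isCompact_closure.exists_bound_of_continuousOn hΦc
  have hkc : Continuous (deriv stepFun) := contDiff_stepFun.continuous_deriv (by simp)
  have i3 : ∀ n, IntegrableOn (fun x => Φ x * ((h n)⁻¹ * deriv stepFun (θ x / h n))) Ω := fun n => by
    obtain ⟨M, hM⟩ := hb.isCompact_closure.exists_bound_of_continuousOn
      (f := fun x => Φ x * ((h n)⁻¹ * deriv stepFun (θ x / h n)))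
      (hΦc.mul (continuous_const.mul
        (hkc.comp (hθ1.continuous.div_const _))).continuousOn)
    exact integrableOn_of_continuousOn_of_bound hΩ hb ((hΦc.mul (continuous_const.mul
        (hkc.comp (hθ1.continuous.div_const _))).continuousOn).mono subset_closure)
      fun x hx => hM x (subset_closure hx)
  -- The divergence of `ρₙψX` integrates to zero; the derivative that falls on `ρₙ` is the layer
  -- integral, which tends to the integral over the graph.
  have key : ∀ n, ∫ x in Ω, (X x * pderiv j ψ x + X' x * ψ x) * ρ n x =
      -∫ x in Ω, Φ x * ((h n)⁻¹ * deriv stepFun (θ x / h n)) := by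
    intro n
    set Kn : Set E3 := K ∩ {x | h n ≤ θ x}
    have hKn : IsCompact Kn := hK.inter_right (isClosed_le continuous_const hθ1.continuous)
    have hKnΩ : Kn ⊆ Ω := fun x hx => (hch.mem_iff x (hKB hx.1)).2 ((hpos n).trans_le hx.2)
    have h0 : ∀ x ∉ Kn, ρ n x * ψ x = 0 := fun x hx => by
      by_cases hxK : x ∈ K
      · have : ρ n x = 0 := stepFun_of_le (by
          rw [div_le_one (hpos n)]
          exact le_of_lt (not_le.1 fun h' => hx ⟨hxK, h'⟩))
        simp [this]
      · simp [hψK x hxK]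
    have hz := integral_div_eq_zero hΩ hX ((hρs n).contDiffOn.mul hψ.contDiffOn) hKn hKnΩ h0
    have e : ∫ x in Ω, (X x * pderiv j (fun x => ρ n x * ψ x) x + X' x * (ρ n x * ψ x)) =
        ∫ x in Ω, ((X x * pderiv j ψ x + X' x * ψ x) * ρ n x +
          Φ x * ((h n)⁻¹ * deriv stepFun (θ x / h n))) := by
      refine setIntegral_congr_fun hΩ.measurableSet fun x hx => ?_
      simp only [hΦ]
      rw [pderiv_mul ((hρs n).differentiable one_ne_zero x) (hψ.differentiableAt hΩ hx), hρd]
      ring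
    have hz' := e.symm.trans hz
    rw [integral_add (hbρ n i12) (i3 n)] at hz'
    linarith
  have l1 : Tendsto (fun n => ∫ x in Ω, (X x * pderiv j ψ x + X' x * ψ x) * ρ n x) atTop
      (𝓝 (∫ x in Ω, (X x * pderiv j ψ x + X' x * ψ x))) := by
    refine tendsto_integral_of_dominated_convergence
      (fun x => ‖X x * pderiv j ψ x + X' x * ψ x‖) ?_ i12.norm ?_ ?_
    · exact fun n => (hbρ n i12).aestronglyMeasurable
    · intro n
      refine Eventually.of_forall fun x => ?_
      rw [norm_mul]
      exact mul_le_of_le_one_right (norm_nonneg _) (hρb n x)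
    · refine (ae_restrict_iff' hΩ.measurableSet).2 (Eventually.of_forall fun x hx => ?_)
      by_cases hxK : x ∈ K
      · have hθx : 0 < θ x := (hch.mem_iff x (hKB hxK)).1 hx
        refine tendsto_const_nhds.congr' ?_
        have := hlim.eventually_lt_const (show 0 < θ x / 2 by positivity)
        filter_upwards [this] with n hn
        have : ρ n x = 1 := stepFun_of_ge (by
          rw [le_div_iff₀ (hpos n)]; linarith)
        rw [this, mul_one]
      · have h1 : pderiv j ψ x = 0 := pderiv_eq_zero_of_notMem fun h' => hxK (hts h')
        simp [h1, hψK x hxK]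
  have l2 := hch.tendsto_integral_layer hΩ hb hΦc hK hKB
    (fun x hx => by simp [hΦ, hψK x hx]) hkc (fun t => deriv_stepFun_of_notMem) hpos hlim
  rw [integral_deriv_stepFun, mul_one] at l2
  exact tendsto_nhds_unique l1 (l2.neg.congr fun n => (key n).symm)

/-- The gradient of the height function points into `Ω`. -/
theorem IsGraphChart.eventually_mem {B : Set E3} {i : Fin 3} {ε : ℝ} {γ : (Fin 2 → ℝ) → ℝ}
    (hch : IsGraphChart Ω B i ε γ) {p : E3} (hp : p ∈ B) (h0 : graphHeight i ε γ p = 0) :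
    ∀ᶠ h in 𝓝[>] (0 : ℝ),
      p + h • (WithLp.toLp 2 fun j => pderiv j (graphHeight i ε γ) p : E3) ∈ Ω := by
  set θ := graphHeight i ε γ with hθ
  set ν : E3 := WithLp.toLp 2 fun j => pderiv j θ p with hν
  have hd : HasFDerivAt θ (fderiv ℝ θ p) p :=
    ((contDiff_graphHeight hch.contDiff).differentiable (by simp) p).hasFDerivAt
  have hνe : ν = ∑ j, pderiv j θ p • (EuclideanSpace.single j 1 : E3) := by
    ext k
    simp [hν, Finset.sum_apply, Pi.single_apply]
  have hval : fderiv ℝ θ p ν = ∑ j, pderiv j θ p ^ 2 := by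
    conv_lhs => rw [hνe, map_sum]
    refine Finset.sum_congr rfl fun j _ => ?_
    rw [map_smul, smul_eq_mul, sq]
    rfl
  -- `γ` does not depend on the `i`-th coordinate, so this component of the gradient is `±1`. Hence
  -- `∇θ` is non-zero and `θ` increases along it.
  have hi : pderiv i θ p = ε := by
    let π : E3 →L[ℝ] (Fin 2 → ℝ) :=
      ContinuousLinearMap.pi fun k => EuclideanSpace.proj (𝕜 := ℝ) (i.succAbove k)
    have h1 : HasFDerivAt (fun x : E3 => x i) (EuclideanSpace.proj (𝕜 := ℝ) i) p :=
      (EuclideanSpace.proj (𝕜 := ℝ) i).hasFDerivAt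
    have h2 : HasFDerivAt (fun x : E3 => γ (π x)) _ p :=
      ((hch.contDiff.differentiable (by simp) (π p)).hasFDerivAt).comp p π.hasFDerivAt
    have h3 : HasFDerivAt θ _ p := (h1.const_mul ε).sub h2
    have h4 : π (EuclideanSpace.single i 1) = 0 := by
      ext k
      simp [π, (Fin.succAbove_ne i k)]
    rw [pderiv, h3.fderiv]
    simp [h4]
  have hpos : 0 < fderiv ℝ θ p ν := by
    rw [hval]
    refine lt_of_lt_of_le ?_ (Finset.single_le_sum (f := fun j => pderiv j θ p ^ 2)
      (fun j _ => sq_nonneg _) (Finset.mem_univ i))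
    rw [hi]
    rcases hch.sign with h | h <;> rw [h] <;> norm_num
  have hl : HasDerivAt (fun h : ℝ => θ (p + h • ν)) (fderiv ℝ θ p ν) 0 := by
    have h1 : HasDerivAt (fun h : ℝ => p + h • ν) ν 0 := by
      simpa using ((hasDerivAt_id (0 : ℝ)).smul_const ν).const_add p
    have hd' : HasFDerivAt θ (fderiv ℝ θ p) (p + (0 : ℝ) • ν) := by simpa using hd
    exact hd'.comp_hasDerivAt (0 : ℝ) h1
  have hc : Tendsto (fun h : ℝ => p + h • ν) (𝓝[>] 0) (𝓝 p) := by
    have : Continuous fun h : ℝ => p + h • ν := by fun_prop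
    simpa using (this.tendsto 0).mono_left (nhdsWithin_le_nhds (s := Ioi 0))
  filter_upwards [hl.tendsto_slope_zero_right.eventually_const_lt hpos, self_mem_nhdsWithin,
    hc (hch.isOpen.mem_nhds hp)] with h h1 h2 h3
  rw [hch.mem_iff _ h3]
  simp only [zero_add, zero_smul, add_zero, smul_eq_mul] at h1
  rw [h0, sub_zero] at h1
  exact (mul_pos_iff_of_pos_left (inv_pos.2 h2)).1 h1

theorem IsBddC1.integrableOn_div (hΩ : IsOpen Ω) (hb : Bornology.IsBounded Ω) {χ X X' : E3 → ℝ}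
    (hχ : IsBddC1 Ω χ) (hXc : ContinuousOn X (closure Ω)) (hX' : IntegrableOn X' Ω) {j : Fin 3} :
    IntegrableOn (fun x => X x * pderiv j χ x + X' x * χ x) Ω := by
  obtain ⟨M, hM⟩ := hb.isCompact_closure.exists_bound_of_continuousOn hXc
  obtain ⟨M', hM'⟩ := hχ.bdd
  obtain ⟨M'', hM''⟩ := hχ.exists_bound hb
  refine Integrable.add ?_ ?_
  · refine integrableOn_of_continuousOn_of_bound hΩ hb
      ((hXc.mono subset_closure).mul (hχ.continuousOn_pderiv hΩ j)) (M := M * M')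
      fun x hx => ?_
    rw [abs_mul]
    have h1 := hM x (subset_closure hx)
    have := (norm_nonneg _).trans h1
    gcongr
    · exact h1
    · exact hM' x hx j
  · refine Integrable.mul_bdd (c := M'') hX'
      ((hχ.continuousOn.mono subset_closure).aestronglyMeasurable hΩ.measurableSet) ?_
    exact (ae_restrict_iff' hΩ.measurableSet).2
      (Eventually.of_forall fun x hx => hM'' x (subset_closure hx))

/-- The bound for the flux of `ψ X` through the boundary, localised by a cut-off function
supported in a boundary chart. -/
theorem IsGraphChart.exists_flux_bound {B : Set E3} {i : Fin 3} {ε : ℝ} {γ : (Fin 2 → ℝ) → ℝ}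
    (hch : IsGraphChart Ω B i ε γ) (hΩ : IsOpen Ω) (hb : Bornology.IsBounded Ω)
    {X X' : Fin 3 → E3 → ℝ} (hXc : ∀ j, ContinuousOn (X j) (closure Ω))
    (hX : ∀ j, HasWeakDeriv Ω j (X j) (X' j)) (hX' : ∀ j, IntegrableOn (X' j) Ω)
    {G : Set E3} (hG : MeasurableSet G)
    (hsign : ∀ p ∈ frontier Ω \ G, ∀ ν : E3, (∀ᶠ h in 𝓝[>] (0 : ℝ), p + h • ν ∈ Ω) →
      0 ≤ ∑ j, X j p * ν j)
    {χ : E3 → ℝ} (hχ : ContDiff ℝ 1 χ) (hχc : HasCompactSupport χ) (hχB : tsupport χ ⊆ B)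
    (hχ0 : ∀ x, 0 ≤ χ x) (hχ1 : ∀ x, χ x ≤ 1) :
    ∃ C : NNReal, ∀ ψ : E3 → ℝ, IsBddC1 Ω ψ → (∀ x ∈ closure Ω, 0 ≤ ψ x) →
      ENNReal.ofReal (∑ j, ∫ x in Ω, (X j x * pderiv j (fun x => χ x * ψ x) x +
        X' j x * (χ x * ψ x))) ≤
        C * ∫⁻ x in G, ENNReal.ofReal (ψ x) ∂surfaceMeasure Ω := by
  obtain ⟨c, hc⟩ := exists_lintegral_graphPoint_le
  set θ := graphHeight i ε γ with hθ
  have hθ1 : ContDiff ℝ 1 θ := (contDiff_graphHeight hch.contDiff).of_le (by exact_mod_cast le_top)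
  have hNc : ContinuousOn (fun x => ∑ j, X j x * pderiv j θ x) (closure Ω) :=
    continuousOn_finsetSum _ fun j _ => (hXc j).mul (continuous_pderiv hθ1 j).continuousOn
  obtain ⟨M, hM⟩ := hb.isCompact_closure.exists_bound_of_continuousOn hNc
  -- `M` bounds `X·∇θ` on `closure Ω`; `c` compares coordinate area with surface measure.
  refine ⟨c * M.toNNReal, fun ψ hψ hψ0 => ?_⟩
  have hχψ : IsBddC1 Ω fun x => χ x * ψ x := (ContDiff.isBddC1 hb hχ).mul hΩ hb hψ
  have hz : ∀ x ∉ tsupport χ, χ x * ψ x = 0 := fun x hx => by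
    simp [image_eq_zero_of_notMem_tsupport hx]
  set P : (Fin 2 → ℝ) → E3 := fun y => graphPoint i ε γ y 0 with hP
  have hPc : Continuous P := (continuous_graphPoint hch.contDiff.continuous).comp
      (by fun_prop : Continuous fun y => (y, (0 : ℝ)))
  have hPθ : ∀ y, θ (P y) = 0 := fun y => graphHeight_graphPoint hch.sign γ y 0
  have hcl : ∀ y, P y ∈ tsupport χ → P y ∈ frontier Ω := fun y hy =>
    hch.mem_frontier_of_eq_zero (hχB hy) (hPθ y)
  have hcl' : ∀ y, P y ∈ tsupport χ → P y ∈ closure Ω := fun y hy => (hcl y hy).1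
  have hint : ∀ j, Integrable fun y => χ (P y) * ψ (P y) * X j (P y) * pderiv j θ (P y) := by
    intro j
    set S : Set (Fin 2 → ℝ) := P ⁻¹' tsupport χ
    have hS : IsCompact S := by
      refine (hχc.isCompact.image (lipschitzWith_succAbove i).continuous).of_isClosed_subset
        ((isClosed_tsupport χ).preimage hPc) fun y hy => ⟨P y, hy, ?_⟩
      ext k; simp [P]
    have hco : ContinuousOn (fun y => χ (P y) * ψ (P y) * X j (P y) * pderiv j θ (P y)) S := by
      have : ContinuousOn (fun x => χ x * ψ x * X j x * pderiv j θ x) (closure Ω) :=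
        ((hχ.continuous.continuousOn.mul hψ.continuousOn).mul (hXc j)).mul
          (continuous_pderiv hθ1 j).continuousOn
      exact this.comp hPc.continuousOn fun y hy => hcl' y hy
    have := hco.integrableOn_compact hS (μ := volume)
    rw [← integrableOn_univ]
    refine this.of_forall_sdiff_eq_zero MeasurableSet.univ fun y hy => ?_
    simp [hz _ hy.2]
  simp_rw [fun j => hch.integral_div_eq hΩ hb (hXc j) (hX j) (hX' j) hχψ hχc.isCompact hχB hz]
  rw [Finset.sum_neg_distrib, ← integral_finsetSum _ fun j _ => hint j, ← integral_neg]
  refine (ofReal_integral_le_lintegral _).trans ?_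
  -- Nothing is known about `ψ` off `closure Ω`; cutting to `S` makes the integrand measurable.
  set S : Set E3 := G ∩ (tsupport χ ∩ closure Ω)
  have hS : MeasurableSet S :=
    hG.inter ((isClosed_tsupport χ).inter isClosed_closure).measurableSet
  set F : E3 → ENNReal := S.indicator fun x => ENNReal.ofReal (ψ x)
  have hF : Measurable F := by
    have : ContinuousOn (fun x => ENNReal.ofReal (ψ x)) S :=
      ENNReal.continuous_ofReal.comp_continuousOn
        (hψ.continuousOn.mono (inter_subset_right.trans inter_subset_right))
    classical
    have := this.measurable_piecewise (continuousOn_const (c := (0 : ENNReal))) hS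
    convert! this using 1
    exact (piecewise_eq_indicator).symm
  have hFle : ∀ y, ENNReal.ofReal (-∑ j, χ (P y) * ψ (P y) * X j (P y) * pderiv j θ (P y)) ≤
      M.toNNReal * F (P y) := by
    intro y
    have e : ∑ j, χ (P y) * ψ (P y) * X j (P y) * pderiv j θ (P y) =
        χ (P y) * ψ (P y) * ∑ j, X j (P y) * pderiv j θ (P y) := by
      rw [Finset.mul_sum]; simp_rw [mul_assoc]
    rw [e]
    by_cases h1 : P y ∈ tsupport χ
    · have hψp := hψ0 _ (hcl' y h1)
      have hpos : 0 ≤ χ (P y) * ψ (P y) := mul_nonneg (hχ0 _) hψp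
      by_cases h2 : P y ∈ G
      · have h3 : P y ∈ S := ⟨h2, h1, hcl' y h1⟩
        have hM' := hM _ (hcl' y h1)
        rw [show F (P y) = ENNReal.ofReal (ψ (P y)) from indicator_of_mem h3 _]
        change _ ≤ ENNReal.ofReal M * _
        rw [← ENNReal.ofReal_mul ((norm_nonneg _).trans hM')]
        refine ENNReal.ofReal_le_ofReal ?_
        refine (neg_le_abs _).trans ?_
        rw [abs_mul, abs_of_nonneg hpos, mul_comm M]
        have : χ (P y) * ψ (P y) ≤ ψ (P y) := mul_le_of_le_one_left hψp (hχ1 _)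
        gcongr
        exact hM'
      -- Outside `G` the sign condition, applied to the inward direction `∇θ`, makes the
      -- contribution non-positive, so it is dropped.
      · have := hsign (P y) ⟨hcl y h1, h2⟩ _ (hch.eventually_mem (hχB h1) (hPθ y))
        rw [ENNReal.ofReal_of_nonpos]
        · exact zero_le
        · exact neg_nonpos.2 (mul_nonneg hpos this)
    · simp [hz _ h1]
  refine (lintegral_mono hFle).trans ?_
  rw [lintegral_const_mul _ (show Measurable fun y => F (P y) from hF.comp hPc.measurable)]
  have h5 := hc Ω B i ε γ hch F hF fun x hx => indicator_of_notMem (fun h => hx (hχB h.2.1)) _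
  refine (mul_le_mul_right h5 _).trans ?_
  rw [← mul_assoc, ENNReal.coe_mul, mul_comm (M.toNNReal : ENNReal)]
  refine mul_le_mul_right ?_ _
  rw [← lintegral_indicator hG]
  refine lintegral_mono fun x => ?_
  by_cases h : x ∈ S
  · simp [F, h, h.1]
  · simp [F, h]

theorem IsGraphChart.mono {B B' : Set E3} {i : Fin 3} {ε : ℝ} {γ : (Fin 2 → ℝ) → ℝ}
    (hch : IsGraphChart Ω B i ε γ) (hB' : IsOpen B') (h : B' ⊆ B) : IsGraphChart Ω B' i ε γ :=
  ⟨hB', hch.sign, hch.contDiff, fun x hx => hch.mem_iff x (h hx)⟩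

/-- If the field `X` points into `Ω` on the boundary outside of `G`, then the integral of the
divergence of `ψ X` is bounded by the integral of `ψ` over `G`. -/
theorem IsSmoothBoundedDomain.exists_flux_bound (hΩ : IsSmoothBoundedDomain Ω)
    {X X' : Fin 3 → E3 → ℝ} (hXc : ∀ j, ContinuousOn (X j) (closure Ω))
    (hX : ∀ j, HasWeakDeriv Ω j (X j) (X' j)) (hX' : ∀ j, IntegrableOn (X' j) Ω)
    {G : Set E3} (hG : MeasurableSet G)
    (hsign : ∀ p ∈ frontier Ω \ G, ∀ ν : E3, (∀ᶠ h in 𝓝[>] (0 : ℝ), p + h • ν ∈ Ω) →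
      0 ≤ ∑ j, X j p * ν j) :
    ∃ C : NNReal, ∀ ψ : E3 → ℝ, IsBddC1 Ω ψ → (∀ x ∈ closure Ω, 0 ≤ ψ x) →
      ENNReal.ofReal (∑ j, ∫ x in Ω, (X j x * pderiv j ψ x + X' j x * ψ x)) ≤
        C * ∫⁻ x in G, ENNReal.ofReal (ψ x) ∂surfaceMeasure Ω := by
  have hb := hΩ.isBounded
  have hloc : ∀ p ∈ closure Ω, ∃ B, IsOpen B ∧ p ∈ B ∧ Bornology.IsBounded B ∧
      (B ⊆ Ω ∨ ∃ i ε γ, IsGraphChart Ω B i ε γ) := by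
    intro p hp
    by_cases hpΩ : p ∈ Ω
    · exact ⟨Ω, hΩ.isOpen, hpΩ, hb, Or.inl Subset.rfl⟩
    · obtain ⟨B, hpB, i, ε, γ, hch⟩ := hΩ.smoothBoundary.exists_isGraphChart
        (p := p) (by rw [hΩ.isOpen.frontier_eq]; exact ⟨hp, hpΩ⟩)
      exact ⟨B ∩ Metric.ball p 1, hch.isOpen.inter Metric.isOpen_ball,
        ⟨hpB, Metric.mem_ball_self one_pos⟩, Metric.isBounded_ball.subset inter_subset_right,
        Or.inr ⟨i, ε, γ, hch.mono (hch.isOpen.inter Metric.isOpen_ball) inter_subset_left⟩⟩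
  choose! B hBo hpB hBb hB using hloc
  obtain ⟨t, ht, htc⟩ := hb.isCompact_closure.elim_nhds_subcover B
    fun p hp => (hBo p hp).mem_nhds (hpB p hp)
  obtain ⟨f, hf⟩ := SmoothPartitionOfUnity.exists_isSubordinate (modelWithCornersSelf ℝ E3)
    isClosed_closure (fun p : t => B p) (fun p => hBo p (ht p p.2))
    (by simpa [iUnion_subtype] using htc)
  have hfs : ∀ p : t, ContDiff ℝ 1 (f p) := fun p =>
    (f p).contMDiff.contDiff.of_le (by exact_mod_cast le_top)
  have hfc : ∀ p : t, HasCompactSupport (f p) := fun p =>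
    Metric.isCompact_of_isClosed_isBounded (isClosed_tsupport _) ((hBb p (ht p p.2)).subset (hf p))
  have hCp : ∀ p : t, ∃ C : NNReal, ∀ ψ : E3 → ℝ, IsBddC1 Ω ψ → (∀ x ∈ closure Ω, 0 ≤ ψ x) →
      ENNReal.ofReal (∑ j, ∫ x in Ω, (X j x * pderiv j (fun x => f p x * ψ x) x +
        X' j x * (f p x * ψ x))) ≤
        C * ∫⁻ x in G, ENNReal.ofReal (ψ x) ∂surfaceMeasure Ω := by
    intro p
    rcases hB p (ht p p.2) with hp | ⟨i, ε, γ, hch⟩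
    -- A patch inside `Ω` does not meet the boundary and carries no flux.
    · refine ⟨0, fun ψ hψ _ => ?_⟩
      have h0 : ∀ j, ∫ x in Ω, (X j x * pderiv j (fun x => f p x * ψ x) x +
          X' j x * (f p x * ψ x)) = 0 := fun j =>
        integral_div_eq_zero hΩ.isOpen (hX j) ((hfs p).contDiffOn.mul hψ.contDiffOn)
          (hfc p).isCompact ((hf p).trans hp) fun x hx => by
            simp [image_eq_zero_of_notMem_tsupport hx]
      simp [h0]
    · exact hch.exists_flux_bound hΩ.isOpen hb hXc hX hX' hG hsign (hfs p) (hfc p) (hf p)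
        (f.nonneg p) (f.le_one p)
  choose C hC using hCp
  refine ⟨∑ p, C p, fun ψ hψ hψ0 => ?_⟩
  have hsum : ∀ x ∈ closure Ω, ∑ p, f p x = 1 := fun x hx => by
    rw [← finsum_eq_sum_of_fintype]; exact f.sum_eq_one hx
  have hfψ : ∀ p, IsBddC1 Ω fun x => f p x * ψ x := fun p =>
    (ContDiff.isBddC1 hb (hfs p)).mul hΩ.isOpen hb hψ
  -- The partition sums to `1` only on `closure Ω`; since `Ω` is open, this suffices to
  -- differentiate the identity at its points.
  have hderiv : ∀ x ∈ Ω, ∀ j, pderiv j ψ x = ∑ p, pderiv j (fun x => f p x * ψ x) x := by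
    intro x hx j
    have e : ψ =ᶠ[𝓝 x] fun x => ∑ p, f p x * ψ x := by
      filter_upwards [hΩ.isOpen.mem_nhds hx] with y hy
      rw [← Finset.sum_mul, hsum y (subset_closure hy), one_mul]
    rw [pderiv, e.fderiv_eq, fderiv_fun_sum fun p _ => (hfψ p).differentiableAt hΩ.isOpen hx]
    simp [pderiv]
  have e : ∑ j, ∫ x in Ω, (X j x * pderiv j ψ x + X' j x * ψ x) =
      ∑ p, ∑ j, ∫ x in Ω, (X j x * pderiv j (fun x => f p x * ψ x) x +
        X' j x * (f p x * ψ x)) := by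
    rw [Finset.sum_comm]
    refine Finset.sum_congr rfl fun j _ => ?_
    rw [← integral_finsetSum _ fun p _ =>
      (hfψ p).integrableOn_div hΩ.isOpen hb (hXc j) (hX' j)]
    refine setIntegral_congr_fun hΩ.isOpen.measurableSet fun x hx => ?_
    rw [Finset.sum_add_distrib, ← Finset.mul_sum, ← Finset.mul_sum, ← hderiv x hx, ← Finset.sum_mul,
      hsum x (subset_closure hx), one_mul]
  rw [e]
  refine (ofReal_sum_le _ _).trans ?_
  push_cast
  rw [Finset.sum_mul]
  exact Finset.sum_le_sum fun p _ => hC p ψ hψ hψ0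

/-! ### Derivatives up to the boundary, approximation and composition -/

theorem contDiff_graphPoint {i : Fin 3} {ε : ℝ} {γ : (Fin 2 → ℝ) → ℝ} (hγ : ContDiff ℝ ∞ γ) :
    ContDiff ℝ ∞ fun p : (Fin 2 → ℝ) × ℝ => graphPoint i ε γ p.1 p.2 := by
  refine contDiff_euclidean.2 fun k => ?_
  obtain rfl | ⟨k, rfl⟩ := i.eq_self_or_eq_succAbove k
  · simp only [graphPoint_apply_same]
    exact contDiff_const.mul (contDiff_snd.add (hγ.comp contDiff_fst))
  · simp only [graphPoint_apply_succAbove]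
    exact (contDiff_apply ℝ ℝ k).comp contDiff_fst

/-- A half-space has unique derivatives at its boundary, and the graph coordinates transport this to
`closure Ω`: they have a smooth right inverse, so their derivative is onto. This is what makes
`gradClosure` well determined, and `C¹` for `d` of class `C²`. -/
theorem IsGraphChart.uniqueDiffWithinAt {B : Set E3} {i : Fin 3} {ε : ℝ} {γ : (Fin 2 → ℝ) → ℝ}
    (hch : IsGraphChart Ω B i ε γ) {p : E3} (hp : p ∈ B) (h0 : graphHeight i ε γ p = 0) :
    UniqueDiffWithinAt ℝ (closure Ω) p := by
  set Θ : (Fin 2 → ℝ) × ℝ → E3 := fun q => graphPoint i ε γ q.1 q.2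
  set Ξ : E3 → (Fin 2 → ℝ) × ℝ := fun x => (fun k => x (i.succAbove k), graphHeight i ε γ x)
  have hΘ : ContDiff ℝ ∞ Θ := contDiff_graphPoint hch.contDiff
  have hΞ : ContDiff ℝ ∞ Ξ :=
    (contDiff_pi.2 fun k => (EuclideanSpace.proj (𝕜 := ℝ) (i.succAbove k)).contDiff).prodMk
      (contDiff_graphHeight hch.contDiff)
  have hinv : ∀ x, Θ (Ξ x) = x := graphPoint_graphHeight hch.sign γ
  have h1 : HasFDerivAt Θ (fderiv ℝ Θ (Ξ p)) (Ξ p) :=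
    (hΘ.differentiable (by simp) _).hasFDerivAt
  have h2 : HasFDerivAt Ξ (fderiv ℝ Ξ p) p := (hΞ.differentiable (by simp) _).hasFDerivAt
  have h3 : (fderiv ℝ Θ (Ξ p)).comp (fderiv ℝ Ξ p) = ContinuousLinearMap.id ℝ E3 := by
    refine (h1.comp p h2).unique ?_
    rw [show Θ ∘ Ξ = id from funext hinv]
    exact hasFDerivAt_id p
  have h4 : Function.Surjective (fderiv ℝ Θ (Ξ p)) := fun v =>
    ⟨fderiv ℝ Ξ p v, by simpa using congrArg (fun L => L v) h3⟩
  set H : Set ((Fin 2 → ℝ) × ℝ) := univ ×ˢ Ici 0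
  have hH : UniqueDiffWithinAt ℝ (H ∩ Θ ⁻¹' B) (Ξ p) := by
    refine UniqueDiffWithinAt.inter ?_ ((hch.isOpen.preimage hΘ.continuous).mem_nhds ?_)
    · exact (uniqueDiffOn_univ.prod (uniqueDiffOn_Ici 0)) _ ⟨mem_univ _, h0.ge⟩
    · change Θ (Ξ p) ∈ B
      rwa [hinv]
  have h5 := h1.hasFDerivWithinAt.uniqueDiffWithinAt hH h4.denseRange
  rw [hinv] at h5
  refine h5.mono ?_
  rintro _ ⟨q, ⟨hq1, hq2⟩, rfl⟩
  refine hch.mem_closure_of_nonneg hq2 ?_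
  rw [graphHeight_graphPoint hch.sign]
  exact hq1.2

theorem IsSmoothBoundedDomain.uniqueDiffOn (hΩ : IsSmoothBoundedDomain Ω) :
    UniqueDiffOn ℝ (closure Ω) := by
  intro p hp
  by_cases hpΩ : p ∈ Ω
  · exact (hΩ.isOpen.uniqueDiffWithinAt hpΩ).mono subset_closure
  · have hpf : p ∈ frontier Ω := by rw [hΩ.isOpen.frontier_eq]; exact ⟨hp, hpΩ⟩
    obtain ⟨B, hpB, i, ε, γ, hch⟩ := hΩ.smoothBoundary.exists_isGraphChart hpf
    exact hch.uniqueDiffWithinAt hpB (hch.eq_zero_of_mem_frontier hΩ.isOpen hpB hpf)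

theorem gradClosure_eq_pderiv (hΩ : IsOpen Ω) (d : E3 → ℝ) {x : E3} (hx : x ∈ Ω) (j : Fin 3) :
    gradClosure Ω d x j = pderiv j d x := by
  rw [gradClosure, fderivWithin_of_mem_nhds (mem_of_superset (hΩ.mem_nhds hx) subset_closure)]
  rfl

theorem IsSmoothBoundedDomain.isBddC1 (hΩ : IsSmoothBoundedDomain Ω) {f : E3 → ℝ}
    (hf : ContDiffOn ℝ 1 f (closure Ω)) : IsBddC1 Ω f := by
  refine ⟨hf.continuousOn, hf.mono subset_closure, ?_⟩
  obtain ⟨M, hM⟩ := hΩ.isBounded.isCompact_closure.exists_bound_of_continuousOn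
    (hf.continuousOn_fderivWithin hΩ.uniqueDiffOn le_rfl)
  refine ⟨M, fun x hx j => (abs_pderiv_le j f x).trans ?_⟩
  have := hM x (subset_closure hx)
  rwa [fderivWithin_of_mem_nhds (mem_of_superset (hΩ.isOpen.mem_nhds hx) subset_closure)] at this

theorem IsSmoothBoundedDomain.isBddC1_gradClosure (hΩ : IsSmoothBoundedDomain Ω) {d : E3 → ℝ}
    (hd : ContDiffOn ℝ 2 d (closure Ω)) (j : Fin 3) : IsBddC1 Ω fun x => gradClosure Ω d x j :=
  hΩ.isBddC1 ((hd.fderivWithin hΩ.uniqueDiffOn (m := 1) (by norm_num)).clm_apply contDiffOn_const)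

/-- The classical derivative of a `C¹` function is its weak derivative. -/
theorem IsBddC1.hasWeakDeriv (hΩ : IsOpen Ω) {f : E3 → ℝ} (hf : IsBddC1 Ω f) (j : Fin 3) :
    HasWeakDeriv Ω j f (pderiv j f) where
  locInt := hf.contDiffOn.continuousOn.locallyIntegrableOn hΩ.measurableSet
  locInt' := (hf.continuousOn_pderiv hΩ j).locallyIntegrableOn hΩ.measurableSet
  integral_eq ψ hψ hc hs := by
    have hz : ∀ x ∉ tsupport ψ, ψ x = 0 := fun x hx => image_eq_zero_of_notMem_tsupport hx
    have hz' : ∀ x ∉ tsupport ψ, pderiv j ψ x = 0 := fun x hx => pderiv_eq_zero_of_notMem hx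
    have l1 : LocallyIntegrableOn f Ω :=
      hf.contDiffOn.continuousOn.locallyIntegrableOn hΩ.measurableSet
    have l2 : LocallyIntegrableOn (pderiv j f) Ω :=
      (hf.continuousOn_pderiv hΩ j).locallyIntegrableOn hΩ.measurableSet
    have c' := (contDiff_pderiv hψ j).continuous
    have := integral_mul_fderiv_eq_neg_fderiv_mul_of_integrable (f := f) (g := ψ)
      (v := EuclideanSpace.single j 1) (μ := volume)
      (integrableOn_mul_of_support_subset l2 hc.isCompact hs hψ.continuous hz)
      (integrableOn_mul_of_support_subset l1 hc.isCompact hs c' hz')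
      (integrableOn_mul_of_support_subset l1 hc.isCompact hs hψ.continuous hz)
      (fun x hx => hf.differentiableAt hΩ (hs hx)) (fun x _ => hψ.differentiable (by simp) x)
    rw [setIntegral_eq_integral_of_forall_compl_eq_zero (s := Ω) fun x hx => by
        rw [hz' x fun h => hx (hs h), mul_zero],
      setIntegral_eq_integral_of_forall_compl_eq_zero (s := Ω) fun x hx => by
        rw [hz x fun h => hx (hs h), mul_zero]]
    exact this

theorem gradClosure_sum_eq (d : E3 → ℝ) (x ν : E3) :
    ∑ j, gradClosure Ω d x j * ν j = fderivWithin ℝ d (closure Ω) x ν := by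
  have hνe : ν = ∑ j, ν j • (EuclideanSpace.single j 1 : E3) := by
    ext k
    simp [Finset.sum_apply, Pi.single_apply]
  conv_rhs => rw [hνe, map_sum]
  refine Finset.sum_congr rfl fun j _ => ?_
  rw [map_smul, smul_eq_mul, mul_comm]
  rfl

/-- At a boundary zero of a function that is positive in `Ω`, the derivative in directions that
point into `Ω` is non-negative. -/
theorem gradClosure_sum_nonneg {d : E3 → ℝ} (hd : DifferentiableOn ℝ d (closure Ω))
    (hpos : ∀ x ∈ Ω, 0 < d x) {p ν : E3} (hp : p ∈ closure Ω) (h0 : d p = 0)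
    (hν : ∀ᶠ h in 𝓝[>] (0 : ℝ), p + h • ν ∈ Ω) : 0 ≤ ∑ j, gradClosure Ω d p j * ν j := by
  rw [gradClosure_sum_eq]
  have h1 := (hd p hp).hasFDerivWithinAt
  have dlim : Tendsto (fun h : ℝ => h • ν) (𝓝[>] 0) (𝓝 0) := by
    have : Continuous fun h : ℝ => h • ν := by fun_prop
    simpa using (this.tendsto 0).mono_left (nhdsWithin_le_nhds (s := Ioi 0))
  have h2 := h1.lim (l := 𝓝[>] (0 : ℝ)) (c := fun h => h⁻¹) (d := fun h => h • ν) (v := ν) dlim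
    (hν.mono fun h hh => subset_closure hh) ?_
  · refine ge_of_tendsto h2 ?_
    filter_upwards [hν, self_mem_nhdsWithin] with h hh (hpos' : 0 < h)
    rw [h0, sub_zero, smul_eq_mul]
    exact mul_nonneg (inv_nonneg.2 hpos'.le) (hpos _ hh).le
  · refine tendsto_const_nhds.congr' ?_
    filter_upwards [self_mem_nhdsWithin] with h (hpos' : 0 < h)
    rw [inv_smul_smul₀ hpos'.ne']

/-- Tietze extension followed by smoothing. It supplies `C¹` factors for the product rule in place
of functions known only to be continuous. -/
theorem exists_contDiff_approx_on {K : Set E3} (hK : IsClosed K) {f : E3 → ℝ}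
    (hf : ContinuousOn f K) {η : ℝ} (hη : 0 < η) :
    ∃ g : E3 → ℝ, ContDiff ℝ 1 g ∧ ∀ x ∈ K, |g x - f x| < η := by
  obtain ⟨F, hF⟩ := ContinuousMap.exists_restrict_eq hK ⟨K.domRestrict f, hf.domRestrict⟩
  obtain ⟨g, hg, hgF, -⟩ := F.continuous.exists_contDiff_approx 1 (ε := fun _ => η)
    continuous_const fun _ => hη
  refine ⟨g, hg, fun x hx => ?_⟩
  have h1 : F x = f x := congrArg (fun G : C(K, ℝ) => G ⟨x, hx⟩) hF
  have h2 := hgF x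
  rwa [h1, Real.dist_eq] at h2

theorem IsBddC1.comp_contDiff (hΩ : IsOpen Ω) (hb : Bornology.IsBounded Ω) {f : E3 → ℝ}
    (hf : IsBddC1 Ω f) {H : ℝ → ℝ} (hH : ContDiff ℝ 1 H) : IsBddC1 Ω fun x => H (f x) := by
  refine ⟨hH.continuous.comp_continuousOn hf.continuousOn, hH.comp_contDiffOn hf.contDiffOn, ?_⟩
  obtain ⟨M, hM⟩ := hf.bdd
  obtain ⟨M', hM'⟩ := hb.isCompact_closure.exists_bound_of_continuousOn
    ((hH.continuous_deriv le_rfl).comp_continuousOn hf.continuousOn)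
  refine ⟨M' * M, fun x hx j => ?_⟩
  have h1 : HasFDerivAt (fun x => H (f x)) (deriv H (f x) • fderiv ℝ f x) x :=
    ((hH.differentiable one_ne_zero (f x)).hasDerivAt).comp_hasFDerivAt x
      (hf.differentiableAt hΩ hx).hasFDerivAt
  have h2 := hM' x (subset_closure hx)
  rw [pderiv, h1.fderiv, _root_.smul_apply, smul_eq_mul, abs_mul]
  have := (norm_nonneg _).trans h2
  gcongr
  · exact h2
  · exact hM x hx j

theorem pderiv_comp {f : E3 → ℝ} {H : ℝ → ℝ} {H' : ℝ} {x : E3} (hf : DifferentiableAt ℝ f x)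
    (hH : HasDerivAt H H' (f x)) (j : Fin 3) :
    pderiv j (fun x => H (f x)) x = H' * pderiv j f x := by
  have h1 : HasFDerivAt (fun x => H (f x)) (H' • fderiv ℝ f x) x :=
    hH.comp_hasFDerivAt x hf.hasFDerivAt
  rw [pderiv, h1.fderiv, _root_.smul_apply, smul_eq_mul]
  rfl

/-! ### The weighted estimate along a transversal field, for smooth functions -/

/-- The weight `e^{k λ d} e^{2 s α}`. -/
def expWeight (Ω : Set E3) (d : E3 → ℝ) (l : ℝ → ℝ) (t₀ k lam s : ℝ) (x : E3) : ℝ :=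
  Real.exp (k * lam * d x) * weight Ω d l lam s x t₀

theorem expWeight_pos (Ω : Set E3) (d : E3 → ℝ) (l : ℝ → ℝ) (t₀ k lam s : ℝ) (x : E3) :
    0 < expWeight Ω d l t₀ k lam s x :=
  mul_pos (Real.exp_pos _) (Real.exp_pos _)

/-- The pointwise inequality behind the Carleman estimate. -/
theorem carleman_pointwise {κ Md M' L k lam s q D m u Y : ℝ} (hκ : 0 < κ) (hL : 0 < L)
    (hk : |1 + k| ≤ 1) (hlam : 1 ≤ lam) (hs : 0 < s) (hs₀ : 2 * L * (Md + M') ≤ κ * s)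
    (hq : s * lam ≤ q * L) (hD : κ ≤ D) (hD' : |D| ≤ Md) (hm : |m| ≤ M') :
    κ * (q ^ 2 * u ^ 2) ≤
      q * (((1 + k) * lam + 2 * q) * D * u ^ 2 + 2 * u * Y + m * u ^ 2) + 2 / κ * Y ^ 2 := by
  have hMd : 0 ≤ Md := (abs_nonneg _).trans hD'
  have hM' : 0 ≤ M' := (abs_nonneg _).trans hm
  have hq0 : 0 < q := by
    have : 0 < q * L := lt_of_lt_of_le (by positivity) hq
    exact (mul_pos_iff_of_pos_right hL).1 this
  have h1 : |(1 + k) * lam * D + m| ≤ lam * (Md + M') := by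
    refine (abs_add_le _ _).trans ?_
    rw [abs_mul, abs_mul, abs_of_pos (show 0 < lam by linarith)]
    have a1 : |1 + k| * lam * |D| ≤ 1 * lam * Md := by gcongr
    nlinarith
  -- This is where `s` must be large and `λ` need not be: both sides scale with `λ` through `qL ≥
  -- sλ`.
  have h2 : lam * (Md + M') ≤ q * (κ / 2) := by
    have : s * (lam * (Md + M')) ≤ s * (q * (κ / 2)) := by
      have a1 : (s * lam) * (Md + M') ≤ (q * L) * (Md + M') := by gcongr
      have a2 : q * (2 * L * (Md + M')) ≤ q * (κ * s) := by gcongr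
      nlinarith
    exact le_of_mul_le_mul_left this hs
  have h3 : -(q * (κ / 2)) ≤ (1 + k) * lam * D + m := by
    have := neg_abs_le ((1 + k) * lam * D + m)
    linarith
  -- The main term is at least `2κq²u²`. The cross term costs `κ/2` of it by completing this square,
  -- the lower-order terms cost another `κ/2`, and `κ` remains.
  have h4 : 0 ≤ (κ / 2) * (q * u + 2 / κ * Y) ^ 2 := by positivity
  have h5 : (κ / 2) * (q * u + 2 / κ * Y) ^ 2 =
      κ / 2 * (q ^ 2 * u ^ 2) + 2 * q * u * Y + 2 / κ * Y ^ 2 := by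
    field_simp
    ring
  have h6 : 0 ≤ q * u ^ 2 * ((1 + k) * lam * D + m + q * (κ / 2)) :=
    mul_nonneg (by positivity) (by linarith)
  have h7 : 0 ≤ 2 * q ^ 2 * u ^ 2 * (D - κ) := mul_nonneg (by positivity) (by linarith)
  nlinarith

/-- The assumptions on a vector field `X` (with derivatives `∂ⱼ Xⱼ = X'ⱼ`) that is transversal to
the level sets of `d`, and that points into `Ω` on the boundary outside of `G`. -/
structure IsTransversalField (Ω G : Set E3) (d : E3 → ℝ) (X X' : Fin 3 → E3 → ℝ) (κ : ℝ) :
    Prop where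
  continuousOn : ∀ j, ContinuousOn (X j) (closure Ω)
  hasWeakDeriv : ∀ j, HasWeakDeriv Ω j (X j) (X' j)
  memLp : ∀ j, MemLp (X' j) ⊤ (volume.restrict Ω)
  measurableSet : MeasurableSet G
  sign : ∀ p ∈ frontier Ω \ G, ∀ ν : E3, (∀ᶠ h in 𝓝[>] (0 : ℝ), p + h • ν ∈ Ω) →
      0 ≤ ∑ j, X j p * ν j
  pos : 0 < κ
  le : ∀ x ∈ closure Ω, κ ≤ ∑ j, X j x * gradClosure Ω d x j

theorem MemLp.exists_ae_bound {α : Type*} [MeasurableSpace α] {μ : Measure α} {f : α → ℝ}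
    (hf : MemLp f ⊤ μ) : ∃ M, 0 ≤ M ∧ ∀ᵐ x ∂μ, |f x| ≤ M := by
  refine ⟨(eLpNormEssSup f μ).toReal, ENNReal.toReal_nonneg, ?_⟩
  have h := hf.eLpNorm_lt_top
  rw [eLpNorm_exponent_top] at h
  filter_upwards [ae_le_eLpNormEssSup (f := f) (μ := μ)] with x hx
  have := ENNReal.toReal_mono h.ne hx
  simpa using this

/-- With `r = d x`, `L = l t₀` and `K = e^{2λ‖d‖}` this is `qW`; its differentiation becomes
one-variable calculus. -/
theorem contDiff_weightProfile (k lam s L K : ℝ) :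
    ContDiff ℝ 1 fun r : ℝ => s * lam * (Real.exp (lam * r) / L) *
      (Real.exp (k * lam * r) * Real.exp (2 * s * ((Real.exp (lam * r) - K) / L))) := by
  have e : ∀ c : ℝ, ContDiff ℝ 1 fun r : ℝ => Real.exp (c * r) := fun c =>
    (contDiff_const.mul contDiff_id).exp
  exact (contDiff_const.mul ((e lam).div_const L)).mul ((e (k * lam)).mul
    (contDiff_const.mul (((e lam).sub contDiff_const).div_const L)).exp)

/-- The logarithmic derivative collects `λ` from `φ`, `kλ` from `e^{kλd}` and `2sλφ = 2q` from
`e^{2sα}`. The last is the large term of the Carleman estimate. -/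
theorem hasDerivAt_weightProfile (k lam s L K r : ℝ) :
    HasDerivAt (fun r : ℝ => s * lam * (Real.exp (lam * r) / L) *
      (Real.exp (k * lam * r) * Real.exp (2 * s * ((Real.exp (lam * r) - K) / L))))
      ((s * lam * (Real.exp (lam * r) / L) *
      (Real.exp (k * lam * r) * Real.exp (2 * s * ((Real.exp (lam * r) - K) / L)))) *
        ((1 + k) * lam + 2 * (s * lam * (Real.exp (lam * r) / L)))) r := by
  have e : ∀ c : ℝ, HasDerivAt (fun r : ℝ => Real.exp (c * r)) (Real.exp (c * r) * c) r :=
    fun c => by simpa using ((hasDerivAt_id r).const_mul c).exp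
  have h := (((e lam).div_const L).const_mul (s * lam)).mul ((e (k * lam)).mul
    ((((e lam).sub_const K).div_const L).const_mul (2 * s)).exp)
  refine h.congr_deriv ?_
  simp only [Pi.mul_apply]
  ring

/-- Integration of `carleman_pointwise`: its first summand, times `W`, is the divergence of `qWu²X`,
and `exists_flux_bound` estimates the integral of that by the boundary term over `G`. -/
theorem exists_carleman_smooth (hΩ : IsSmoothBoundedDomain Ω) {d : E3 → ℝ}
    (hd : ContDiffOn ℝ 2 d (closure Ω)) (hd0 : ∀ x ∈ closure Ω, 0 ≤ d x) {l : ℝ → ℝ} {t₀ : ℝ}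
    (hl : 0 < l t₀) {G : Set E3} {X X' : Fin 3 → E3 → ℝ} {κ : ℝ}
    (hX : IsTransversalField Ω G d X X' κ) {k : ℝ} (hk : |1 + k| ≤ 1) :
    ∃ s₀ : ℝ, 1 ≤ s₀ ∧ ∃ C : NNReal, ∀ lam s : ℝ, 1 ≤ lam → s₀ ≤ s → ∀ u : E3 → ℝ,
      ContDiff ℝ ∞ u →
      ∫⁻ x in Ω, ENNReal.ofReal ((s * lam * phi d l lam x t₀) ^ 2 *
          expWeight Ω d l t₀ k lam s x * u x ^ 2) ≤
        C * ((∫⁻ x in Ω, ENNReal.ofReal (expWeight Ω d l t₀ k lam s x *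
            (∑ j, X j x * pderiv j u x) ^ 2)) +
          ∫⁻ x in G, ENNReal.ofReal (s * lam * phi d l lam x t₀ *
            expWeight Ω d l t₀ k lam s x * u x ^ 2) ∂surfaceMeasure Ω) := by
  have hb := hΩ.isBounded
  have hκ := hX.pos
  have hX'i : ∀ j, IntegrableOn (X' j) Ω := fun j => by
    have : IsFiniteMeasure (volume.restrict Ω) := ⟨by simpa using hb.measure_lt_top⟩
    exact (hX.memLp j).integrable le_top
  obtain ⟨CG, hCG⟩ := hΩ.exists_flux_bound hX.continuousOn hX.hasWeakDeriv hX'i hX.measurableSet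
    hX.sign
  have hgc : ∀ j, ContinuousOn (fun x => gradClosure Ω d x j) (closure Ω) := fun j =>
    (hΩ.isBddC1_gradClosure hd j).continuousOn
  obtain ⟨Md, hMd⟩ := hb.isCompact_closure.exists_bound_of_continuousOn
    (continuousOn_finsetSum Finset.univ fun j _ => (hX.continuousOn j).mul (hgc j))
  have hdiv : MemLp (fun x => ∑ j, X' j x) ⊤ (volume.restrict Ω) :=
    memLp_finsetSum _ fun j _ => hX.memLp j
  obtain ⟨M', hM'0, hM'⟩ := MemLp.exists_ae_bound hdiv
  set L := l t₀ with hLdef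
  -- The threshold is the condition of `carleman_pointwise`, with `Md` a bound of `X·∇d` and `M'`
  -- one of `div X`. The constant comes from dividing by `κ`.
  refine ⟨max 1 (2 * L * (Md + M') / κ), le_max_left _ _, κ⁻¹.toNNReal * (CG + (2 / κ).toNNReal),
    fun lam s hlam hs u hu => ?_⟩
  have hs1 : 1 ≤ s := (le_max_left _ _).trans hs
  have hs2 : 2 * L * (Md + M') ≤ κ * s := by
    have := (le_max_right _ _).trans hs
    rwa [div_le_iff₀ hκ, mul_comm s] at this
  have hs0 : 0 < s := by linarith
  have hlam0 : 0 < lam := by linarith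
  set K : ℝ := Real.exp (2 * lam * sSup ((fun y => |d y|) '' closure Ω)) with hK
  set H : ℝ → ℝ := fun r : ℝ => s * lam * (Real.exp (lam * r) / L) *
      (Real.exp (k * lam * r) * Real.exp (2 * s * ((Real.exp (lam * r) - K) / L))) with hH
  set q : E3 → ℝ := fun x => s * lam * phi d l lam x t₀ with hq
  set W : E3 → ℝ := expWeight Ω d l t₀ k lam s with hW
  have hHd : ∀ x, H (d x) = q x * W x := fun x => rfl
  have hdB : IsBddC1 Ω d := hΩ.isBddC1 (hd.of_le (by norm_num))
  have hHB : IsBddC1 Ω fun x => H (d x) :=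
    hdB.comp_contDiff hΩ.isOpen hb (contDiff_weightProfile k lam s L K)
  have hu1 : ContDiff ℝ 1 u := hu.of_le (by exact_mod_cast le_top)
  have hu2 : ContDiff ℝ 1 fun x => u x ^ 2 := hu1.pow 2
  have hψB : IsBddC1 Ω fun x => H (d x) * u x ^ 2 :=
    hHB.mul hΩ.isOpen hb (ContDiff.isBddC1 hb hu2)
  have hqpos : ∀ x, 0 < q x := fun x =>
    mul_pos (mul_pos hs0 hlam0) (div_pos (Real.exp_pos _) hl)
  have hWpos : ∀ x, 0 < W x := fun x => expWeight_pos ..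
  have hqL : ∀ x ∈ closure Ω, s * lam ≤ q x * L := fun x hx => by
    have h1 : q x * L = s * lam * Real.exp (lam * d x) := by
      simp only [hq, phi, ← hLdef]
      field_simp
    rw [h1]
    exact le_mul_of_one_le_right (by positivity)
      (Real.one_le_exp (mul_nonneg hlam0.le (hd0 x hx)))
  have hderiv : ∀ x ∈ Ω, ∀ j, pderiv j (fun x => H (d x) * u x ^ 2) x =
      q x * W x * (((1 + k) * lam + 2 * q x) * gradClosure Ω d x j * u x ^ 2 +
        2 * u x * pderiv j u x) := by
    intro x hx j
    have hux := hu1.differentiable one_ne_zero x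
    rw [pderiv_mul (hHB.differentiableAt hΩ.isOpen hx) (hu2.differentiable one_ne_zero x),
      pderiv_comp (hdB.differentiableAt hΩ.isOpen hx) (hasDerivAt_weightProfile k lam s L K (d x)),
      gradClosure_eq_pderiv hΩ.isOpen d hx]
    have : pderiv j (fun x => u x ^ 2) x = 2 * u x * pderiv j u x := by
      have := pderiv_comp (H := fun r => r ^ 2) hux (by simpa using hasDerivAt_pow 2 (u x)) j
      simpa using this
    rw [this]
    have e1 : s * lam * (Real.exp (lam * d x) / L) * (Real.exp (k * lam * d x) *
        Real.exp (2 * s * ((Real.exp (lam * d x) - K) / L))) = q x * W x := rfl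
    have e2 : s * lam * (Real.exp (lam * d x) / L) = q x := rfl
    rw [e1, e2, hHd]
    ring
  -- Only almost everywhere, since `div X` is a weak derivative with an essential bound.
  have hptw : ∀ᵐ x ∂volume.restrict Ω, κ * (q x ^ 2 * W x * u x ^ 2) ≤
      (∑ j, (X j x * pderiv j (fun x => H (d x) * u x ^ 2) x + X' j x * (H (d x) * u x ^ 2))) +
        2 / κ * (W x * (∑ j, X j x * pderiv j u x) ^ 2) := by
    filter_upwards [hM', ae_restrict_mem hΩ.isOpen.measurableSet] with x hx' hx
    have hxc := subset_closure hx
    have h := carleman_pointwise (u := u x) (Y := ∑ j, X j x * pderiv j u x) hκ hl hk hlam hs0 hs2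
      (hqL x hxc) (hX.le x hxc) (hMd x hxc) hx'
    have h2 := mul_le_mul_of_nonneg_left h (hWpos x).le
    refine le_trans (le_of_eq (by ring)) (h2.trans (le_of_eq ?_))
    simp_rw [hderiv x hx, hHd]
    simp only [Fin.sum_univ_three]
    ring
  have hWc : ContinuousOn W (closure Ω) :=
    (Real.continuous_exp.comp_continuousOn (continuousOn_const.mul hdB.continuousOn)).mul
      (Real.continuous_exp.comp_continuousOn (continuousOn_const.mul
        (((Real.continuous_exp.comp_continuousOn (continuousOn_const.mul hdB.continuousOn)).sub
          continuousOn_const).div_const _)))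
  have hqc : ContinuousOn q (closure Ω) :=
    continuousOn_const.mul
      ((Real.continuous_exp.comp_continuousOn (continuousOn_const.mul hdB.continuousOn)).div_const _)
  have hint : ∀ F : E3 → ℝ, ContinuousOn F (closure Ω) → IntegrableOn F Ω := fun F hF =>
    (hF.integrableOn_compact hb.isCompact_closure).mono_set subset_closure
  have i1 : IntegrableOn (fun x => q x ^ 2 * W x * u x ^ 2) Ω :=
    hint _ (((hqc.pow 2).mul hWc).mul hu2.continuous.continuousOn)
  have i2 : IntegrableOn (fun x => W x * (∑ j, X j x * pderiv j u x) ^ 2) Ω :=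
    hint _ (hWc.mul ((continuousOn_finsetSum _ fun j _ =>
      (hX.continuousOn j).mul (continuous_pderiv hu1 j).continuousOn).pow 2))
  have i3 : ∀ j, IntegrableOn (fun x => X j x * pderiv j (fun x => H (d x) * u x ^ 2) x +
      X' j x * (H (d x) * u x ^ 2)) Ω := fun j =>
    hψB.integrableOn_div hΩ.isOpen hb (hX.continuousOn j) (hX'i j)
  have hmain : κ * ∫ x in Ω, q x ^ 2 * W x * u x ^ 2 ≤
      (∑ j, ∫ x in Ω, (X j x * pderiv j (fun x => H (d x) * u x ^ 2) x +
        X' j x * (H (d x) * u x ^ 2))) +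
        2 / κ * ∫ x in Ω, W x * (∑ j, X j x * pderiv j u x) ^ 2 := by
    rw [← integral_const_mul, ← integral_const_mul, ← integral_finsetSum _ fun j _ => i3 j,
      ← integral_add (integrable_finsetSum _ fun j _ => i3 j) (i2.const_mul _)]
    exact integral_mono_ae (i1.const_mul _)
      ((integrable_finsetSum _ fun j _ => i3 j).add (i2.const_mul _)) hptw
  have hflux := hCG (fun x => H (d x) * u x ^ 2) hψB fun x hx => by
    rw [hHd]; have := hqpos x; have := hWpos x; positivity
  have e1 : ENNReal.ofReal (∫ x in Ω, q x ^ 2 * W x * u x ^ 2) =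
      ∫⁻ x in Ω, ENNReal.ofReal (q x ^ 2 * W x * u x ^ 2) :=
    ofReal_integral_eq_lintegral_ofReal i1 (Eventually.of_forall fun x => by
      have := hWpos x; simp only [Pi.zero_apply]; positivity)
  have e2 : ENNReal.ofReal (∫ x in Ω, W x * (∑ j, X j x * pderiv j u x) ^ 2) =
      ∫⁻ x in Ω, ENNReal.ofReal (W x * (∑ j, X j x * pderiv j u x) ^ 2) :=
    ofReal_integral_eq_lintegral_ofReal i2 (Eventually.of_forall fun x => by
      have := hWpos x; simp only [Pi.zero_apply]; positivity)
  have hmain' : ∫ x in Ω, q x ^ 2 * W x * u x ^ 2 ≤ κ⁻¹ *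
      ((∑ j, ∫ x in Ω, (X j x * pderiv j (fun x => H (d x) * u x ^ 2) x +
        X' j x * (H (d x) * u x ^ 2))) +
        2 / κ * ∫ x in Ω, W x * (∑ j, X j x * pderiv j u x) ^ 2) := by
    rw [← div_eq_inv_mul, le_div_iff₀ hκ, mul_comm]
    exact hmain
  change ∫⁻ x in Ω, ENNReal.ofReal (q x ^ 2 * W x * u x ^ 2) ≤ _ * ((∫⁻ x in Ω, ENNReal.ofReal
    (W x * (∑ j, X j x * pderiv j u x) ^ 2)) + ∫⁻ x in G, ENNReal.ofReal (q x * W x * u x ^ 2)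
      ∂surfaceMeasure Ω)
  rw [← e1, ← e2]
  refine (ENNReal.ofReal_le_ofReal hmain').trans ?_
  rw [ENNReal.ofReal_mul (inv_nonneg.2 hκ.le)]
  push_cast
  rw [mul_assoc]
  refine mul_le_mul_right ?_ _
  refine ENNReal.ofReal_add_le.trans ?_
  rw [ENNReal.ofReal_mul (by positivity), add_mul]
  simp_rw [hHd] at hflux
  refine add_le_add (hflux.trans (mul_le_mul_right le_add_self _)) (mul_le_mul_right le_self_add _)

/-! ### Passage from smooth to Sobolev functions -/

/-- From `2b² + 2(a - b)² - a² = (a - 2b)² ≥ 0`. Only the difference has to be measurable, so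
nothing is asked of the weight `F` off `closure Ω`. -/
theorem lintegral_weighted_sq_le {α : Type*} [MeasurableSpace α] {μ : Measure α} {F a b : α → ℝ}
    {B : ℝ} (hF : ∀ᵐ x ∂μ, 0 ≤ F x ∧ F x ≤ B) (hm : AEStronglyMeasurable (fun x => a x - b x) μ) :
    ∫⁻ x, ENNReal.ofReal (F x * a x ^ 2) ∂μ ≤
      2 * (∫⁻ x, ENNReal.ofReal (F x * b x ^ 2) ∂μ) +
        ENNReal.ofReal (2 * B) * eLpNorm (fun x => a x - b x) 2 μ ^ 2 := by
  have e : eLpNorm (fun x => a x - b x) 2 μ ^ 2 = ∫⁻ x, ‖a x - b x‖ₑ ^ 2 ∂μ := by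
    have := eLpNorm_nnreal_pow_eq_lintegral (f := fun x => a x - b x) (μ := μ)
      (p := 2) (by norm_num)
    simpa using this
  rw [e, ← lintegral_const_mul'' _ (hm.enorm.pow_const 2), ← lintegral_const_mul' _ _ (by simp),
    ← lintegral_add_right' _ ((hm.enorm.pow_const 2).const_mul _)]
  refine lintegral_mono_ae ?_
  filter_upwards [hF] with x ⟨h0, hB⟩
  have h1 : ‖a x - b x‖ₑ ^ 2 = ENNReal.ofReal ((a x - b x) ^ 2) := by
    rw [← ofReal_norm, ← ENNReal.ofReal_pow (norm_nonneg _), Real.norm_eq_abs, sq_abs]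
  have hB0 : 0 ≤ B := h0.trans hB
  rw [h1, ← ENNReal.ofReal_mul (by positivity), ← ENNReal.ofReal_ofNat 2,
    ← ENNReal.ofReal_mul (by norm_num), ← ENNReal.ofReal_add (by positivity) (by positivity)]
  refine ENNReal.ofReal_le_ofReal ?_
  have h2 : F x * (a x - b x) ^ 2 ≤ B * (a x - b x) ^ 2 := by gcongr
  have h3 : 0 ≤ F x * (a x - 2 * b x) ^ 2 := by positivity
  nlinarith

theorem tendsto_mul_sq_zero {e : ℕ → ENNReal} (h : Tendsto e atTop (𝓝 0)) (c : ℝ) :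
    Tendsto (fun n => ENNReal.ofReal c * e n ^ 2) atTop (𝓝 0) := by
  have h1 : Tendsto (fun n => e n ^ 2) atTop (𝓝 0) := by
    simpa using ENNReal.Tendsto.pow (n := 2) h
  simpa using ENNReal.Tendsto.const_mul h1 (Or.inr ENNReal.ofReal_ne_top)

theorem continuousOn_phi {d : E3 → ℝ} {S : Set E3} (hd : ContinuousOn d S) (l : ℝ → ℝ)
    (lam t₀ : ℝ) : ContinuousOn (fun x => phi d l lam x t₀) S :=
  (Real.continuous_exp.comp_continuousOn (continuousOn_const.mul hd)).div_const _

theorem continuousOn_expWeight {d : E3 → ℝ} {S : Set E3} (hd : ContinuousOn d S) (l : ℝ → ℝ)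
    (t₀ k lam s : ℝ) : ContinuousOn (expWeight Ω d l t₀ k lam s) S :=
  (Real.continuous_exp.comp_continuousOn (continuousOn_const.mul hd)).mul
    (Real.continuous_exp.comp_continuousOn (continuousOn_const.mul
      (((Real.continuous_exp.comp_continuousOn (continuousOn_const.mul hd)).sub
        continuousOn_const).div_const _)))

/-- The Carleman estimate for a first order operator that is transversal to the level sets
of `d`. -/
theorem exists_carleman_estimate (hΩ : IsSmoothBoundedDomain Ω) {d : E3 → ℝ}
    (hd : ContDiffOn ℝ 2 d (closure Ω)) (hd0 : ∀ x ∈ closure Ω, 0 ≤ d x) {l : ℝ → ℝ} {t₀ : ℝ}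
    (hl : 0 < l t₀) {G : Set E3} {X X' : Fin 3 → E3 → ℝ} {κ : ℝ}
    (hX : IsTransversalField Ω G d X X' κ) {k : ℝ} (hk : |1 + k| ≤ 1) :
    ∃ s₀ : ℝ, 1 ≤ s₀ ∧ ∃ C : NNReal, ∀ lam s : ℝ, 1 ≤ lam → s₀ ≤ s → ∀ v τ : E3 → ℝ,
      MemW Ω 2 1 v → IsTrace Ω v τ →
      ∫⁻ x in Ω, ENNReal.ofReal ((s * lam * phi d l lam x t₀) ^ 2 *
          expWeight Ω d l t₀ k lam s x * v x ^ 2) ≤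
        C * ((∫⁻ x in Ω, ENNReal.ofReal (expWeight Ω d l t₀ k lam s x *
            (∑ j, X j x * weakDeriv Ω j v x) ^ 2)) +
          ∫⁻ x in G, ENNReal.ofReal (s * lam * phi d l lam x t₀ *
            expWeight Ω d l t₀ k lam s x * τ x ^ 2) ∂surfaceMeasure Ω) := by
  obtain ⟨s₀, hs₀, C, hC⟩ := exists_carleman_smooth hΩ hd hd0 hl hX hk
  -- One factor `2` is lost in passing from `v` to its approximant on the left, another in returning
  -- on the right.
  refine ⟨s₀, hs₀, 4 * C, fun lam s hlam hs v τ hv hτ => ?_⟩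
  have hcpt := hΩ.isBounded.isCompact_closure
  set q : E3 → ℝ := fun x => s * lam * phi d l lam x t₀ with hq
  set W : E3 → ℝ := expWeight Ω d l t₀ k lam s with hW
  have hs0 : 0 < s := by linarith
  have hlam0 : 0 < lam := by linarith
  have hqpos : ∀ x, 0 < q x := fun x =>
    mul_pos (mul_pos hs0 hlam0) (div_pos (Real.exp_pos _) hl)
  have hWpos : ∀ x, 0 < W x := fun x => expWeight_pos ..
  have hqc : ContinuousOn q (closure Ω) :=
    continuousOn_const.mul (continuousOn_phi hd.continuousOn l lam t₀)
  have hWc : ContinuousOn W (closure Ω) := continuousOn_expWeight hd.continuousOn l t₀ k lam s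
  obtain ⟨B₁, hB₁⟩ := hcpt.exists_bound_of_continuousOn ((hqc.pow 2).mul hWc)
  obtain ⟨B₂, hB₂⟩ := hcpt.exists_bound_of_continuousOn hWc
  obtain ⟨B₃, hB₃⟩ := hcpt.exists_bound_of_continuousOn (hqc.mul hWc)
  obtain ⟨u, hu, t1, t2, t3⟩ := hτ.exists_approx
  have hmΩ : ∀ᵐ x ∂volume.restrict Ω, x ∈ closure Ω := by
    filter_upwards [ae_restrict_mem hΩ.isOpen.measurableSet] with x hx using subset_closure hx
  have hmG : ∀ᵐ x ∂(surfaceMeasure Ω).restrict G, x ∈ closure Ω := by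
    refine ae_restrict_of_ae ?_
    filter_upwards [ae_restrict_mem isClosed_frontier.measurableSet] with x hx using hx.1
  have hv0 : MemLp v 2 (volume.restrict Ω) := hv.1
  have hv1 : ∀ j, MemLp (weakDeriv Ω j v) 2 (volume.restrict Ω) := fun j => (hv.2 j).2
  have hXm : ∀ j, AEStronglyMeasurable (X j) (volume.restrict Ω) := fun j =>
    ((hX.continuousOn j).mono subset_closure).aestronglyMeasurable hΩ.isOpen.measurableSet
  have hum : ∀ n j, AEStronglyMeasurable (pderiv j (u n)) (volume.restrict Ω) := fun n j =>
    (contDiff_pderiv (hu n) j).continuous.aestronglyMeasurable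
  have a1 : ∀ n, ∫⁻ x in Ω, ENNReal.ofReal (q x ^ 2 * W x * v x ^ 2) ≤
      2 * (∫⁻ x in Ω, ENNReal.ofReal (q x ^ 2 * W x * u n x ^ 2)) + ENNReal.ofReal (2 * B₁) *
        eLpNorm (fun x => u n x - v x) 2 (volume.restrict Ω) ^ 2 := fun n => by
    have e : eLpNorm (fun x => u n x - v x) 2 (volume.restrict Ω) =
        eLpNorm (fun x => v x - u n x) 2 (volume.restrict Ω) := by
      rw [← eLpNorm_neg]
      refine congrArg (fun f => eLpNorm f 2 (volume.restrict Ω)) (funext fun x => ?_)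
      simp
    rw [e]
    refine lintegral_weighted_sq_le (hmΩ.mono fun x hx => ⟨?_, (le_abs_self _).trans (hB₁ x hx)⟩)
      (hv0.aestronglyMeasurable.sub (hu n).continuous.aestronglyMeasurable)
    have := hWpos x
    positivity
  have a2 : ∀ n, ∫⁻ x in Ω, ENNReal.ofReal (W x * (∑ j, X j x * pderiv j (u n) x) ^ 2) ≤
      2 * (∫⁻ x in Ω, ENNReal.ofReal (W x * (∑ j, X j x * weakDeriv Ω j v x) ^ 2)) +
        ENNReal.ofReal (2 * B₂) * eLpNorm (fun x => (∑ j, X j x * pderiv j (u n) x) -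
          ∑ j, X j x * weakDeriv Ω j v x) 2 (volume.restrict Ω) ^ 2 := fun n => by
    refine lintegral_weighted_sq_le (hmΩ.mono fun x hx => ⟨(hWpos x).le,
      (le_abs_self _).trans (hB₂ x hx)⟩) ?_
    exact (Finset.aestronglyMeasurable_fun_sum _ fun j _ => (hXm j).mul (hum n j)).sub
      (Finset.aestronglyMeasurable_fun_sum _ fun j _ => (hXm j).mul (hv1 j).aestronglyMeasurable)
  have a3 : ∀ n, ∫⁻ x in G, ENNReal.ofReal (q x * W x * u n x ^ 2) ∂surfaceMeasure Ω ≤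
      2 * (∫⁻ x in G, ENNReal.ofReal (q x * W x * τ x ^ 2) ∂surfaceMeasure Ω) +
        ENNReal.ofReal (2 * B₃) * eLpNorm (fun x => u n x - τ x) 2
          ((surfaceMeasure Ω).restrict G) ^ 2 := fun n => by
    refine lintegral_weighted_sq_le (hmG.mono fun x hx => ⟨?_,
      (le_abs_self _).trans (hB₃ x hx)⟩) ?_
    · exact (mul_pos (hqpos x) (hWpos x)).le
    · exact (hu n).continuous.aestronglyMeasurable.sub hτ.memLp.aestronglyMeasurable.restrict
  have l2 : Tendsto (fun n => eLpNorm (fun x => (∑ j, X j x * pderiv j (u n) x) -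
      ∑ j, X j x * weakDeriv Ω j v x) 2 (volume.restrict Ω)) atTop (𝓝 0) := by
    choose M hM using fun j => hcpt.exists_bound_of_continuousOn (hX.continuousOn j)
    have hle : ∀ n, eLpNorm (fun x => (∑ j, X j x * pderiv j (u n) x) -
        ∑ j, X j x * weakDeriv Ω j v x) 2 (volume.restrict Ω) ≤
        ∑ j, ENNReal.ofReal (M j) *
          eLpNorm (fun x => pderiv j (u n) x - weakDeriv Ω j v x) 2 (volume.restrict Ω) := by
      intro n
      have e : (fun x => (∑ j, X j x * pderiv j (u n) x) - ∑ j, X j x * weakDeriv Ω j v x) =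
          ∑ j, fun x => X j x * (pderiv j (u n) x - weakDeriv Ω j v x) := by
        ext x
        simp only [Finset.sum_apply, ← Finset.sum_sub_distrib, mul_sub]
      rw [e]
      refine (eLpNorm_sum_le (fun j _ => (hXm j).mul ((hum n j).sub
        (hv1 j).aestronglyMeasurable)) (by norm_num)).trans ?_
      refine Finset.sum_le_sum fun j _ => ?_
      refine eLpNorm_le_mul_eLpNorm_of_ae_le_mul (hmΩ.mono fun x hx => ?_) 2
      simp only [Pi.mul_apply, Pi.sub_apply, norm_mul]
      gcongr
      exact hM j x hx
    refine tendsto_of_tendsto_of_tendsto_of_le_of_le tendsto_const_nhds ?_ (fun _ => zero_le) hle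
    have := tendsto_finsetSum Finset.univ fun j _ =>
      ENNReal.Tendsto.const_mul (t2 j) (Or.inr (ENNReal.ofReal_ne_top (r := M j)))
    simpa using this
  have l3 : Tendsto (fun n => eLpNorm (fun x => u n x - τ x) 2 ((surfaceMeasure Ω).restrict G))
      atTop (𝓝 0) :=
    tendsto_of_tendsto_of_tendsto_of_le_of_le tendsto_const_nhds t3 (fun _ => zero_le)
      fun n => eLpNorm_mono_measure _ Measure.restrict_le_self
  have hn : ∀ n, ∫⁻ x in Ω, ENNReal.ofReal (q x ^ 2 * W x * v x ^ 2) ≤ _ := fun n =>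
    (a1 n).trans (add_le_add_left (mul_le_mul_right ((hC lam s hlam hs (u n) (hu n)).trans
      (mul_le_mul_right (add_le_add (a2 n) (a3 n)) _)) _) _)
  have key := ge_of_tendsto' (((ENNReal.Tendsto.const_mul (ENNReal.Tendsto.const_mul
    ((tendsto_const_nhds.add (tendsto_mul_sq_zero l2 _)).add
      (tendsto_const_nhds.add (tendsto_mul_sq_zero l3 _)))
    (Or.inr ENNReal.coe_ne_top)) (Or.inr (by norm_num))).add (tendsto_mul_sq_zero t1 _))) hn
  refine key.trans (le_of_eq ?_)
  push_cast
  ring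

/-! ### Transversal fields for the two operators -/

/-- Addition in `Fin 3` is modulo `3`, so one formula serves all components. -/
theorem crossProduct_apply_cyclic (v w : Fin 3 → ℝ) (i : Fin 3) :
    crossProduct v w i = v (i + 1) * w (i + 2) - v (i + 2) * w (i + 1) := by
  fin_cases i <;> rfl

theorem rot_apply_cyclic (Ω : Set E3) (b : E3 → Fin 3 → ℝ) (x : E3) (i : Fin 3) :
    rot Ω b x i = weakDeriv Ω (i + 1) (fun y => b y (i + 2)) x -
      weakDeriv Ω (i + 2) (fun y => b y (i + 1)) x := by
  fin_cases i <;> rfl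

theorem IsWeightFunction.nonneg {Γ : Set E3} {d : E3 → ℝ} (hd : IsWeightFunction Ω Γ d) :
    ∀ x ∈ closure Ω, 0 ≤ d x := fun _ hx =>
  le_on_closure (fun y hy => (hd.pos y hy).le) continuousOn_const hd.contDiffOn.continuousOn hx

theorem ContinuousOn.memLp_top (hΩ : IsOpen Ω) (hb : Bornology.IsBounded Ω) {f : E3 → ℝ}
    (hf : ContinuousOn f (closure Ω)) : MemLp f ⊤ (volume.restrict Ω) := by
  obtain ⟨M, hM⟩ := hb.isCompact_closure.exists_bound_of_continuousOn hf
  exact memLp_top_of_bound ((hf.mono subset_closure).aestronglyMeasurable hΩ.measurableSet) M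
    ((ae_restrict_iff' hΩ.measurableSet).2 (Eventually.of_forall fun x hx =>
      hM x (subset_closure hx)))

theorem sqNorm_pos {v : Fin 3 → ℝ} (hv : v ≠ 0) : 0 < sqNorm v := by
  obtain ⟨i, hi⟩ := Function.ne_iff.1 hv
  exact lt_of_lt_of_le (pow_pos (abs_pos.2 hi) 2 |>.trans_eq (sq_abs _))
    (Finset.single_le_sum (f := fun j => v j ^ 2) (fun j _ => sq_nonneg _) (Finset.mem_univ i))

theorem sqNorm_nonneg (v : Fin 3 → ℝ) : 0 ≤ sqNorm v := Finset.sum_nonneg fun _ _ => sq_nonneg _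

theorem continuousOn_sqNorm {S : Set E3} {v : E3 → Fin 3 → ℝ}
    (hv : ∀ j, ContinuousOn (fun x => v x j) S) : ContinuousOn (fun x => sqNorm (v x)) S :=
  continuousOn_finsetSum _ fun j _ => (hv j).pow 2

/-- The gradient of the weight function is a transversal field. -/
theorem IsWeightFunction.exists_isTransversalField (hΩ : IsSmoothBoundedDomain Ω) {Γ : Set E3}
    (hΓ : MeasurableSet Γ) {d : E3 → ℝ} (hd : IsWeightFunction Ω Γ d) :
    ∃ X' κ, IsTransversalField Ω Γ d (fun j x => gradClosure Ω d x j) X' κ := by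
  have hX := hΩ.isBddC1_gradClosure hd.contDiffOn
  obtain ⟨κ, hκ, hκ'⟩ := hΩ.isBounded.isCompact_closure.exists_forall_le'
    (continuousOn_sqNorm fun j => (hX j).continuousOn)
    (a := 0) fun x hx => sqNorm_pos (hd.grad_ne_zero x hx)
  refine ⟨fun j => pderiv j fun x => gradClosure Ω d x j, κ, fun j => (hX j).continuousOn,
    fun j => (hX j).hasWeakDeriv hΩ.isOpen j, fun j => ?_, hΓ, fun p hp ν hν => ?_, hκ,
    fun x hx => ?_⟩
  · obtain ⟨M, hM⟩ := (hX j).bdd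
    exact memLp_top_of_bound (((hX j).continuousOn_pderiv hΩ.isOpen j).aestronglyMeasurable
      hΩ.isOpen.measurableSet) M ((ae_restrict_iff' hΩ.isOpen.measurableSet).2
        (Eventually.of_forall fun x hx => hM x hx j))
  -- Off `Γ` the point is a boundary zero of a function positive in `Ω`, so `∇d` points inwards.
  -- This confines the boundary term for `P` to `Γ`.
  · exact gradClosure_sum_nonneg (hd.contDiffOn.differentiableOn (by norm_num)) hd.pos hp.1.1
      (hd.eq_zero p hp) hν
  · refine (hκ' x hx).trans_eq ?_
    simp only [sqNorm, sq]

/-- If `∇d × b` does not vanish, then there is a `C¹` field `c` such that `b × c` is transversal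
to the level sets of `d`. -/
theorem exists_isTransversalField_cross (hΩ : IsSmoothBoundedDomain Ω) {d : E3 → ℝ}
    (hd : ContDiffOn ℝ 2 d (closure Ω)) {b : E3 → Fin 3 → ℝ}
    (hb : ∀ i, MemW Ω ⊤ 1 (fun x => b x i)) (hbc : ContinuousOn b (closure Ω))
    (hcross : ∀ x ∈ closure Ω, crossProduct (gradClosure Ω d x) (b x) ≠ 0) :
    ∃ c : Fin 3 → E3 → ℝ, (∀ j, ContDiff ℝ 1 (c j)) ∧ ∃ X' κ, IsTransversalField Ω univ d
      (fun j x => b x (j + 1) * c (j + 2) x - b x (j + 2) * c (j + 1) x) X' κ := by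
  have hcpt := hΩ.isBounded.isCompact_closure
  have hgc : ∀ j, ContinuousOn (fun x => gradClosure Ω d x j) (closure Ω) := fun j =>
    (hΩ.isBddC1_gradClosure hd j).continuousOn
  have hbj : ∀ j, ContinuousOn (fun x => b x j) (closure Ω) := fun j => continuousOn_pi.1 hbc j
  -- Since `(b×c)·∇d = c·n`, the choice `c = n` would give `|n|²`. A nearby `C¹` field keeps half of
  -- this and suits the product rule with `b`.
  set n : E3 → Fin 3 → ℝ := fun x => crossProduct (gradClosure Ω d x) (b x) with hn
  have hnc : ∀ j, ContinuousOn (fun x => n x j) (closure Ω) := fun j => by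
    simp only [hn, crossProduct_apply_cyclic]
    exact ((hgc _).mul (hbj _)).sub ((hgc _).mul (hbj _))
  obtain ⟨κ, hκ, hκ'⟩ := hcpt.exists_forall_le' (continuousOn_sqNorm hnc) (a := 0)
    fun x hx => sqNorm_pos (hcross x hx)
  obtain ⟨N, hN⟩ := hcpt.exists_bound_of_continuousOn
    (continuousOn_finsetSum Finset.univ fun j _ => (hnc j).abs)
  -- With this precision the error `(c - n)·n` is at most `κ/2`, as `N` bounds `∑ |nⱼ|`; adding `1`
  -- avoids division by zero.
  have hη : 0 < κ / (2 * (|N| + 1)) := by positivity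
  choose c hc hcn using fun j => exists_contDiff_approx_on isClosed_closure (hnc j) hη
  refine ⟨c, hc, fun j x => (weakDeriv Ω j (fun y => b y (j + 1)) x * c (j + 2) x +
      b x (j + 1) * pderiv j (c (j + 2)) x) - (weakDeriv Ω j (fun y => b y (j + 2)) x * c (j + 1) x +
      b x (j + 2) * pderiv j (c (j + 1)) x), κ / 2, ?_⟩
  have hbw : ∀ i j, HasWeakDeriv Ω j (fun x => b x i) (weakDeriv Ω j fun x => b x i) := fun i j =>
    hasWeakDeriv_weakDeriv ((hb i).2 j).1
  have mc : ∀ j, MemLp (c j) ⊤ (volume.restrict Ω) := fun j =>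
    ContinuousOn.memLp_top hΩ.isOpen hΩ.isBounded (hc j).continuous.continuousOn
  have mc' : ∀ i j, MemLp (pderiv i (c j)) ⊤ (volume.restrict Ω) := fun i j =>
    ContinuousOn.memLp_top hΩ.isOpen hΩ.isBounded (continuous_pderiv (hc j) i).continuousOn
  have mb : ∀ i, MemLp (fun x => b x i) ⊤ (volume.restrict Ω) := fun i => (hb i).1
  have mb' : ∀ i j, MemLp (weakDeriv Ω j fun x => b x i) ⊤ (volume.restrict Ω) := fun i j =>
    ((hb i).2 j).2
  refine ⟨fun j => ?_, fun j => ?_, fun j => ?_, MeasurableSet.univ, fun p hp => ?_, by positivity,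
    fun x hx => ?_⟩
  · exact ((hbj _).mul (hc _).continuous.continuousOn).sub
      ((hbj _).mul (hc _).continuous.continuousOn)
  · exact ((hbw _ j).mul_contDiff hΩ.isOpen (hc _)).sub ((hbw _ j).mul_contDiff hΩ.isOpen (hc _))
  · exact (((mc _).mul' (mb' _ _)).add ((mc' _ _).mul' (mb _))).sub
      (((mc _).mul' (mb' _ _)).add ((mc' _ _).mul' (mb _)))
  -- With `G` everything, the sign condition is empty: `b×c` has no preferred direction at the
  -- boundary.
  · exact absurd (mem_univ p) hp.2
  · have e : ∑ j, (b x (j + 1) * c (j + 2) x - b x (j + 2) * c (j + 1) x) * gradClosure Ω d x j =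
        sqNorm (n x) + ∑ j, (c j x - n x j) * n x j := by
      simp only [sqNorm, hn, crossProduct_apply_cyclic, Fin.sum_univ_three]
      norm_num [show (1 : Fin 3) + 2 = 0 from rfl, show (2 : Fin 3) + 1 = 0 from rfl,
        show (2 : Fin 3) + 2 = 1 from rfl, show (1 : Fin 3) + 1 = 2 from rfl]
      ring
    rw [e]
    have h1 : |∑ j, (c j x - n x j) * n x j| ≤ κ / (2 * (|N| + 1)) * ∑ j, |n x j| := by
      rw [Finset.mul_sum]
      refine (Finset.abs_sum_le_sum_abs _ _).trans (Finset.sum_le_sum fun j _ => ?_)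
      rw [abs_mul]
      exact mul_le_mul_of_nonneg_right (hcn j x hx).le (abs_nonneg _)
    have h2 : ∑ j, |n x j| ≤ |N| := (le_abs_self _).trans ((hN x hx).trans (le_abs_self N))
    have h3 : κ / (2 * (|N| + 1)) * ∑ j, |n x j| ≤ κ / 2 := by
      refine (mul_le_mul_of_nonneg_left h2 hη.le).trans ?_
      rw [div_mul_eq_mul_div, div_le_div_iff₀ (by positivity) (by norm_num)]
      nlinarith [abs_nonneg N]
    have h4 := neg_abs_le (∑ j, (c j x - n x j) * n x j)
    linarith [hκ' x hx]

/-! ### Pointwise control of derivatives by `P` and `Q` -/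

theorem sq_sum_mul_le (a v : Fin 3 → ℝ) : (∑ j, a j * v j) ^ 2 ≤ sqNorm a * sqNorm v :=
  Finset.sum_mul_sq_le_sq_mul_sq _ _ _

theorem sqNorm_mulVec_le (A : Matrix (Fin 3) (Fin 3) ℝ) (v : Fin 3 → ℝ) :
    sqNorm (A.mulVec v) ≤ (∑ i, sqNorm (A i)) * sqNorm v := by
  rw [Finset.sum_mul]
  exact Finset.sum_le_sum fun i _ => sq_sum_mul_le (A i) v

theorem sqNorm_sub_le (v w : Fin 3 → ℝ) : sqNorm (v - w) ≤ 2 * sqNorm v + 2 * sqNorm w := by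
  simp only [sqNorm, Finset.mul_sum, ← Finset.sum_add_distrib]
  refine Finset.sum_le_sum fun i _ => ?_
  simp only [Pi.sub_apply]
  nlinarith [sq_nonneg (v i + w i)]

/-- The gradient is controlled by `P f` and `f`. -/
theorem exists_sqNorm_weakGrad_le (hb : Bornology.IsBounded Ω) (hΩ : IsOpen Ω)
    {A : E3 → Matrix (Fin 3) (Fin 3) ℝ} (hA : ∀ k j, MemW Ω ⊤ 1 (fun x => A x k j))
    (hAc : ContinuousOn A (closure Ω)) (hdet : ∀ x ∈ closure Ω, (A x).det ≠ 0) :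
    ∃ M : ℝ, 0 ≤ M ∧ ∀ f : E3 → ℝ, ∀ᵐ x ∂volume.restrict Ω,
      sqNorm (weakGrad Ω f x) ≤ M * (sqNorm (opP Ω A f x) + f x ^ 2) := by
  have hcpt := hb.isCompact_closure
  obtain ⟨κ, hκ, hκ'⟩ := hcpt.exists_forall_le' (f := fun x => (A x).det ^ 2)
    (((continuous_id.matrix_det).comp_continuousOn hAc).pow 2) (a := 0)
    fun x hx => by have := hdet x hx; positivity
  obtain ⟨N, hN⟩ := hcpt.exists_bound_of_continuousOn (f := fun x => ∑ i, sqNorm ((A x).adjugate i))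
    (continuousOn_finsetSum _ fun i _ => continuousOn_sqNorm fun j => by
      have h1 : ContinuousOn (fun x => (A x).adjugate) (closure Ω) :=
        (continuous_id.matrix_adjugate).comp_continuousOn hAc
      exact continuousOn_pi.1 (continuousOn_pi.1 h1 i) j)
  choose M hM0 hM using fun k j => MemLp.exists_ae_bound ((hA k j).2 j).2
  set S : ℝ := ∑ k, (∑ j, M k j) ^ 2
  refine ⟨|N| / κ * (2 * (1 + S)), by positivity, fun f => ?_⟩
  have hM' : ∀ᵐ x ∂volume.restrict Ω, ∀ k j, |weakDeriv Ω j (fun y => A y k j) x| ≤ M k j :=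
    ae_all_iff.2 fun k => ae_all_iff.2 fun j => hM k j
  filter_upwards [hM', ae_restrict_mem hΩ.measurableSet] with x hx hxΩ
  have hxc := subset_closure hxΩ
  set v := weakGrad Ω f x
  have h1 : sqNorm (divMat Ω A x) ≤ S := by
    refine Finset.sum_le_sum fun k _ => ?_
    rw [← sq_abs]
    have : |divMat Ω A x k| ≤ ∑ j, M k j :=
      (Finset.abs_sum_le_sum_abs _ _).trans (Finset.sum_le_sum fun j _ => hx k j)
    gcongr
  -- Cramer's rule: the adjugate is continuous and hence bounded, and the determinant is bounded
  -- away from zero by compactness.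
  have h2 : (A x).det • v = (A x).adjugate.mulVec (opP Ω A f x - f x • divMat Ω A x) := by
    rw [opP, add_sub_cancel_right, Matrix.mulVec_mulVec, Matrix.adjugate_mul, Matrix.smul_mulVec,
      Matrix.one_mulVec]
  have h3 : (A x).det ^ 2 * sqNorm v = sqNorm ((A x).det • v) := by
    simp only [sqNorm, Finset.mul_sum, Pi.smul_apply, smul_eq_mul, mul_pow]
  have h4 : sqNorm (f x • divMat Ω A x) = f x ^ 2 * sqNorm (divMat Ω A x) := by
    simp only [sqNorm, Finset.mul_sum, Pi.smul_apply, smul_eq_mul, mul_pow]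
  have h5 : κ * sqNorm v ≤ |N| * (2 * (1 + S) * (sqNorm (opP Ω A f x) + f x ^ 2)) := by
    calc κ * sqNorm v ≤ (A x).det ^ 2 * sqNorm v :=
          mul_le_mul_of_nonneg_right (hκ' x hxc) (sqNorm_nonneg _)
      _ ≤ _ := by
          rw [h3, h2]
          refine (sqNorm_mulVec_le _ _).trans ?_
          have hS : 0 ≤ S := Finset.sum_nonneg fun k _ => sq_nonneg _
          have h6 : sqNorm (opP Ω A f x - f x • divMat Ω A x) ≤
              2 * (1 + S) * (sqNorm (opP Ω A f x) + f x ^ 2) := by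
            refine (sqNorm_sub_le _ _).trans ?_
            rw [h4]
            have h7 : f x ^ 2 * sqNorm (divMat Ω A x) ≤ f x ^ 2 * S := by gcongr
            have h8 := mul_nonneg hS (sqNorm_nonneg (opP Ω A f x))
            nlinarith [sq_nonneg (f x)]
          have h9 := (le_abs_self _).trans ((hN x hxc).trans (le_abs_self N))
          have h10 := sqNorm_nonneg (opP Ω A f x - f x • divMat Ω A x)
          gcongr
  rw [div_mul_eq_mul_div, div_mul_eq_mul_div, le_div_iff₀ hκ]
  linarith

theorem MemW.of_succ {p : ENNReal} {k : ℕ} {f : E3 → ℝ} (h : MemW Ω p (k + 1) f) :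
    MemW Ω p k f := by
  induction k generalizing f with
  | zero => exact h.1
  | succ k ih => exact ⟨h.1, fun j => ⟨(h.2 j).1, ih (h.2 j).2⟩⟩

theorem MemW.hasWeakDeriv {p : ENNReal} {k : ℕ} {f : E3 → ℝ} (h : MemW Ω p (k + 1) f) (j : Fin 3) :
    HasWeakDeriv Ω j f (weakDeriv Ω j f) :=
  hasWeakDeriv_weakDeriv (h.2 j).1

/-- Product rule for functions that have a trace. -/
theorem IsTrace.hasWeakDeriv_mul {h τ β β' : E3 → ℝ} {j : Fin 3} (hτ : IsTrace Ω h τ)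
    (hh : MemW Ω 2 1 h) (hβ : MemLp β ⊤ (volume.restrict Ω))
    (hβ' : MemLp β' ⊤ (volume.restrict Ω)) (hw : HasWeakDeriv Ω j β β') :
    HasWeakDeriv Ω j (fun x => h x * β x) (fun x => weakDeriv Ω j h x * β x + h x * β' x) := by
  obtain ⟨u, hu, t1, t2, -⟩ := hτ.exists_approx
  exact HasWeakDeriv.mul_of_tendsto hh.1 (hh.2 j).2 hβ hβ' hw hu t1 (t2 j)

theorem exists_common_bound {b : E3 → Fin 3 → ℝ} (hb : ∀ i, MemW Ω ⊤ 2 (fun x => b x i)) :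
    ∃ M, 0 ≤ M ∧ ∀ᵐ x ∂volume.restrict Ω, ∀ i j k,
      |weakDeriv Ω j (fun y => b y i) x| ≤ M ∧
        |weakDeriv Ω k (weakDeriv Ω j (fun y => b y i)) x| ≤ M := by
  choose M₁ hM₁ h₁ using fun i j => MemLp.exists_ae_bound ((hb i).2 j).2.1
  choose M₂ hM₂ h₂ using fun i j k => MemLp.exists_ae_bound (((hb i).2 j).2.2 k).2
  refine ⟨∑ i, ∑ j, (M₁ i j + ∑ k, M₂ i j k), ?_, ?_⟩
  · exact Finset.sum_nonneg fun i _ => Finset.sum_nonneg fun j _ =>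
      add_nonneg (hM₁ i j) (Finset.sum_nonneg fun k _ => hM₂ i j k)
  · refine ae_all_iff.2 fun i => ae_all_iff.2 fun j => ae_all_iff.2 fun k => ?_
    have hk : M₂ i j k ≤ ∑ k, M₂ i j k :=
      Finset.single_le_sum (f := fun k => M₂ i j k) (fun k _ => hM₂ i j k) (Finset.mem_univ k)
    have hk0 := hM₂ i j k
    have hj : M₁ i j + ∑ k, M₂ i j k ≤ ∑ j, (M₁ i j + ∑ k, M₂ i j k) :=
      Finset.single_le_sum (f := fun j => M₁ i j + ∑ k, M₂ i j k) (fun j _ =>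
        add_nonneg (hM₁ i j) (Finset.sum_nonneg fun k _ => hM₂ i j k)) (Finset.mem_univ j)
    have hi : ∑ j, (M₁ i j + ∑ k, M₂ i j k) ≤ ∑ i, ∑ j, (M₁ i j + ∑ k, M₂ i j k) :=
      Finset.single_le_sum (f := fun i => ∑ j, (M₁ i j + ∑ k, M₂ i j k)) (fun i _ =>
        Finset.sum_nonneg fun j _ =>
          add_nonneg (hM₁ i j) (Finset.sum_nonneg fun k _ => hM₂ i j k)) (Finset.mem_univ i)
    have hj0 := hM₁ i j
    filter_upwards [h₁ i j, h₂ i j k] with x hx₁ hx₂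
    exact ⟨by linarith, by linarith⟩

theorem sq_le_of_abs_le {a M : ℝ} (h : |a| ≤ M) : a ^ 2 ≤ M ^ 2 := by
  rw [← sq_abs]
  gcongr

theorem sq_le_sqNorm (v : Fin 3 → ℝ) (j : Fin 3) : v j ^ 2 ≤ sqNorm v :=
  Finset.single_le_sum (f := fun j => v j ^ 2) (fun _ _ => sq_nonneg _) (Finset.mem_univ j)

/-- `∇g × b` is controlled by `Q g` and `g`. -/
theorem exists_sqNorm_cross_le {b : E3 → Fin 3 → ℝ} (hb : ∀ i, MemW Ω ⊤ 2 (fun x => b x i)) :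
    ∃ M : ℝ, 0 ≤ M ∧ ∀ g : E3 → ℝ, ∀ᵐ x ∂volume.restrict Ω,
      sqNorm (crossProduct (weakGrad Ω g x) (b x)) ≤ M * (sqNorm (opQ Ω b g x) + g x ^ 2) := by
  obtain ⟨M, hM0, hM⟩ := exists_common_bound hb
  refine ⟨2 * (1 + 3 * (2 * M) ^ 2), by positivity, fun g => ?_⟩
  filter_upwards [hM] with x hx
  have h1 : sqNorm (rot Ω b x) ≤ 3 * (2 * M) ^ 2 := by
    have : ∀ i, rot Ω b x i ^ 2 ≤ (2 * M) ^ 2 := fun i => by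
      refine sq_le_of_abs_le ?_
      rw [rot_apply_cyclic]
      refine (abs_sub _ _).trans ?_
      linarith [(hx (i + 2) (i + 1) 0).1, (hx (i + 1) (i + 2) 0).1]
    refine (Finset.sum_le_sum fun i _ => this i).trans_eq ?_
    simp
  have h2 : crossProduct (weakGrad Ω g x) (b x) = opQ Ω b g x - g x • rot Ω b x := by
    rw [opQ, add_sub_cancel_right]
  have h3 : sqNorm (g x • rot Ω b x) = g x ^ 2 * sqNorm (rot Ω b x) := by
    simp only [sqNorm, Finset.mul_sum, Pi.smul_apply, smul_eq_mul, mul_pow]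
  rw [h2]
  refine (sqNorm_sub_le _ _).trans ?_
  rw [h3]
  have h4 : g x ^ 2 * sqNorm (rot Ω b x) ≤ g x ^ 2 * (3 * (2 * M) ^ 2) := by gcongr
  have h5 : 0 ≤ (3 * (2 * M) ^ 2) * sqNorm (opQ Ω b g x) :=
    mul_nonneg (by positivity) (sqNorm_nonneg _)
  nlinarith [sq_nonneg (g x)]

/-- The weak derivatives of `Q g`. -/
theorem hasWeakDeriv_opQ {b : E3 → Fin 3 → ℝ} (hb : ∀ i, MemW Ω ⊤ 2 (fun x => b x i))
    {g τ : E3 → ℝ} {τ' : Fin 3 → E3 → ℝ} (hg : MemW Ω 2 2 g) (hτ : IsTrace Ω g τ)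
    (hτ' : ∀ j, IsTrace Ω (weakDeriv Ω j g) (τ' j)) (i k : Fin 3) :
    HasWeakDeriv Ω k (fun x => opQ Ω b g x i) fun x =>
      (weakDeriv Ω k (weakDeriv Ω (i + 1) g) x * b x (i + 2) +
        weakDeriv Ω (i + 1) g x * weakDeriv Ω k (fun y => b y (i + 2)) x) -
      (weakDeriv Ω k (weakDeriv Ω (i + 2) g) x * b x (i + 1) +
        weakDeriv Ω (i + 2) g x * weakDeriv Ω k (fun y => b y (i + 1)) x) +
      (weakDeriv Ω k g x * rot Ω b x i + g x *
        (weakDeriv Ω k (weakDeriv Ω (i + 1) fun y => b y (i + 2)) x -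
          weakDeriv Ω k (weakDeriv Ω (i + 2) fun y => b y (i + 1)) x)) := by
  -- `b` and `rot b` are known only through bounded weak derivatives, so the product rule rests on
  -- the smooth approximations of `∂ⱼg` and `g` that the trace hypotheses supply.
  have h1 : ∀ j m, HasWeakDeriv Ω k (fun x => weakDeriv Ω j g x * b x m) fun x =>
      weakDeriv Ω k (weakDeriv Ω j g) x * b x m +
        weakDeriv Ω j g x * weakDeriv Ω k (fun y => b y m) x := fun j m =>
    (hτ' j).hasWeakDeriv_mul (hg.2 j).2 (hb m).1 ((hb m).2 k).2.1 ((hb m).hasWeakDeriv k)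
  have hr : HasWeakDeriv Ω k (fun x => rot Ω b x i) fun x =>
      weakDeriv Ω k (weakDeriv Ω (i + 1) fun y => b y (i + 2)) x -
        weakDeriv Ω k (weakDeriv Ω (i + 2) fun y => b y (i + 1)) x := by
    simp only [rot_apply_cyclic]
    exact (((hb _).2 _).2.hasWeakDeriv k).sub (((hb _).2 _).2.hasWeakDeriv k)
  have mr : MemLp (fun x => rot Ω b x i) ⊤ (volume.restrict Ω) := by
    simp only [rot_apply_cyclic]
    exact ((hb _).2 _).2.1.sub ((hb _).2 _).2.1
  have h2 := hτ.hasWeakDeriv_mul hg.of_succ mr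
    (((((hb _).2 _).2.2 k).2).sub ((((hb _).2 _).2.2 k).2)) hr
  have h3 := ((h1 (i + 1) (i + 2)).sub (h1 (i + 2) (i + 1))).add h2
  have e : (fun x => opQ Ω b g x i) = fun x =>
      weakDeriv Ω (i + 1) g x * b x (i + 2) - weakDeriv Ω (i + 2) g x * b x (i + 1) +
        g x * rot Ω b x i := by
    ext x
    simp only [opQ, Pi.add_apply, crossProduct_apply_cyclic, weakGrad, Pi.smul_apply, smul_eq_mul]
  rw [e]
  exact h3

/-- `∇(∂ₖg) × b` is controlled by the derivatives of `Q g`, by `∇g` and by `g`. -/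
theorem exists_sqNorm_cross_weakGrad_le (hΩ : IsOpen Ω) {b : E3 → Fin 3 → ℝ}
    (hb : ∀ i, MemW Ω ⊤ 2 (fun x => b x i)) :
    ∃ M : ℝ, 0 ≤ M ∧ ∀ (g τ : E3 → ℝ) (τ' : Fin 3 → E3 → ℝ), MemW Ω 2 2 g → IsTrace Ω g τ →
      (∀ j, IsTrace Ω (weakDeriv Ω j g) (τ' j)) → ∀ k, ∀ᵐ x ∂volume.restrict Ω,
      sqNorm (crossProduct (weakGrad Ω (weakDeriv Ω k g) x) (b x)) ≤
        M * (sqNormGrad Ω (opQ Ω b g) x + (sqNorm (weakGrad Ω g x) + g x ^ 2)) := by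
  obtain ⟨M, hM0, hM⟩ := exists_common_bound hb
  -- Each component of the error `E` below has square at most `24M²(|∇g|² + g²)`; three components
  -- and the factor `2` of `sqNorm_sub_le` give `144M²`.
  refine ⟨2 + 144 * M ^ 2, by positivity, fun g τ τ' hg hτ hτ' k => ?_⟩
  have hQ : ∀ᵐ x ∂volume.restrict Ω, ∀ i, weakDeriv Ω k (fun x => opQ Ω b g x i) x = _ :=
    ae_all_iff.2 fun i => weakDeriv_ae_eq hΩ (hasWeakDeriv_opQ hb hg hτ hτ' i k)
  -- `∂ₖ(Qg)` contains `∂ₖ∂ⱼg`, while `∇(∂ₖg)` has the components `∂ⱼ∂ₖg`.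
  have hcomm : ∀ᵐ x ∂volume.restrict Ω, ∀ j, weakDeriv Ω j (weakDeriv Ω k g) x =
      weakDeriv Ω k (weakDeriv Ω j g) x := ae_all_iff.2 fun j =>
    weakDeriv_ae_eq hΩ ((hg.hasWeakDeriv j).comm (hg.hasWeakDeriv k) ((hg.2 j).2.hasWeakDeriv k))
  filter_upwards [hM, hQ, hcomm] with x hx hQx hcx
  -- The part of `∂ₖ(Qg)` without second derivatives of `g`: `∂ₖ` has fallen on `b`, or on the term
  -- `g rot b`.
  set E : Fin 3 → ℝ := fun i =>
    weakDeriv Ω (i + 1) g x * weakDeriv Ω k (fun y => b y (i + 2)) x -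
      weakDeriv Ω (i + 2) g x * weakDeriv Ω k (fun y => b y (i + 1)) x +
      weakDeriv Ω k g x * rot Ω b x i + g x *
        (weakDeriv Ω k (weakDeriv Ω (i + 1) fun y => b y (i + 2)) x -
          weakDeriv Ω k (weakDeriv Ω (i + 2) fun y => b y (i + 1)) x) with hE
  set Y : Fin 3 → ℝ := fun i => weakDeriv Ω k (fun x => opQ Ω b g x i) x with hY
  have h1 : crossProduct (weakGrad Ω (weakDeriv Ω k g) x) (b x) = Y - E := by
    ext i
    simp only [crossProduct_apply_cyclic, weakGrad, Pi.sub_apply, hY, hE, hcx]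
    rw [hQx i]
    ring
  have hYle : sqNorm Y ≤ sqNormGrad Ω (opQ Ω b g) x :=
    Finset.sum_le_sum fun i _ => sq_le_sqNorm (weakGrad Ω (fun y => opQ Ω b g y i) x) k
  have hEi : ∀ i, E i ^ 2 ≤ 24 * M ^ 2 * (sqNorm (weakGrad Ω g x) + g x ^ 2) := by
    intro i
    have hr : |rot Ω b x i| ≤ 2 * M := by
      rw [rot_apply_cyclic]
      refine (abs_sub _ _).trans ?_
      linarith [(hx (i + 2) (i + 1) 0).1, (hx (i + 1) (i + 2) 0).1]
    have hr' : |weakDeriv Ω k (weakDeriv Ω (i + 1) fun y => b y (i + 2)) x -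
        weakDeriv Ω k (weakDeriv Ω (i + 2) fun y => b y (i + 1)) x| ≤ 2 * M := by
      refine (abs_sub _ _).trans ?_
      linarith [(hx (i + 2) (i + 1) k).2, (hx (i + 1) (i + 2) k).2]
    set D := sqNorm (weakGrad Ω g x)
    have hd : ∀ j, weakDeriv Ω j g x ^ 2 ≤ D := fun j => sq_le_sqNorm (weakGrad Ω g x) j
    have hD : 0 ≤ D := sqNorm_nonneg _
    have p1 : (weakDeriv Ω (i + 1) g x * weakDeriv Ω k (fun y => b y (i + 2)) x) ^ 2 ≤
        D * M ^ 2 := by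
      rw [mul_pow]
      exact mul_le_mul (hd _) (sq_le_of_abs_le (hx _ k 0).1) (sq_nonneg _) hD
    have p2 : (weakDeriv Ω (i + 2) g x * weakDeriv Ω k (fun y => b y (i + 1)) x) ^ 2 ≤
        D * M ^ 2 := by
      rw [mul_pow]
      exact mul_le_mul (hd _) (sq_le_of_abs_le (hx _ k 0).1) (sq_nonneg _) hD
    have p3 : (weakDeriv Ω k g x * rot Ω b x i) ^ 2 ≤ D * (2 * M) ^ 2 := by
      rw [mul_pow]
      exact mul_le_mul (hd _) (sq_le_of_abs_le hr) (sq_nonneg _) hD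
    have p4 : (g x * (weakDeriv Ω k (weakDeriv Ω (i + 1) fun y => b y (i + 2)) x -
        weakDeriv Ω k (weakDeriv Ω (i + 2) fun y => b y (i + 1)) x)) ^ 2 ≤
        g x ^ 2 * (2 * M) ^ 2 := by
      rw [mul_pow]
      exact mul_le_mul_of_nonneg_left (sq_le_of_abs_le hr') (sq_nonneg _)
    have four : ∀ a b c d : ℝ, (a - b + c + d) ^ 2 ≤ 4 * (a ^ 2 + b ^ 2 + c ^ 2 + d ^ 2) := by
      intro a b c d
      nlinarith [sq_nonneg (a + b), sq_nonneg (a - c), sq_nonneg (a - d), sq_nonneg (b + c),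
        sq_nonneg (b + d), sq_nonneg (c - d)]
    refine (four _ _ _ _).trans ?_
    have : 0 ≤ D * M ^ 2 := by positivity
    have : 0 ≤ g x ^ 2 * M ^ 2 := by positivity
    nlinarith
  have hEle : sqNorm E ≤ 72 * M ^ 2 * (sqNorm (weakGrad Ω g x) + g x ^ 2) := by
    refine (Finset.sum_le_sum fun i _ => hEi i).trans_eq ?_
    simp
    ring
  rw [h1]
  refine (sqNorm_sub_le _ _).trans ?_
  have q1 : 0 ≤ M ^ 2 * sqNormGrad Ω (opQ Ω b g) x :=
    mul_nonneg (sq_nonneg _) (Finset.sum_nonneg fun i _ => sqNorm_nonneg _)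
  have q2 : 0 ≤ sqNorm (weakGrad Ω g x) + g x ^ 2 := add_nonneg (sqNorm_nonneg _) (sq_nonneg _)
  nlinarith

/-- The derivative along `b × c` in terms of `∇v × b`. -/
theorem sq_sum_cross_le (b c v : Fin 3 → ℝ) :
    (∑ j, (b (j + 1) * c (j + 2) - b (j + 2) * c (j + 1)) * v j) ^ 2 ≤
      sqNorm c * sqNorm (crossProduct v b) := by
  have e : ∑ j, (b (j + 1) * c (j + 2) - b (j + 2) * c (j + 1)) * v j =
      ∑ j, c j * crossProduct v b j := by
    simp only [crossProduct_apply_cyclic, Fin.sum_univ_three]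
    norm_num [show (1 : Fin 3) + 2 = 0 from rfl, show (2 : Fin 3) + 1 = 0 from rfl,
        show (2 : Fin 3) + 2 = 1 from rfl, show (1 : Fin 3) + 1 = 2 from rfl]
    ring
  rw [e]
  exact sq_sum_mul_le _ _

/-! ### Integral inequalities and absorption -/

/-- Splitting the integral needs one measurable summand; the other may be an expression such as
`|Pf|²w`, whose measurability then never has to be checked. -/
theorem lintegral_ofReal_le_mul_add {μ : Measure E3} {F a b : E3 → ℝ} {c : ℝ} (hc : 0 ≤ c)
    (hb : AEMeasurable b μ) (h : ∀ᵐ x ∂μ, F x ≤ c * (a x + b x)) :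
    ∫⁻ x, ENNReal.ofReal (F x) ∂μ ≤
      ENNReal.ofReal c * ((∫⁻ x, ENNReal.ofReal (a x) ∂μ) + ∫⁻ x, ENNReal.ofReal (b x) ∂μ) := by
  rw [← lintegral_add_right' _ hb.ennreal_ofReal, ← lintegral_const_mul' _ _ ENNReal.ofReal_ne_top]
  refine lintegral_mono_ae (h.mono fun x hx => ?_)
  calc ENNReal.ofReal (F x) ≤ ENNReal.ofReal (c * (a x + b x)) := ENNReal.ofReal_le_ofReal hx
    _ = ENNReal.ofReal c * ENNReal.ofReal (a x + b x) := ENNReal.ofReal_mul hc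
    _ ≤ _ := by gcongr; exact ENNReal.ofReal_add_le

theorem lintegral_ofReal_le_mul {μ : Measure E3} {F a : E3 → ℝ} {c : ℝ} (hc : 0 ≤ c)
    (h : ∀ᵐ x ∂μ, F x ≤ c * a x) :
    ∫⁻ x, ENNReal.ofReal (F x) ∂μ ≤ ENNReal.ofReal c * ∫⁻ x, ENNReal.ofReal (a x) ∂μ := by
  rw [← lintegral_const_mul' _ _ ENNReal.ofReal_ne_top]
  refine lintegral_mono_ae (h.mono fun x hx => ?_)
  rw [← ENNReal.ofReal_mul hc]
  exact ENNReal.ofReal_le_ofReal hx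

/-- The lower integral is superadditive, so this direction needs no measurability. It reassembles
the right-hand side of the estimate for `Q`. -/
theorem le_lintegral_ofReal_add {μ : Measure E3} {a b : E3 → ℝ} (ha : ∀ x, 0 ≤ a x)
    (hb : ∀ x, 0 ≤ b x) :
    (∫⁻ x, ENNReal.ofReal (a x) ∂μ) + (∫⁻ x, ENNReal.ofReal (b x) ∂μ) ≤
      ∫⁻ x, ENNReal.ofReal (a x + b x) ∂μ := by
  simp_rw [fun x => ENNReal.ofReal_add (ha x) (hb x)]
  exact le_lintegral_add _ _

/-- Absorption of a small multiple of the left-hand side. -/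
theorem le_two_mul_of_le_mul_add {I R A ε : ENNReal} (h : I ≤ A * (R + ε * I))
    (hε : A * ε ≤ 2⁻¹) (hI : I ≠ ⊤) : I ≤ 2 * A * R := by
  have h1 : I ≤ A * R + 2⁻¹ * I := by
    refine h.trans ?_
    rw [mul_add, ← mul_assoc A ε]
    gcongr
  have h2 : I = 2⁻¹ * I + 2⁻¹ * I := by
    rw [← add_mul, ENNReal.inv_two_add_inv_two, one_mul]
  -- Cancellation in `ENNReal` requires this finiteness.
  have h3 : (2 : ENNReal)⁻¹ * I ≠ ⊤ := ENNReal.mul_ne_top (by simp) hI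
  have h4 : 2⁻¹ * I ≤ A * R := by
    refine (ENNReal.add_le_add_iff_right h3).1 ?_
    rwa [← h2]
  calc I = 2 * (2⁻¹ * I) := by
        rw [← mul_assoc, ENNReal.mul_inv_cancel (by simp) (by simp), one_mul]
    _ ≤ 2 * (A * R) := by gcongr
    _ = 2 * A * R := by ring

theorem mul_ofReal_div_sq_le_half {A : NNReal} {L s : ℝ} (hs : 1 ≤ s) (h : 2 * L ^ 2 * A ≤ s) :
    (A : ENNReal) * ENNReal.ofReal (L ^ 2 / s ^ 2) ≤ 2⁻¹ := by
  rw [← ENNReal.ofReal_coe_nnreal, ← ENNReal.ofReal_mul A.coe_nonneg,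
    ← ENNReal.ofReal_ofNat 2, ← ENNReal.ofReal_inv_of_pos (by norm_num)]
  refine ENNReal.ofReal_le_ofReal ?_
  rw [mul_div_assoc', div_le_iff₀ (by positivity)]
  nlinarith

theorem sqNorm_aestronglyMeasurable {μ : Measure E3} {v : E3 → Fin 3 → ℝ}
    (h : ∀ j, AEStronglyMeasurable (fun x => v x j) μ) :
    AEStronglyMeasurable (fun x => sqNorm (v x)) μ :=
  Finset.aestronglyMeasurable_fun_sum _ fun j _ => (h j).pow 2

/-- Supplies the finiteness without which absorption is illegitimate; for fixed parameters the
weights are bounded on a compact set. -/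
theorem lintegral_weighted_ne_top {μ : Measure E3} {S : Set E3} (hS : IsCompact S)
    (hμ : ∀ᵐ x ∂μ, x ∈ S) {f : E3 → ℝ} {v : E3 → Fin 3 → ℝ} (hf : MemLp f 2 μ)
    (hv : ∀ j, MemLp (fun x => v x j) 2 μ) {w q : E3 → ℝ} (hw : ContinuousOn w S) (hq : ContinuousOn q S) :
    ∫⁻ x, ENNReal.ofReal ((sqNorm (v x) + q x ^ 2 * f x ^ 2) * w x) ∂μ ≠ ⊤ := by
  obtain ⟨B, hB⟩ := hS.exists_bound_of_continuousOn hw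
  obtain ⟨D, hD⟩ := hS.exists_bound_of_continuousOn ((hq.pow 2).mul hw)
  have hint : Integrable (fun x => B * sqNorm (v x) + D * f x ^ 2) μ := by
    refine Integrable.add (Integrable.const_mul ?_ _) (hf.integrable_sq.const_mul _)
    exact integrable_finsetSum _ fun j _ => (hv j).integrable_sq
  refine (lt_of_le_of_lt (lintegral_mono_ae ?_) hint.lintegral_lt_top).ne
  filter_upwards [hμ] with x hx
  refine ENNReal.ofReal_le_ofReal ?_
  have h1 : w x ≤ B := (le_abs_self _).trans (hB x hx)
  have h2 : q x ^ 2 * w x ≤ D := (le_abs_self _).trans (hD x hx)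
  have h3 : w x * sqNorm (v x) ≤ B * sqNorm (v x) := by
    have := sqNorm_nonneg (v x)
    gcongr
  have h4 : q x ^ 2 * w x * f x ^ 2 ≤ D * f x ^ 2 := by gcongr
  linarith

/-! ### Shifted weights and the lower bound for `sλφ` -/

/-- The Carleman estimate with the weight `w` on the left-hand side. -/
theorem exists_carleman_estimate_inv (hΩ : IsSmoothBoundedDomain Ω) {d : E3 → ℝ}
    (hd : ContDiffOn ℝ 2 d (closure Ω)) (hd0 : ∀ x ∈ closure Ω, 0 ≤ d x) {l : ℝ → ℝ} {t₀ : ℝ}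
    (hl : 0 < l t₀) {G : Set E3} {X X' : Fin 3 → E3 → ℝ} {κ : ℝ}
    (hX : IsTransversalField Ω G d X X' κ) :
    ∃ s₀ : ℝ, 1 ≤ s₀ ∧ ∃ C : NNReal, ∀ lam s : ℝ, 1 ≤ lam → s₀ ≤ s → ∀ v τ : E3 → ℝ,
      MemW Ω 2 1 v → IsTrace Ω v τ →
      ∫⁻ x in Ω, ENNReal.ofReal (v x ^ 2 * weight Ω d l lam s x t₀) ≤
        C * ((∫⁻ x in Ω, ENNReal.ofReal (1 / (s * lam * phi d l lam x t₀) ^ 2 *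
            weight Ω d l lam s x t₀ * (∑ j, X j x * weakDeriv Ω j v x) ^ 2)) +
          ∫⁻ x in G, ENNReal.ofReal (1 / (s * lam * phi d l lam x t₀) *
            weight Ω d l lam s x t₀ * τ x ^ 2) ∂surfaceMeasure Ω) := by
  obtain ⟨s₀, hs₀, C, hC⟩ := exists_carleman_estimate hΩ hd hd0 hl hX (k := -2) (by norm_num)
  refine ⟨s₀, hs₀, C, fun lam s hlam hs v τ hv hτ => ?_⟩
  have hs0 : 0 < s := by linarith
  have hlam0 : 0 < lam := by linarith
  -- `r e^{-2λd} = 1/q²`. Multiplying by `r` turns the weights `q²W`, `W`, `qW` for `k = -2` into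
  -- `w`, `w/q²`, `w/q`.
  set r : ℝ := (l t₀ / (s * lam)) ^ 2 with hr
  have hr0 : 0 ≤ r := sq_nonneg _
  have h := mul_le_mul_right (hC lam s hlam hs v τ hv hτ) (ENNReal.ofReal r)
  have hexp : ∀ x, Real.exp (-2 * lam * d x) = (Real.exp (lam * d x) ^ 2)⁻¹ := fun x => by
    rw [← Real.exp_nat_mul, ← Real.exp_neg]
    congr 1
    push_cast
    ring
  rw [mul_left_comm, mul_add] at h
  iterate 3 rw [← lintegral_const_mul' _ _ ENNReal.ofReal_ne_top] at h
  simp_rw [← ENNReal.ofReal_mul hr0] at h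
  convert h using 3 with x
  · congr 1
    have := Real.exp_pos (lam * d x)
    rw [expWeight, hexp, hr, phi]
    field_simp
  · refine congrArg _ (funext fun x => congrArg _ ?_)
    have := Real.exp_pos (lam * d x)
    rw [expWeight, hexp, hr, phi]
    field_simp
  · refine congrArg _ (funext fun x => congrArg _ ?_)
    have := Real.exp_pos (lam * d x)
    rw [expWeight, hexp, hr, phi]
    field_simp

theorem expWeight_zero (Ω : Set E3) (d : E3 → ℝ) (l : ℝ → ℝ) (t₀ lam s : ℝ) (x : E3) :
    expWeight Ω d l t₀ 0 lam s x = weight Ω d l lam s x t₀ := by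
  simp [expWeight]

/-- A lower bound free of `λ`: the absorption of lower-order terms can be driven by `s` alone. -/
theorem div_le_mul_phi {d : E3 → ℝ} {l : ℝ → ℝ} {t₀ lam s : ℝ} {x : E3} (hl : 0 < l t₀)
    (hs : 0 ≤ s) (hlam : 1 ≤ lam) (hx : 0 ≤ d x) : s / l t₀ ≤ s * lam * phi d l lam x t₀ := by
  have h1 : 1 ≤ Real.exp (lam * d x) := Real.one_le_exp (by positivity)
  rw [phi, mul_div_assoc']
  gcongr
  rw [mul_assoc]
  exact le_mul_of_one_le_right hs (one_le_mul_of_one_le_of_one_le hlam h1)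

theorem sq_le_mul_sq_mul_phi {d : E3 → ℝ} {l : ℝ → ℝ} {t₀ lam s : ℝ} {x : E3} (hl : 0 < l t₀)
    (hs : 0 < s) (hlam : 1 ≤ lam) (hx : 0 ≤ d x) (a : ℝ) :
    a ^ 2 ≤ l t₀ ^ 2 / s ^ 2 * ((s * lam * phi d l lam x t₀) ^ 2 * a ^ 2) := by
  have h1 := pow_le_pow_left₀ (by positivity) (div_le_mul_phi hl hs.le hlam hx) 2
  have h2 : l t₀ ^ 2 / s ^ 2 * (s / l t₀) ^ 2 = 1 := by field_simp
  calc a ^ 2 = l t₀ ^ 2 / s ^ 2 * ((s / l t₀) ^ 2 * a ^ 2) := by rw [← mul_assoc, h2, one_mul]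
    _ ≤ _ := by gcongr

theorem weight_pos (Ω : Set E3) (d : E3 → ℝ) (l : ℝ → ℝ) (t₀ lam s : ℝ) (x : E3) :
    0 < weight Ω d l lam s x t₀ := Real.exp_pos _

theorem continuousOn_weight {d : E3 → ℝ} {S : Set E3} (hd : ContinuousOn d S) (l : ℝ → ℝ)
    (t₀ lam s : ℝ) : ContinuousOn (fun x => weight Ω d l lam s x t₀) S := by
  have h := continuousOn_expWeight (Ω := Ω) hd l t₀ 0 lam s
  exact h.congr fun x _ => (expWeight_zero Ω d l t₀ lam s x).symm

/-- The weighted `H¹` integral is finite. -/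
theorem lintegral_energy_ne_top (hΩ : IsSmoothBoundedDomain Ω) {d : E3 → ℝ}
    (hd : ContinuousOn d (closure Ω)) {f : E3 → ℝ} (hf : MemW Ω 2 1 f) (l : ℝ → ℝ)
    (t₀ lam s : ℝ) :
    ∫⁻ x in Ω, ENNReal.ofReal ((sqNorm (weakGrad Ω f x) +
      (s * lam * phi d l lam x t₀) ^ 2 * f x ^ 2) * weight Ω d l lam s x t₀) ≠ ⊤ :=
  lintegral_weighted_ne_top (S := closure Ω) hΩ.isBounded.isCompact_closure
    ((ae_restrict_mem hΩ.isOpen.measurableSet).mono fun _ hx => subset_closure hx) hf.1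
    (fun j => (hf.2 j).2) (continuousOn_weight hd l t₀ lam s)
    (continuousOn_const.mul (continuousOn_phi hd l lam t₀))

/-! ### The Carleman estimates for `P` and `Q` -/

/-- The Carleman estimate for `P`. -/
theorem exists_carleman_opP (hΩ : IsSmoothBoundedDomain Ω) {Γ : Set E3} (hΓ : MeasurableSet Γ)
    {d : E3 → ℝ} (hd : IsWeightFunction Ω Γ d) {l : ℝ → ℝ} {t₀ : ℝ} (hl : 0 < l t₀)
    {A : E3 → Matrix (Fin 3) (Fin 3) ℝ} (hA : ∀ k j, MemW Ω ⊤ 1 (fun x => A x k j))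
    (hAc : ContinuousOn A (closure Ω)) (hdet : ∀ x ∈ closure Ω, (A x).det ≠ 0) :
    ∃ s₀ : ℝ, 1 ≤ s₀ ∧ ∃ C : NNReal, ∀ lam s : ℝ, 1 ≤ lam → s₀ ≤ s → ∀ f τ : E3 → ℝ,
      MemW Ω 2 1 f → IsTrace Ω f τ →
      ∫⁻ x in Ω, ENNReal.ofReal ((sqNorm (weakGrad Ω f x) +
          (s * lam * phi d l lam x t₀) ^ 2 * f x ^ 2) * weight Ω d l lam s x t₀) ≤
        C * ((∫⁻ x in Ω, ENNReal.ofReal (sqNorm (opP Ω A f x) * weight Ω d l lam s x t₀)) +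
          ∫⁻ x in Γ, ENNReal.ofReal (s * lam * phi d l lam x t₀ * τ x ^ 2 *
            weight Ω d l lam s x t₀) ∂surfaceMeasure Ω) := by
  have hdc := hd.contDiffOn.continuousOn
  obtain ⟨X', κ, hX⟩ := hd.exists_isTransversalField hΩ hΓ
  obtain ⟨s₀, hs₀, C₀, hC₀⟩ := exists_carleman_estimate hΩ hd.contDiffOn hd.nonneg hl hX (k := 0)
    (by norm_num)
  obtain ⟨N, hN⟩ := hΩ.isBounded.isCompact_closure.exists_bound_of_continuousOn
    (continuousOn_sqNorm hX.continuousOn)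
  obtain ⟨M, hM0, hM⟩ := exists_sqNorm_weakGrad_le hΩ.isBounded hΩ.isOpen hA hAc hdet
  set N' : NNReal := N.toNNReal with hN'
  set M' : NNReal := M.toNNReal with hM'
  -- The gradient integral, bounded with `M'`, enters directly and once more through `(∇d·∇f)² ≤
  -- N'|∇f|²` in the transport estimate with constant `C₀`.
  set B : NNReal := (1 + C₀ * N') * M' + C₀ with hB
  -- The second threshold makes `B ε ≤ 1/2` for `ε = l(t₀)²/s²`; absorption then doubles the
  -- constant.
  refine ⟨max s₀ (2 * l t₀ ^ 2 * B), le_max_of_le_left hs₀, 2 * B, fun lam s hlam hs f τ hf hτ => ?_⟩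
  have hs₁ : s₀ ≤ s := (le_max_left _ _).trans hs
  have hs0 : 0 < s := by linarith
  have key := hC₀ lam s hlam hs₁ f τ hf hτ
  simp only [expWeight_zero] at key
  set q : E3 → ℝ := fun x => s * lam * phi d l lam x t₀ with hq
  set w : E3 → ℝ := fun x => weight Ω d l lam s x t₀ with hw
  have hw0 : ∀ x, 0 < w x := fun x => weight_pos ..
  have hmΩ : ∀ᵐ x ∂volume.restrict Ω, x ∈ closure Ω :=
    (ae_restrict_mem hΩ.isOpen.measurableSet).mono fun _ hx => subset_closure hx
  have hwm : AEStronglyMeasurable w (volume.restrict Ω) :=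
    ((continuousOn_weight hdc l t₀ lam s).mono subset_closure).aestronglyMeasurable
      hΩ.isOpen.measurableSet
  have hqm : AEStronglyMeasurable q (volume.restrict Ω) :=
    ((continuousOn_const.mul (continuousOn_phi hdc l lam t₀)).mono
      subset_closure).aestronglyMeasurable hΩ.isOpen.measurableSet
  have hfm : AEStronglyMeasurable f (volume.restrict Ω) := hf.1.aestronglyMeasurable
  set ε : ENNReal := ENNReal.ofReal (l t₀ ^ 2 / s ^ 2) with hε
  set I := ∫⁻ x in Ω, ENNReal.ofReal ((sqNorm (weakGrad Ω f x) + q x ^ 2 * f x ^ 2) * w x) with hI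
  set P := ∫⁻ x in Ω, ENNReal.ofReal (sqNorm (opP Ω A f x) * w x) with hP
  set S := ∫⁻ x in Γ, ENNReal.ofReal (q x * τ x ^ 2 * w x) ∂surfaceMeasure Ω with hS
  have hItop : I ≠ ⊤ := lintegral_energy_ne_top hΩ hdc hf l t₀ lam s
  have hZ : ∫⁻ x in Ω, ENNReal.ofReal (f x ^ 2 * w x) ≤ ε * I := by
    refine lintegral_ofReal_le_mul (by positivity) (hmΩ.mono fun x hx => ?_)
    rw [← mul_assoc]
    refine mul_le_mul_of_nonneg_right ?_ (hw0 x).le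
    refine (sq_le_mul_sq_mul_phi hl hs0 hlam (hd.nonneg x hx) (f x)).trans ?_
    gcongr
    exact le_add_of_nonneg_left (sqNorm_nonneg _)
  have hJ : ∫⁻ x in Ω, ENNReal.ofReal (sqNorm (weakGrad Ω f x) * w x) ≤ M' * (P + ε * I) := by
    refine (lintegral_ofReal_le_mul_add (b := fun x => f x ^ 2 * w x) hM0
      ((hfm.pow 2).mul hwm).aemeasurable ((hM f).mono fun x hx => ?_)).trans (by gcongr; rfl)
    rw [← add_mul, ← mul_assoc]
    exact mul_le_mul_of_nonneg_right hx (hw0 x).le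
  have hX' : ∫⁻ x in Ω, ENNReal.ofReal (w x * (∑ j, gradClosure Ω d x j * weakDeriv Ω j f x) ^ 2) ≤
      N' * ∫⁻ x in Ω, ENNReal.ofReal (sqNorm (weakGrad Ω f x) * w x) := by
    refine (lintegral_ofReal_le_mul N'.coe_nonneg (hmΩ.mono fun x hx => ?_)).trans_eq
      (by rw [ENNReal.ofReal_coe_nnreal])
    have h1 := sq_sum_mul_le (gradClosure Ω d x) (weakGrad Ω f x)
    have h2 : sqNorm (gradClosure Ω d x) ≤ N' :=
      ((le_abs_self _).trans (hN x hx)).trans (Real.le_coe_toNNReal N)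
    rw [← mul_assoc, mul_comm]
    refine mul_le_mul_of_nonneg_right (h1.trans ?_) (hw0 x).le
    exact mul_le_mul_of_nonneg_right h2 (sqNorm_nonneg _)
  have hS' : ∫⁻ x in Γ, ENNReal.ofReal (q x * w x * τ x ^ 2) ∂surfaceMeasure Ω = S := by
    simp only [hS, mul_right_comm]
  have hsplit : I ≤ (∫⁻ x in Ω, ENNReal.ofReal (sqNorm (weakGrad Ω f x) * w x)) +
      ∫⁻ x in Ω, ENNReal.ofReal (q x ^ 2 * w x * f x ^ 2) := by
    refine (lintegral_ofReal_le_mul_add (b := fun x => q x ^ 2 * w x * f x ^ 2) zero_le_one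
      (((hqm.pow 2).mul hwm).mul (hfm.pow 2)).aemeasurable
      (Eventually.of_forall fun x => le_of_eq ?_)).trans_eq (by rw [ENNReal.ofReal_one, one_mul])
    ring
  have hmain : I ≤ B * ((P + S) + ε * I) := by
    calc I ≤ M' * (P + ε * I) + C₀ * (N' * (M' * (P + ε * I)) + S) := by
          refine hsplit.trans (add_le_add hJ (key.trans ?_))
          rw [hS']
          gcongr
          exact hX'.trans (by gcongr)
      _ ≤ (1 + C₀ * N') * M' * (P + S + ε * I) + C₀ * (P + S + ε * I) := by
          have e : (M' : ENNReal) * (P + ε * I) + C₀ * (N' * (M' * (P + ε * I)) + S) =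
            (1 + C₀ * N') * M' * (P + ε * I) + C₀ * S := by ring
          rw [e]
          gcongr ?_ * ?_ + ?_ * ?_
          · rfl
          · gcongr
            exact le_self_add
          · rfl
          · exact le_add_right le_add_self
      _ = B * ((P + S) + ε * I) := by
          rw [hB]
          push_cast
          ring
  refine (le_two_mul_of_le_mul_add hmain
    (mul_ofReal_div_sq_le_half (hs₀.trans hs₁) ((le_max_right _ _).trans hs)) hItop).trans_eq ?_
  push_cast
  rfl

/-- The Carleman estimate for `Q`. -/
theorem exists_carleman_opQ (hΩ : IsSmoothBoundedDomain Ω) {Γ : Set E3}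
    {d : E3 → ℝ} (hd : IsWeightFunction Ω Γ d) {l : ℝ → ℝ} {t₀ : ℝ} (hl : 0 < l t₀)
    {b : E3 → Fin 3 → ℝ} (hb : ∀ i, MemW Ω ⊤ 2 (fun x => b x i)) (hbc : ContinuousOn b (closure Ω))
    (hcross : ∀ x ∈ closure Ω, crossProduct (gradClosure Ω d x) (b x) ≠ 0) :
    ∃ s₀ : ℝ, 1 ≤ s₀ ∧ ∃ C : NNReal, ∀ lam s : ℝ, 1 ≤ lam → s₀ ≤ s →
      ∀ (g τ : E3 → ℝ) (τ' : Fin 3 → E3 → ℝ), MemW Ω 2 2 g → IsTrace Ω g τ →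
      (∀ j, IsTrace Ω (weakDeriv Ω j g) (τ' j)) →
      ∫⁻ x in Ω, ENNReal.ofReal ((sqNorm (weakGrad Ω g x) +
          (s * lam * phi d l lam x t₀) ^ 2 * g x ^ 2) * weight Ω d l lam s x t₀) ≤
        C * ((∫⁻ x in Ω, ENNReal.ofReal ((1 / (s * lam * phi d l lam x t₀) ^ 2 *
            sqNormGrad Ω (opQ Ω b g) x + sqNorm (opQ Ω b g x)) * weight Ω d l lam s x t₀)) +
          ∫⁻ x, ENNReal.ofReal ((1 / (s * lam * phi d l lam x t₀) * sqNorm (fun j => τ' j x) +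
            s * lam * phi d l lam x t₀ * τ x ^ 2) * weight Ω d l lam s x t₀)
            ∂surfaceMeasure Ω) := by
  have hdc := hd.contDiffOn.continuousOn
  obtain ⟨c, hc, X', κ, hX⟩ := exists_isTransversalField_cross hΩ hd.contDiffOn
    (fun i => (hb i).of_succ) hbc hcross
  obtain ⟨s₁, hs₁, C₁, hC₁⟩ := exists_carleman_estimate hΩ hd.contDiffOn hd.nonneg hl hX (k := 0)
    (by norm_num)
  obtain ⟨s₂, hs₂, C₂, hC₂⟩ := exists_carleman_estimate_inv hΩ hd.contDiffOn hd.nonneg hl hX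
  obtain ⟨N, hN⟩ := hΩ.isBounded.isCompact_closure.exists_bound_of_continuousOn
    (continuousOn_sqNorm (v := fun x j => c j x) fun j => (hc j).continuous.continuousOn)
  obtain ⟨M₁, hM₁0, hM₁⟩ := exists_sqNorm_cross_le hb
  obtain ⟨M₂, hM₂0, hM₂⟩ := exists_sqNorm_cross_weakGrad_le hΩ.isOpen hb
  set N' : NNReal := N.toNNReal with hN'
  set K₁ : NNReal := N' * M₁.toNNReal with hK₁
  set K₂ : NNReal := N' * M₂.toNNReal with hK₂
  -- `C₁` belongs to the estimate for `g`, `C₂` to the one for the three derivatives `∂ₖg`.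
  set B : NNReal := 3 * (C₂ * K₂) + C₂ + C₁ * K₁ + C₁ with hB
  -- The condition `l t₀ ≤ s` gives `e ≤ 1`, hence `g² ≤ q²g²`; the last one allows absorption.
  refine ⟨max (max s₁ s₂) (max (l t₀) (2 * l t₀ ^ 2 * B)),
    le_max_of_le_left (le_max_of_le_left hs₁), 2 * B,
    fun lam s hlam hs g τ τ' hg hτ hτ' => ?_⟩
  obtain ⟨⟨hs₁', hs₂'⟩, hs₃, hs₄⟩ :
      (s₁ ≤ s ∧ s₂ ≤ s) ∧ l t₀ ≤ s ∧ 2 * l t₀ ^ 2 * B ≤ s := by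
    simpa only [max_le_iff] using hs
  have hs0 : 0 < s := by linarith
  have hlam0 : 0 < lam := by linarith
  have key₁ := hC₁ lam s hlam hs₁' g τ hg.of_succ hτ
  have key₂ := fun k => hC₂ lam s hlam hs₂' (weakDeriv Ω k g) (τ' k) (hg.2 k).2 (hτ' k)
  simp only [expWeight_zero] at key₁
  set q : E3 → ℝ := fun x => s * lam * phi d l lam x t₀ with hq
  set w : E3 → ℝ := fun x => weight Ω d l lam s x t₀ with hw
  have hw0 : ∀ x, 0 < w x := fun x => weight_pos ..
  have hq0 : ∀ x, 0 < q x := fun x => mul_pos (mul_pos hs0 hlam0) (div_pos (Real.exp_pos _) hl)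
  have hmΩ : ∀ᵐ x ∂volume.restrict Ω, x ∈ closure Ω :=
    (ae_restrict_mem hΩ.isOpen.measurableSet).mono fun _ hx => subset_closure hx
  have hwm : AEStronglyMeasurable w (volume.restrict Ω) :=
    ((continuousOn_weight hdc l t₀ lam s).mono subset_closure).aestronglyMeasurable
      hΩ.isOpen.measurableSet
  have hqm : AEStronglyMeasurable q (volume.restrict Ω) :=
    ((continuousOn_const.mul (continuousOn_phi hdc l lam t₀)).mono
      subset_closure).aestronglyMeasurable hΩ.isOpen.measurableSet
  have hgm : AEStronglyMeasurable g (volume.restrict Ω) := hg.1.aestronglyMeasurable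
  have hvm : AEStronglyMeasurable (fun x => sqNorm (weakGrad Ω g x)) (volume.restrict Ω) :=
    sqNorm_aestronglyMeasurable fun j => (hg.2 j).2.1.aestronglyMeasurable
  set e : ℝ := l t₀ ^ 2 / s ^ 2 with he
  have he0 : 0 ≤ e := by positivity
  have hqe : ∀ x ∈ closure Ω, ∀ a : ℝ, a ^ 2 ≤ e * (q x ^ 2 * a ^ 2) := fun x hx a =>
    sq_le_mul_sq_mul_phi hl hs0 hlam (hd.nonneg x hx) a
  have he1 : e ≤ 1 := by
    rw [he, div_le_one (by positivity)]
    exact pow_le_pow_left₀ hl.le hs₃ 2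
  set ε : ENNReal := ENNReal.ofReal e with hε
  set I := ∫⁻ x in Ω, ENNReal.ofReal ((sqNorm (weakGrad Ω g x) + q x ^ 2 * g x ^ 2) * w x) with hI
  set D := ∫⁻ x in Ω, ENNReal.ofReal (1 / q x ^ 2 * sqNormGrad Ω (opQ Ω b g) x * w x) with hD
  set R := ∫⁻ x in Ω, ENNReal.ofReal (sqNorm (opQ Ω b g x) * w x) with hR
  set S := ∫⁻ x, ENNReal.ofReal (q x * τ x ^ 2 * w x) ∂surfaceMeasure Ω with hS
  set S' := fun k => ∫⁻ x, ENNReal.ofReal (1 / q x * w x * τ' k x ^ 2) ∂surfaceMeasure Ω with hS'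
  have hItop : I ≠ ⊤ := lintegral_energy_ne_top hΩ hdc hg.of_succ l t₀ lam s
  have hN0 : ∀ x ∈ closure Ω, sqNorm (fun j => c j x) ≤ N' := fun x hx =>
    ((le_abs_self _).trans (hN x hx)).trans (Real.le_coe_toNNReal N)
  have hXle : ∀ x ∈ closure Ω, ∀ v : Fin 3 → ℝ,
      (∑ j, (b x (j + 1) * c (j + 2) x - b x (j + 2) * c (j + 1) x) * v j) ^ 2 ≤
        N' * sqNorm (crossProduct v (b x)) := fun x hx v =>
    (sq_sum_cross_le (b x) (fun j => c j x) v).trans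
      (mul_le_mul_of_nonneg_right (hN0 x hx) (sqNorm_nonneg _))
  have hZ : ∫⁻ x in Ω, ENNReal.ofReal (g x ^ 2 * w x) ≤ ε * I := by
    refine lintegral_ofReal_le_mul he0 (hmΩ.mono fun x hx => ?_)
    rw [← mul_assoc]
    refine mul_le_mul_of_nonneg_right ((hqe x hx (g x)).trans ?_) (hw0 x).le
    gcongr
    exact le_add_of_nonneg_left (sqNorm_nonneg _)
  have hX₁ : ∫⁻ x in Ω, ENNReal.ofReal (w x *
      (∑ j, (b x (j + 1) * c (j + 2) x - b x (j + 2) * c (j + 1) x) * weakDeriv Ω j g x) ^ 2) ≤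
      K₁ * (R + ε * I) := by
    refine (lintegral_ofReal_le_mul_add (b := fun x => g x ^ 2 * w x) K₁.coe_nonneg
      ((hgm.pow 2).mul hwm).aemeasurable ?_).trans
      (by rw [ENNReal.ofReal_coe_nnreal]; gcongr)
    filter_upwards [hmΩ, hM₁ g] with x hx hx'
    have h1 := (hXle x hx (weakGrad Ω g x)).trans (mul_le_mul_of_nonneg_left hx' N'.coe_nonneg)
    rw [← add_mul, ← mul_assoc, mul_comm, hK₁, NNReal.coe_mul, Real.coe_toNNReal M₁ hM₁0,
      mul_assoc (N' : ℝ)]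
    exact mul_le_mul_of_nonneg_right h1 (hw0 x).le
  have hX₂ : ∀ k, ∫⁻ x in Ω, ENNReal.ofReal (1 / q x ^ 2 * w x *
      (∑ j, (b x (j + 1) * c (j + 2) x - b x (j + 2) * c (j + 1) x) *
        weakDeriv Ω j (weakDeriv Ω k g) x) ^ 2) ≤ K₂ * (D + ε * I) := by
    intro k
    have hm : AEStronglyMeasurable (fun x => e * ((sqNorm (weakGrad Ω g x) +
        q x ^ 2 * g x ^ 2) * w x)) (volume.restrict Ω) :=
      ((hvm.add ((hqm.pow 2).mul (hgm.pow 2))).mul hwm).const_mul e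
    refine (lintegral_ofReal_le_mul_add
      (a := fun x => 1 / q x ^ 2 * sqNormGrad Ω (opQ Ω b g) x * w x) K₂.coe_nonneg hm.aemeasurable ?_).trans ?_
    · filter_upwards [hmΩ, hM₂ g τ τ' hg hτ hτ' k] with x hx hx'
      have h1 := (hXle x hx (weakGrad Ω (weakDeriv Ω k g) x)).trans
        (mul_le_mul_of_nonneg_left hx' N'.coe_nonneg)
      have h2 : 1 / q x ^ 2 ≤ e := by
        have := hqe x hx 1
        rw [div_le_iff₀ (pow_pos (hq0 x) 2)]
        linarith
      have h3 : sqNorm (weakGrad Ω g x) + g x ^ 2 ≤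
          sqNorm (weakGrad Ω g x) + q x ^ 2 * g x ^ 2 := by
        gcongr
        refine (hqe x hx (g x)).trans (mul_le_of_le_one_left (by positivity) he1)
      -- The lower-order error carries the factor `1/q² ≤ e`, so even its `|∇g|²` part is a small
      -- multiple of the left-hand side.
      have h4 : 1 / q x ^ 2 * (sqNorm (weakGrad Ω g x) + g x ^ 2) ≤
          e * (sqNorm (weakGrad Ω g x) + q x ^ 2 * g x ^ 2) :=
        mul_le_mul h2 h3 (add_nonneg (sqNorm_nonneg _) (sq_nonneg _)) he0
      have h5 : 0 ≤ 1 / q x ^ 2 * w x := mul_nonneg (by positivity) (hw0 x).le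
      calc _ ≤ 1 / q x ^ 2 * w x * (N' * (M₂ * (sqNormGrad Ω (opQ Ω b g) x +
              (sqNorm (weakGrad Ω g x) + g x ^ 2)))) := mul_le_mul_of_nonneg_left h1 h5
        _ = N' * M₂ * ((1 / q x ^ 2 * sqNormGrad Ω (opQ Ω b g) x +
              1 / q x ^ 2 * (sqNorm (weakGrad Ω g x) + g x ^ 2)) * w x) := by ring
        _ ≤ N' * M₂ * ((1 / q x ^ 2 * sqNormGrad Ω (opQ Ω b g) x +
              e * (sqNorm (weakGrad Ω g x) + q x ^ 2 * g x ^ 2)) * w x) := by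
            have := (hw0 x).le
            gcongr
        _ = _ := by
            rw [hK₂, NNReal.coe_mul, Real.coe_toNNReal M₂ hM₂0]
            ring
    · rw [ENNReal.ofReal_coe_nnreal]
      gcongr
      exact lintegral_ofReal_le_mul he0 (Eventually.of_forall fun x => le_rfl)
  -- The full gradient is recovered from the transport estimate for each `∂ₖg`, because `∇g × b`
  -- misses the direction of `b`.
  have hJk : ∀ k, ∫⁻ x in Ω, ENNReal.ofReal (weakDeriv Ω k g x ^ 2 * w x) ≤
      C₂ * (K₂ * (D + ε * I) + S' k) := by
    intro k
    have h := key₂ k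
    rw [Measure.restrict_univ] at h
    exact h.trans (by gcongr; exact hX₂ k)
  have hJ : ∫⁻ x in Ω, ENNReal.ofReal (sqNorm (weakGrad Ω g x) * w x) ≤
      3 * (C₂ * K₂) * (D + ε * I) + C₂ * ∑ k, S' k := by
    have h1 : ∀ x, ENNReal.ofReal (sqNorm (weakGrad Ω g x) * w x) =
        ∑ k, ENNReal.ofReal (weakDeriv Ω k g x ^ 2 * w x) := fun x => by
      rw [← ENNReal.ofReal_sum_of_nonneg fun k _ => mul_nonneg (sq_nonneg _) (hw0 x).le,
        ← Finset.sum_mul]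
      rfl
    simp_rw [h1]
    have hm : ∀ k, AEMeasurable (fun x => weakDeriv Ω k g x ^ 2 * w x) (volume.restrict Ω) :=
      fun k => (((hg.2 k).2.1.aestronglyMeasurable.pow 2).mul hwm).aemeasurable
    rw [lintegral_finsetSum' _ fun k _ => (hm k).ennreal_ofReal]
    refine (Finset.sum_le_sum fun k _ => hJk k).trans_eq ?_
    simp only [Fin.sum_univ_three]
    ring
  have hJ₂ : ∫⁻ x in Ω, ENNReal.ofReal (q x ^ 2 * w x * g x ^ 2) ≤
      C₁ * (K₁ * (R + ε * I) + S) := by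
    have hS₁ : ∫⁻ x, ENNReal.ofReal (q x * w x * τ x ^ 2) ∂surfaceMeasure Ω = S := by
      simp only [hS, mul_right_comm]
    rw [Measure.restrict_univ] at key₁
    refine key₁.trans ?_
    rw [hS₁]
    gcongr
  have hsplit : I ≤ (∫⁻ x in Ω, ENNReal.ofReal (sqNorm (weakGrad Ω g x) * w x)) +
      ∫⁻ x in Ω, ENNReal.ofReal (q x ^ 2 * w x * g x ^ 2) := by
    refine (lintegral_ofReal_le_mul_add (b := fun x => q x ^ 2 * w x * g x ^ 2) zero_le_one
      (((hqm.pow 2).mul hwm).mul (hgm.pow 2)).aemeasurable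
      (Eventually.of_forall fun x => le_of_eq ?_)).trans_eq (by rw [ENNReal.ofReal_one, one_mul])
    ring
  have hDR : D + R ≤ ∫⁻ x in Ω, ENNReal.ofReal ((1 / q x ^ 2 * sqNormGrad Ω (opQ Ω b g) x +
      sqNorm (opQ Ω b g x)) * w x) := by
    simp_rw [add_mul]
    exact le_lintegral_ofReal_add
      (fun x => mul_nonneg (mul_nonneg (by positivity)
        (Finset.sum_nonneg fun i _ => sqNorm_nonneg _)) (hw0 x).le)
      fun x => mul_nonneg (sqNorm_nonneg _) (hw0 x).le
  have hSS : (∑ k, S' k) + S ≤ ∫⁻ x, ENNReal.ofReal ((1 / q x * sqNorm (fun j => τ' j x) +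
      q x * τ x ^ 2) * w x) ∂surfaceMeasure Ω := by
    have h0 : ∀ k x, 0 ≤ 1 / q x * w x * τ' k x ^ 2 := fun k x =>
      mul_nonneg (mul_nonneg (one_div_nonneg.2 (hq0 x).le) (hw0 x).le) (sq_nonneg _)
    have h1 : ∀ x, 0 ≤ q x * τ x ^ 2 * w x := fun x =>
      mul_nonneg (mul_nonneg (hq0 x).le (sq_nonneg _)) (hw0 x).le
    rw [Fin.sum_univ_three]
    refine (add_le_add_left ((add_le_add_left (le_lintegral_ofReal_add (h0 0) (h0 1)) _).trans
      (le_lintegral_ofReal_add (fun x => add_nonneg (h0 0 x) (h0 1 x)) (h0 2))) _).trans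
      ((le_lintegral_ofReal_add (fun x => add_nonneg (add_nonneg (h0 0 x) (h0 1 x)) (h0 2 x))
        h1).trans_eq ?_)
    refine lintegral_congr fun x => congrArg _ ?_
    rw [sqNorm, Fin.sum_univ_three]
    ring
  have hmain : I ≤ B * (((D + R) + ((∑ k, S' k) + S)) + ε * I) := by
    set V := ((D + R) + ((∑ k, S' k) + S)) + ε * I with hV
    have v1 : D + ε * I ≤ V := by
      rw [hV, add_assoc D R, add_assoc D]
      gcongr
      exact le_add_self
    have v2 : ∑ k, S' k ≤ V := le_add_right (le_add_left le_self_add)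
    have v3 : R + ε * I ≤ V := by
      rw [hV]
      gcongr
      exact le_add_right le_add_self
    have v4 : S ≤ V := le_add_right (le_add_left le_add_self)
    calc I ≤ (3 * (C₂ * K₂) * (D + ε * I) + C₂ * ∑ k, S' k) + C₁ * (K₁ * (R + ε * I) + S) :=
          hsplit.trans (add_le_add hJ hJ₂)
      _ ≤ (3 * (C₂ * K₂) * V + C₂ * V) + C₁ * (K₁ * V + V) := by gcongr
      _ = B * V := by
          rw [hB]
          push_cast
          ring
  refine (le_two_mul_of_le_mul_add hmain (mul_ofReal_div_sq_le_half (hs₁.trans hs₁') hs₄)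
    hItop).trans ?_
  push_cast
  gcongr

end Carleman

end

theorem theorem3p3
    (Ω : Set E3) (hΩ : IsSmoothBoundedDomain Ω)
    (Γ : Set E3) (hΓne : Γ.Nonempty) (hΓ : ∃ U : Set E3, IsOpen U ∧ Γ = frontier Ω ∩ U)
    (d : E3 → ℝ) (hd : IsWeightFunction Ω Γ d)
    (T t₀ : ℝ) (ht₀ : t₀ ∈ Set.Ioo 0 T) (l : ℝ → ℝ) (hl : IsTimeWeight T t₀ l)
    (A : E3 → Matrix (Fin 3) (Fin 3) ℝ) (hA : ∀ k j, MemW Ω ⊤ 1 (fun x => A x k j))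
    (hAc : ContinuousOn A (closure Ω))
    (b : E3 → Fin 3 → ℝ) (hb : ∀ i, MemW Ω ⊤ 2 (fun x => b x i))
    (hbc : ContinuousOn b (closure Ω))
    (hdet : ∀ x ∈ closure Ω, (A x).det ≠ 0)
    (hcross : ∀ x ∈ closure Ω, crossProduct (gradClosure Ω d x) (b x) ≠ 0) :
    ∃ lam₀ s₀ C : ℝ, 1 ≤ lam₀ ∧ 1 ≤ s₀ ∧ 0 < C ∧
      ∀ lam s : ℝ, lam₀ ≤ lam → s₀ ≤ s →
        (∀ f τ : E3 → ℝ, MemW Ω 2 1 f → IsTrace Ω f τ →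
          (∫⁻ x in Ω, ENNReal.ofReal
              ((sqNorm (weakGrad Ω f x) + s ^ 2 * lam ^ 2 * phi d l lam x t₀ ^ 2 * f x ^ 2)
                * weight Ω d l lam s x t₀))
            ≤ ENNReal.ofReal C * (∫⁻ x in Ω, ENNReal.ofReal
                (sqNorm (opP Ω A f x) * weight Ω d l lam s x t₀))
              + ENNReal.ofReal C * (∫⁻ x in Γ, ENNReal.ofReal
                (s * lam * phi d l lam x t₀ * τ x ^ 2 * weight Ω d l lam s x t₀)
                ∂surfaceMeasure Ω)) ∧
        (∀ (g τ : E3 → ℝ) (τ' : Fin 3 → E3 → ℝ), MemW Ω 2 2 g → IsTrace Ω g τ →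
          (∀ j, IsTrace Ω (weakDeriv Ω j g) (τ' j)) →
          (∫⁻ x in Ω, ENNReal.ofReal
              ((sqNorm (weakGrad Ω g x) + s ^ 2 * lam ^ 2 * phi d l lam x t₀ ^ 2 * g x ^ 2)
                * weight Ω d l lam s x t₀))
            ≤ ENNReal.ofReal C * (∫⁻ x in Ω, ENNReal.ofReal
                ((1 / (s ^ 2 * lam ^ 2 * phi d l lam x t₀ ^ 2) * sqNormGrad Ω (opQ Ω b g) x
                  + sqNorm (opQ Ω b g x)) * weight Ω d l lam s x t₀))
              + ENNReal.ofReal C * (∫⁻ x, ENNReal.ofReal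
                ((1 / (s * lam * phi d l lam x t₀) * sqNorm (fun j => τ' j x)
                  + s * lam * phi d l lam x t₀ * τ x ^ 2) * weight Ω d l lam s x t₀)
                ∂surfaceMeasure Ω)) := by
  have hlt : 0 < l t₀ := hl.pos t₀ ht₀
  have hΓm : MeasurableSet Γ := by
    obtain ⟨U, hU, rfl⟩ := hΓ
    exact isClosed_frontier.measurableSet.inter hU.measurableSet
  obtain ⟨s₁, hs₁, C₁, hC₁⟩ := exists_carleman_opP hΩ hΓm hd hlt hA hAc hdet
  obtain ⟨s₂, -, C₂, hC₂⟩ := exists_carleman_opQ hΩ hd hlt hb hbc hcross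
  have hC : ENNReal.ofReal (C₁ + C₂ + 1 : NNReal) = C₁ + C₂ + 1 := by
    rw [ENNReal.ofReal_coe_nnreal]
    push_cast
    rfl
  -- No largeness of `λ` beyond `1` is needed; the summand `1` makes the common constant positive.
  refine ⟨1, max s₁ s₂, (C₁ + C₂ + 1 : NNReal), le_rfl, le_max_of_le_left hs₁,
    by positivity, fun lam s hlam hs => ⟨fun f τ hf hτ => ?_, fun g τ τ' hg hτ hτ' => ?_⟩⟩
  · rw [← mul_add, hC]
    have h := hC₁ lam s hlam ((le_max_left _ _).trans hs) f τ hf hτ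
    simp only [mul_pow] at h
    exact h.trans (mul_le_mul_left (by rw [add_assoc]; exact le_self_add) _)
  · rw [← mul_add, hC]
    have h := hC₂ lam s hlam ((le_max_right _ _).trans hs) g τ τ' hg hτ hτ'
    simp only [mul_pow] at h
    exact h.trans (mul_le_mul_left (le_add_right le_add_self) _)
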